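/- Let $m,n\ge 2$ be even integers with $mn\ge 6$. Construction. Let $\mathcal G_{m,n}$ be the grid graph with vertices $v_{i,j}$, $0<i<m$, $0<j<n$ (placed at $(i,j)\in\mathbb R^2$), edges joining vertices at distance $1$, $\mathcal A=\{v_{i,j}: i+j \text{ even}\}$, $\mathcal B=\{v_{i,j}: i+j\text{ odd}\}$, and write $\alpha(e)\in\mathcal A$, $\beta(e)\in\mathcal B$ for the endpoints of an edge $e$. Order the edges at $v_{i,j}$ cyclically, clockwise if $i$ is even and counter-clockwise if $i$ is odd; let $\mathfrak e(e)$ and $\mathfrak n(e)$ be the edge following $e$ in the cyclic order at $\alpha(e)$ and at $\beta(e)$, respectively. Put $w(v_{i,j})=\sin\frac{i\pi}{m}\sin\frac{j\pi}{n}$ and $R_e=[0,w(\beta(e))]\times[0,w(\alpha(e))]\subset\mathbb C$. The translation surface $(X_{m,n},\omega_{m,n})$ is obtained from the rectangles $R_e$ by gluing, by translations, the right side of $R_e$ to the left side of $R_{\mathfrak e(e)}$ and the top side of $R_e$ to the bottom side of $R_{\mathfrak n(e)}$; $\omega_{m,n}$ is $dz$ on each rectangle. As $m,n$ are even, the graph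 automorphism $v_{i,j}\mapsto v_{m-i,n-j}$ induces an automorphism $\iota_*$ of $(X_{m,n},\omega_{m,n})$ permuting the rectangles by translations. Let $(X^e_{m,n},\omega^e_{m,n})=(X_{m,n},\omega_{m,n})/\iota_*$. Theorem. $(X^e_{m,n},\omega^e_{m,n})$ is a (compact, connected) translation surface. If $m\le 4$ and $n\le 4$, then $X^e_{m,n}$ is a torus. Now assume that $m>4$ or $n>4$, and set $\gamma=\gcd(m,n)$. 1. If $m/\gamma$ and $n/\gamma$ are both odd, then $X^e_{m,n}$ has genus $\frac{mn-m-n-2\gamma}{4}+1$, and, unless $\{m,n\}=\{2,6\}$, $\omega^e_{m,n}$ has exactly $\gamma$ zeros, each of order $\frac{mn-m-n}{2\gamma}-1$. If $\{m,n\}=\{2,6\}$ (where this order would be $0$), $\omega^e_{m,n}$ has no zeros. 2. Otherwise, $X^e_{m,n}$ has genus $\frac{mn-m-n-\gamma}{4}+1$, and $\omega^e_{m,n}$ has exactly $\gamma/2$ zeros, each of order $\frac{mn-m-n}{\gamma}-1$. -/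

import Mathlib

open Topology

noncomputable section

namespace GridSurface

/-! ### Cyclic orders in the grid -/

/-- The integer points `(i, j)` with `0 < i < m` and `0 < j < n`: the vertices `v_{i,j}` of the
`(m,n)` grid graph. -/
def InGrid (m n : ℕ) (v : ℤ × ℤ) : Prop :=
  0 < v.1 ∧ v.1 < m ∧ 0 < v.2 ∧ v.2 < n

/-- Quarter turn of `u` about the point `v`: clockwise if the first coordinate of `v` is even,
counter-clockwise if it is odd. -/
def turn (v u : ℤ × ℤ) : ℤ × ℤ :=
  if Even v.1 then (v.1 + (u.2 - v.2), v.2 - (u.1 - v.1))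
  else (v.1 - (u.2 - v.2), v.2 + (u.1 - v.1))

/-- The inverse quarter turn. -/
def turnBack (v u : ℤ × ℤ) : ℤ × ℤ :=
  if Even v.1 then (v.1 - (u.2 - v.2), v.2 + (u.1 - v.1))
  else (v.1 + (u.2 - v.2), v.2 - (u.1 - v.1))

open Classical in
/-- For `t` of order dividing four: the first of `t u`, `t (t u)`, `t (t (t u))` that
satisfies `P`, and `u` itself if none of them does. -/
def firstIn {α : Type} (P : α → Prop) (t : α → α) (u : α) : α :=
  if P (t u) then t u
  else if P (t (t u)) then t (t u)
  else if P (t (t (t u))) then t (t (t u))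
  else u

theorem firstIn_mem {α : Type} (P : α → Prop) (t : α → α) (u : α) (hu : P u) :
    P (firstIn P t u) := by
  unfold firstIn
  split_ifs <;> assumption

theorem firstIn_induct {α : Type} (P : α → Prop) (t : α → α) (Q : α → Prop)
    (hQ : ∀ u, Q u → Q (t u)) (u : α) (hu : Q u) : Q (firstIn P t u) := by
  unfold firstIn
  split_ifs
  · exact hQ _ hu
  · exact hQ _ (hQ _ hu)
  · exact hQ _ (hQ _ (hQ _ hu))
  · exact hu

theorem firstIn_firstIn {α : Type} (P : α → Prop) (t s : α → α) (hst : ∀ u, s (t u) = u)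
    (h4 : ∀ u, t (t (t (t u))) = u) (u : α) (hu : P u) :
    firstIn P s (firstIn P t u) = u := by
  have hs : ∀ u, s u = t (t (t u)) := fun u => by
    conv_lhs => rw [← h4 u]
    exact hst _
  have hcases : firstIn P s = firstIn P (fun x => t (t (t x))) :=
    congrArg (firstIn P) (funext hs)
  rw [hcases]
  by_cases h1 : P (t u)
  · simp [firstIn, h1, h4, hu]
  · by_cases h2 : P (t (t u))
    · simp [firstIn, h1, h2, h4, hu]
    · by_cases h3 : P (t (t (t u)))
      · simp [firstIn, h1, h2, h3, h4, hu]
      · simp [firstIn, h1, h2, h3, h4]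

theorem firstIn_equivariant {α : Type} (P : α → Prop) (t t' f : α → α)
    (hf : ∀ u, f (t u) = t' (f u)) (hP : ∀ u, P (f u) ↔ P u) (u : α) :
    firstIn P t' (f u) = f (firstIn P t u) := by
  unfold firstIn
  rw [← hf, ← hf, ← hf]
  by_cases h1 : P (t u) <;> by_cases h2 : P (t (t u)) <;> by_cases h3 : P (t (t (t u))) <;>
    simp [h1, h2, h3, hP]

/-- `u` and `v` are at distance one. -/
def Adj (v u : ℤ × ℤ) : Prop := (v.1 - u.1) ^ 2 + (v.2 - u.2) ^ 2 = 1

theorem turnBack_turn (v u : ℤ × ℤ) : turnBack v (turn v u) = u := by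
  unfold turnBack turn
  split_ifs <;> ext <;> simp

theorem turn_turnBack (v u : ℤ × ℤ) : turn v (turnBack v u) = u := by
  unfold turnBack turn
  split_ifs <;> ext <;> simp

theorem turn_four (v u : ℤ × ℤ) : turn v (turn v (turn v (turn v u))) = u := by
  unfold turn
  split_ifs <;> ext <;> simp

theorem turnBack_four (v u : ℤ × ℤ) :
    turnBack v (turnBack v (turnBack v (turnBack v u))) = u := by
  unfold turnBack
  split_ifs <;> ext <;> simp

theorem adj_turn (v u : ℤ × ℤ) (h : Adj v u) : Adj v (turn v u) := by
  unfold Adj turn at *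
  split_ifs <;> simp only [] <;> linarith

theorem adj_turnBack (v u : ℤ × ℤ) (h : Adj v u) : Adj v (turnBack v u) := by
  unfold Adj turnBack at *
  split_ifs <;> simp only [] <;> linarith

theorem Adj.symm {v u : ℤ × ℤ} (h : Adj v u) : Adj u v := by
  unfold Adj at *
  linarith

/-- The neighbour of `v` in the grid that follows the neighbour `u` in the cyclic order at `v`. -/
def next (m n : ℕ) (v u : ℤ × ℤ) : ℤ × ℤ := firstIn (InGrid m n) (turn v) u

/-- The neighbour of `v` in the grid that precedes the neighbour `u` in the cyclic order. -/
def prev (m n : ℕ) (v u : ℤ × ℤ) : ℤ × ℤ := firstIn (InGrid m n) (turnBack v) u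

/-- The class of vertices `𝒜`: `i + j` even. -/
def IsA (v : ℤ × ℤ) : Prop := Even (v.1 + v.2)

/-- The class of vertices `ℬ`: `i + j` odd. -/
def IsB (v : ℤ × ℤ) : Prop := Odd (v.1 + v.2)

theorem IsA.isB_of_adj {a b : ℤ × ℤ} (ha : IsA a) (h : Adj a b) : IsB b := by
  unfold IsA IsB Adj at *
  obtain ⟨r, hr⟩ := ha
  obtain ⟨x, hx⟩ := Int.even_mul_pred_self (a.1 - b.1)
  obtain ⟨y, hy⟩ := Int.even_mul_pred_self (a.2 - b.2)
  have h1 : b.1 + b.2 = 2 * (r + x + y - 1) + 1 := by linarith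
  exact ⟨_, h1⟩

theorem IsB.isA_of_adj {a b : ℤ × ℤ} (hb : IsB b) (h : Adj b a) : IsA a := by
  unfold IsA IsB Adj at *
  obtain ⟨r, hr⟩ := hb
  obtain ⟨x, hx⟩ := Int.even_mul_pred_self (b.1 - a.1)
  obtain ⟨y, hy⟩ := Int.even_mul_pred_self (b.2 - a.2)
  have h1 : a.1 + a.2 = (r + x + y) + (r + x + y) := by linarith
  exact ⟨_, h1⟩

/-! ### The grid graph as a bipartite ribbon graph -/

/-- The edges of the `(m,n)` grid graph, written as pairs of their `𝒜`-endpoint `a` and their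
`ℬ`-endpoint `b`. -/
@[ext]
structure Edge (m n : ℕ) where
  a : ℤ × ℤ
  b : ℤ × ℤ
  a_mem : InGrid m n a
  b_mem : InGrid m n b
  a_isA : IsA a
  b_isB : IsB b
  adj : Adj a b

variable {m n : ℕ}

/-- The edge permutation "east": the next edge around the `𝒜`-endpoint. -/
def east : Equiv.Perm (Edge m n) where
  toFun e :=
    have h : Adj e.a (next m n e.a e.b) := firstIn_induct _ _ _ (adj_turn e.a) _ e.adj
    ⟨e.a, next m n e.a e.b, e.a_mem, firstIn_mem _ _ _ e.b_mem, e.a_isA, e.a_isA.isB_of_adj h, h⟩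
  invFun e :=
    have h : Adj e.a (prev m n e.a e.b) := firstIn_induct _ _ _ (adj_turnBack e.a) _ e.adj
    ⟨e.a, prev m n e.a e.b, e.a_mem, firstIn_mem _ _ _ e.b_mem, e.a_isA, e.a_isA.isB_of_adj h, h⟩
  left_inv e := Edge.ext rfl
    (firstIn_firstIn _ _ _ (turnBack_turn e.a) (turn_four e.a) _ e.b_mem)
  right_inv e := Edge.ext rfl
    (firstIn_firstIn _ _ _ (turn_turnBack e.a) (turnBack_four e.a) _ e.b_mem)

/-- The edge permutation "north": the next edge around the `ℬ`-endpoint. -/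
def north : Equiv.Perm (Edge m n) where
  toFun e :=
    have h : Adj e.b (next m n e.b e.a) := firstIn_induct _ _ _ (adj_turn e.b) _ e.adj.symm
    ⟨next m n e.b e.a, e.b, firstIn_mem _ _ _ e.a_mem, e.b_mem, e.b_isB.isA_of_adj h, e.b_isB,
      h.symm⟩
  invFun e :=
    have h : Adj e.b (prev m n e.b e.a) := firstIn_induct _ _ _ (adj_turnBack e.b) _ e.adj.symm
    ⟨prev m n e.b e.a, e.b, firstIn_mem _ _ _ e.a_mem, e.b_mem, e.b_isB.isA_of_adj h, e.b_isB,
      h.symm⟩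
  left_inv e := Edge.ext
    (firstIn_firstIn _ _ _ (turnBack_turn e.b) (turn_four e.b) _ e.a_mem) rfl
  right_inv e := Edge.ext
    (firstIn_firstIn _ _ _ (turn_turnBack e.b) (turnBack_four e.b) _ e.a_mem) rfl

/-- The positive eigenfunction `w(v_{i,j}) = sin(iπ/m) sin(jπ/n)` of the grid graph. -/
def weight (m n : ℕ) (v : ℤ × ℤ) : ℝ :=
  Real.sin (v.1 * Real.pi / m) * Real.sin (v.2 * Real.pi / n)

/-! ### The surface `X_{m,n}` glued from rectangles -/

/-- The width of the rectangle `R_e`. -/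
def width (e : Edge m n) : ℝ := weight m n e.b

/-- The height of the rectangle `R_e`. -/
def height (e : Edge m n) : ℝ := weight m n e.a

/-- The rectangle `R_e = [0, w(β(e))] × [0, w(α(e))]` in the complex plane. -/
def rect (e : Edge m n) : Set ℂ := Set.Icc 0 (width e) ×ℂ Set.Icc 0 (height e)

/-- The disjoint union of the rectangles `R_e`, with its natural topology. -/
abbrev RectUnion (m n : ℕ) : Type := Σ e : Edge m n, rect e

/-- The position of a point of `⨆ R_e` in its rectangle, as a complex number. -/
def coord (p : RectUnion m n) : ℂ := (p.2 : ℂ)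

/-- The identifications: the right side of `R_e` is glued to the left side of `R_{east e}`, and
the top side of `R_e` to the bottom side of `R_{north e}`, by translations. -/
inductive Glue : RectUnion m n → RectUnion m n → Prop
  | horizontal (p q : RectUnion m n) (h : q.1 = east p.1) (hp : (coord p).re = width p.1)
      (hq : (coord q).re = 0) (him : (coord q).im = (coord p).im) : Glue p q
  | vertical (p q : RectUnion m n) (h : q.1 = north p.1) (hp : (coord p).im = height p.1)
      (hq : (coord q).im = 0) (hre : (coord q).re = (coord p).re) : Glue p q

/-- The surface `X_{m,n}`: the quotient space of the disjoint union of the rectangles by the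
equivalence relation generated by the gluings. -/
abbrev X (m n : ℕ) : Type := Quot (Glue (m := m) (n := n))

/-! ### The involution and the quotient surface -/

/-- The involution `v_{i,j} ↦ v_{m-i,n-j}` on vertices. -/
def flipV (m n : ℕ) (v : ℤ × ℤ) : ℤ × ℤ := (m - v.1, n - v.2)

theorem inGrid_flip (v : ℤ × ℤ) : InGrid m n (flipV m n v) ↔ InGrid m n v := by
  unfold InGrid flipV
  constructor <;> intro h <;> simp only [] at * <;> omega

theorem adj_flip {v u : ℤ × ℤ} (h : Adj v u) : Adj (flipV m n v) (flipV m n u) := by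
  unfold Adj flipV at *
  simp only []
  linarith

theorem isA_flip (hm : Even m) (hn : Even n) {v : ℤ × ℤ} (h : IsA v) : IsA (flipV m n v) := by
  unfold IsA flipV at *
  have h1 : Even (m : ℤ) := by exact_mod_cast hm
  have h2 : Even (n : ℤ) := by exact_mod_cast hn
  simp_all [parity_simps]

theorem isB_flip (hm : Even m) (hn : Even n) {v : ℤ × ℤ} (h : IsB v) : IsB (flipV m n v) := by
  unfold IsB flipV at *
  have h1 : Even (m : ℤ) := by exact_mod_cast hm
  have h2 : Even (n : ℤ) := by exact_mod_cast hn
  rw [← Int.not_even_iff_odd] at *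
  simp_all [parity_simps]

theorem flip_turn (hm : Even m) (v u : ℤ × ℤ) :
    flipV m n (turn v u) = turn (flipV m n v) (flipV m n u) := by
  have h1 : Even (m : ℤ) := by exact_mod_cast hm
  have h2 : Even (flipV m n v).1 ↔ Even v.1 := by simp [flipV, h1, parity_simps]
  unfold turn
  simp only [h2]
  split_ifs <;> ext <;> simp [flipV] <;> ring

theorem next_flip (hm : Even m) (v u : ℤ × ℤ) :
    next m n (flipV m n v) (flipV m n u) = flipV m n (next m n v u) :=
  firstIn_equivariant _ _ _ _ (flip_turn hm v) inGrid_flip u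

theorem weight_flip {v : ℤ × ℤ} (h : InGrid m n v) :
    weight m n (flipV m n v) = weight m n v := by
  unfold InGrid at h
  have hm : (m : ℝ) ≠ 0 := by
    have : m ≠ 0 := by omega
    exact_mod_cast this
  have hn : (n : ℝ) ≠ 0 := by
    have : n ≠ 0 := by omega
    exact_mod_cast this
  unfold weight flipV
  have h1 : (((m : ℤ) - v.1 : ℤ) : ℝ) * Real.pi / m = Real.pi - v.1 * Real.pi / m := by
    push_cast
    field_simp
  have h2 : (((n : ℤ) - v.2 : ℤ) : ℝ) * Real.pi / n = Real.pi - v.2 * Real.pi / n := by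
    push_cast
    field_simp
  simp only [h1, h2, Real.sin_pi_sub]

/-- For `m`, `n` even, the automorphism `ι` of the ribbon graph, on edges. -/
def iota (hm : Even m) (hn : Even n) (e : Edge m n) : Edge m n :=
  ⟨flipV m n e.a, flipV m n e.b, (inGrid_flip _).2 e.a_mem, (inGrid_flip _).2 e.b_mem,
    isA_flip hm hn e.a_isA, isB_flip hm hn e.b_isB, adj_flip e.adj⟩

theorem iota_east (hm : Even m) (hn : Even n) (e : Edge m n) :
    iota hm hn (east e) = east (iota hm hn e) :=
  Edge.ext rfl (next_flip hm e.a e.b).symm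

theorem iota_north (hm : Even m) (hn : Even n) (e : Edge m n) :
    iota hm hn (north e) = north (iota hm hn e) :=
  Edge.ext (next_flip hm e.b e.a).symm rfl

theorem width_iota (hm : Even m) (hn : Even n) (e : Edge m n) :
    width (iota hm hn e) = width e := weight_flip e.b_mem

theorem height_iota (hm : Even m) (hn : Even n) (e : Edge m n) :
    height (iota hm hn e) = height e := weight_flip e.a_mem

theorem rect_iota (hm : Even m) (hn : Even n) (e : Edge m n) :
    rect (iota hm hn e) = rect e := by
  unfold rect
  rw [width_iota, height_iota]

/-- `ι` moves the rectangle `R_e` onto the rectangle `R_{ι(e)}` by a translation. -/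
def iotaRect (hm : Even m) (hn : Even n) (p : RectUnion m n) : RectUnion m n :=
  ⟨iota hm hn p.1, ⟨coord p, by rw [rect_iota]; exact p.2.2⟩⟩

theorem glue_iotaRect (hm : Even m) (hn : Even n) (p q : RectUnion m n) (h : Glue p q) :
    Glue (iotaRect hm hn p) (iotaRect hm hn q) := by
  cases h with
  | horizontal h hp hq him =>
    exact Glue.horizontal _ _ ((congrArg (iota hm hn) h).trans (iota_east hm hn p.1))
      (hp.trans (width_iota hm hn p.1).symm) hq him
  | vertical h hp hq hre =>
    exact Glue.vertical _ _ ((congrArg (iota hm hn) h).trans (iota_north hm hn p.1))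
      (hp.trans (height_iota hm hn p.1).symm) hq hre

/-- The automorphism `ι_*` of `X_{m,n}` that permutes the rectangles according to `ι`. -/
def iotaStar (hm : Even m) (hn : Even n) : X m n → X m n :=
  Quot.map (iotaRect hm hn) (glue_iotaRect hm hn)

/-- The surface `X^e_{m,n} = X_{m,n} / ι_*`, for `m` and `n` even, with the quotient topology. -/
abbrev Xe (m n : ℕ) (hm : Even m) (hn : Even n) : Type :=
  Quot (fun x y : X m n => y = iotaStar hm hn x)

/-- The projection of the disjoint union of the rectangles onto `X^e_{m,n}`. -/
def projXe (hm : Even m) (hn : Even n) (p : RectUnion m n) : Xe m n hm hn :=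
  Quot.mk _ (Quot.mk _ p)

/-! ### The holomorphic one-form, its zeros, the genus

Below, `q` is the projection of the disjoint union of the rectangles onto a surface `S` which is
glued from them by translations. The one-form `ω` of `S` is the one with `q^* ω = dz` on every
rectangle. -/

section Form

variable {S : Type} [TopologicalSpace S] (q : RectUnion m n → S)

/-- `F` is a primitive of `ω` on the open set `U`: in every rectangle, `F` differs from the
coordinate `z` by a locally constant function. -/
def IsPrimitive (U : Set S) (F : S → ℂ) : Prop :=
  ∀ p : RectUnion m n, q p ∈ U → ∀ᶠ p' in 𝓝 p, F (q p') - coord p' = F (q p) - coord p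

/-- `ω` vanishes to the order `k` at `x`: there is a chart `φ` around `x`, with `φ x = 0`, in which
`ω` is `d(φ^{k+1}) = (k+1) φ^k dφ`. (So the order is zero exactly at the regular points, and the
cone angle at `x` is `2π(k+1)`. The charts `φ` form the atlas of the Riemann surface.) -/
def HasOrder (x : S) (k : ℕ) : Prop :=
  ∃ φ : OpenPartialHomeomorph S ℂ, x ∈ φ.source ∧ φ x = 0 ∧
    IsPrimitive q φ.source (fun y => φ y ^ (k + 1))

/-- `(S, ω)` is a translation surface: a compact connected Hausdorff space with charts as above
around each of its points. -/
def IsTranslationSurface : Prop :=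
  CompactSpace S ∧ ConnectedSpace S ∧ T2Space S ∧ ∀ x : S, ∃ k : ℕ, HasOrder q x k

/-- The set of zeros of `ω`. -/
def zeros : Set S := {x | ∃ k : ℕ, 1 ≤ k ∧ HasOrder q x k}

end Form

/-- The Euler characteristic of the space `S` is `c`, by a finite two-dimensional cell structure:
the number of vertices, minus the number of edges, plus the number of faces. (As always, this
number does not depend on the cell structure.) -/
def HasEulerChar (S : Type) [TopologicalSpace S] (c : ℤ) : Prop :=
  ∃ C : Topology.CWComplex (Set.univ : Set S),
    (∀ d, Finite (C.cell d)) ∧ (∀ d, 2 < d → IsEmpty (C.cell d)) ∧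
    (Nat.card (C.cell 0) : ℤ) - Nat.card (C.cell 1) + Nat.card (C.cell 2) = c

/-- The closed connected orientable surface `S` has genus `g`: its Euler characteristic
is `2 - 2g`. -/
def HasGenus (S : Type) [TopologicalSpace S] (g : ℕ) : Prop :=
  HasEulerChar S (2 - 2 * (g : ℤ))

/-- `S` is a torus: it is homeomorphic to the product of two circles. -/
def IsTorus (S : Type) [TopologicalSpace S] : Prop :=
  Nonempty (S ≃ₜ UnitAddCircle × UnitAddCircle)

end GridSurface

end

/-! ### Quotient maps: the Hausdorff property and charts -/

noncomputable section

namespace GridSurface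

/-! The surface `X^e` is a quotient in two steps, but it is also glued directly from one rectangle
for each orbit of `ι` on the edges (`isSurface_qXe`). So everything rests on a general theory of
finitely many rectangles glued along two permutations `r` and `u` (`RectSystem`), and no covering
argument is needed.

In such a surface every point has a normal form in a half-open rectangle, except that the corners
are labelled by the orbits of the commutator `C = u r u⁻¹ r⁻¹`, the turn by `2π` around a lower left
corner (`IsSurface.q_eq_iff`). A vertex whose orbit has length `N` is surrounded by `4N` rectangle
corners. Placing the `N`-th roots of these quadrants side by side in the plane gives a chart whose
`N`-th power is a primitive of the form (`IsSurface.exists_chart_primitive`). Hence the vertex has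
order `N - 1`, every other point is regular, and the order is unique (`HasOrder.unique`). Counting
vertices, `2|I|` sides and `|I|` rectangles gives the Euler characteristic `|Orb| - |I|`
(`IsSurface.hasEulerChar`).

It remains to find the cycle lengths of `C` for the grid. An edge whose lower left corner is the
midpoint of a square of the grid is fixed by the turn and gives a regular vertex. Every other edge
is unfolded, as for a billiard in an `m × n` table, to a lattice point `(x, y)` in a cell `(X, Y)`
of the lattice `mℤ × nℤ`. One turn keeps `y - x` and raises `x - X - Y` by `2`, up to translations
by `(αm, βn)` with `α ≡ β` modulo `2`, and `ι` is itself a translation with odd `α` and `β`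
(`unfolds_step`, `Edge.Unfolds.latEq_iota`). The number `x - X - Y` counts along a diagonal while
skipping the points on the grid lines: crossing a single line adds `2` to `x` and `1` to `X + Y`. It
fails to separate points only across a lattice corner, and no unfolded point lies there
(`eq_of_unfold`).

So `k` turns lead back to the same orbit exactly if `αm = βn` and `αm - α - β = 2k` for some `α ≡ β`
modulo `2`. With `m = 2ga`, `n = 2gb` and `a`, `b` coprime this means `N ∣ k`, where `N` is `2gab -
a - b`, or half of it if `a` and `b` are both odd (`lattice_iff`). There are `(mn - m - n)/2` orbits
of unfolded edges (`ncard_active`), hence `2g` vertices on them if `a` and `b` are odd and `g`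
otherwise. The genus and the zeros follow by arithmetic. The small tori are found by developing the
rectangles onto a rectangular torus. -/

theorem t2Space_of_isClosed_ker {P S : Type*} [TopologicalSpace P] [CompactSpace P] [T2Space P]
    [TopologicalSpace S] {q : P → S} (hq : IsQuotientMap q)
    (hK : IsClosed {x : P × P | q x.1 = q x.2}) : T2Space S := by
  -- The saturation of a closed set is the projection of a closed subset of `P × P`, and projecting
  -- along the compact space `P` is a closed map.
  have hcl : IsClosedMap q := by
    intro C hC
    rw [← hq.isClosed_preimage]
    have h : q ⁻¹' (q '' C) = Prod.snd '' ({x : P × P | q x.1 = q x.2} ∩ Prod.fst ⁻¹' C) := by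
      ext y
      constructor
      · rintro ⟨x, hx, hxy⟩
        exact ⟨(x, y), ⟨hxy, hx⟩, rfl⟩
      · rintro ⟨⟨x, y'⟩, ⟨h1, h2⟩, rfl⟩
        exact ⟨x, h2, h1⟩
    rw [h]
    exact isClosedMap_snd_of_compactSpace _ (hK.inter (hC.preimage continuous_fst))
  refine ⟨fun x y hxy => ?_⟩
  have hfib : ∀ x : S, IsClosed (q ⁻¹' {x}) := by
    intro x
    obtain ⟨p, rfl⟩ := hq.surjective x
    have := hcl {p} isClosed_singleton
    rw [Set.image_singleton] at this
    exact this.preimage hq.continuous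
  obtain ⟨A, B, hA, hB, hxA, hyB, hAB⟩ := normal_separation (hfib x) (hfib y)
    (Set.disjoint_left.2 fun p hp hp' => hxy (hp.symm.trans hp'))
  -- These are the sets of points whose whole fibre lies in `A`, respectively in `B`; they are open
  -- because `q` is closed.
  refine ⟨(q '' Aᶜ)ᶜ, (q '' Bᶜ)ᶜ, (hcl _ hA.isClosed_compl).isOpen_compl,
    (hcl _ hB.isClosed_compl).isOpen_compl, ?_, ?_, ?_⟩
  · rintro ⟨p, hp, hpx⟩
    exact hp (hxA hpx)
  · rintro ⟨p, hp, hpx⟩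
    exact hp (hyB hpx)
  · rw [Set.disjoint_left]
    intro z hz hz'
    obtain ⟨p, rfl⟩ := hq.surjective z
    have h1 : p ∈ A := by
      by_contra h
      exact hz ⟨p, h, rfl⟩
    have h2 : p ∈ B := by
      by_contra h
      exact hz' ⟨p, h, rfl⟩
    exact Set.disjoint_left.1 hAB h1 h2

/-- Two maps with the same fibres, both open on saturated open sets, differ by a local
homeomorphism of their targets. -/
theorem exists_openPartialHomeomorph {M S Z : Type*} [Nonempty M] [TopologicalSpace M]
    [TopologicalSpace S] [TopologicalSpace Z] (a : M → S) (b : M → Z) (ha : Continuous a)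
    (hb : Continuous b) (hab : ∀ x y, a x = a y ↔ b x = b y)
    (hao : ∀ V : Set M, IsOpen V → (∀ x y, a x = a y → x ∈ V → y ∈ V) → IsOpen (a '' V))
    (hbo : ∀ V : Set M, IsOpen V → (∀ x y, a x = a y → x ∈ V → y ∈ V) → IsOpen (b '' V)) :
    ∃ φ : OpenPartialHomeomorph S Z, φ.source = Set.range a ∧ ∀ x, φ (a x) = b x := by
  obtain ⟨x₀⟩ := ‹Nonempty M›
  have h1 : ∀ x, Function.extend a b (fun _ => b x₀) (a x) = b x :=
    fun x => Function.FactorsThrough.extend_apply (fun x y h => (hab x y).1 h) _ x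
  have h2 : ∀ x, Function.extend b a (fun _ => a x₀) (b x) = a x :=
    fun x => Function.FactorsThrough.extend_apply (fun x y h => (hab x y).2 h) _ x
  have hsa : IsOpen (Set.range a) := by
    rw [← Set.image_univ]
    exact hao _ isOpen_univ fun _ _ _ _ => Set.mem_univ _
  have hsb : IsOpen (Set.range b) := by
    rw [← Set.image_univ]
    exact hbo _ isOpen_univ fun _ _ _ _ => Set.mem_univ _
  refine ⟨{ toFun := Function.extend a b (fun _ => b x₀)
            invFun := Function.extend b a (fun _ => a x₀)
            source := Set.range a
            target := Set.range b
            map_source' := ?_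
            map_target' := ?_
            left_inv' := ?_
            right_inv' := ?_
            open_source := hsa
            open_target := hsb
            continuousOn_toFun := ?_
            continuousOn_invFun := ?_ }, rfl, h1⟩
  · rintro _ ⟨x, rfl⟩
    exact ⟨x, (h1 x).symm⟩
  · rintro _ ⟨x, rfl⟩
    exact ⟨x, (h2 x).symm⟩
  · rintro _ ⟨x, rfl⟩
    rw [h1, h2]
  · rintro _ ⟨x, rfl⟩
    rw [h2, h1]
  · rw [continuousOn_open_iff hsa]
    intro t ht
    have : Set.range a ∩ Function.extend a b (fun _ => b x₀) ⁻¹' t = a '' (b ⁻¹' t) := by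
      ext s
      constructor
      · rintro ⟨⟨x, rfl⟩, hx⟩
        exact ⟨x, by simpa [h1] using hx, rfl⟩
      · rintro ⟨x, hx, rfl⟩
        exact ⟨⟨x, rfl⟩, by simpa [h1] using hx⟩
    rw [this]
    exact hao _ (ht.preimage hb) fun x y h hx => by
      simpa [Set.mem_preimage, ← (hab x y).1 h] using hx
  · rw [continuousOn_open_iff hsb]
    intro t ht
    have : Set.range b ∩ Function.extend b a (fun _ => a x₀) ⁻¹' t = b '' (a ⁻¹' t) := by
      ext s
      constructor
      · rintro ⟨⟨x, rfl⟩, hx⟩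
        exact ⟨x, by simpa [h2] using hx, rfl⟩
      · rintro ⟨x, hx, rfl⟩
        exact ⟨⟨x, rfl⟩, by simpa [h2] using hx⟩
    rw [this]
    exact hbo _ (ht.preimage ha) fun x y h hx => by
      simpa [Set.mem_preimage, ← h] using hx

/-! ### The order of a one-form at a point -/

section Order

variable {m n : ℕ} {S : Type} [TopologicalSpace S] {q : RectUnion m n → S}

/-- Near `x` the powers `φ^(k+1)` and `ψ^(l+1)` agree, being primitives with the value `0` at `x`. A
fibre of the first near `x` has `k + 1` points, and the injective `ψ` maps it into the `(l+1)`-th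
roots of one number. -/
theorem HasOrder.le (hq : IsQuotientMap q) {x : S} {k l : ℕ} (hk : HasOrder q x k)
    (hl : HasOrder q x l) : k ≤ l := by
  obtain ⟨φ, hxφ, hφx, hφ⟩ := hk
  obtain ⟨ψ, hxψ, hψx, hψ⟩ := hl
  let T : Set S := {y | (y ∈ φ.source ∧ y ∈ ψ.source) ∧ φ y ^ (k + 1) = ψ y ^ (l + 1)}
  -- Openness is tested on the rectangles, where the difference of two primitives is locally
  -- constant.
  have hT : IsOpen T := by
    rw [← hq.isOpen_preimage, isOpen_iff_eventually]
    rintro p ⟨⟨h1, h2⟩, h3⟩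
    have h4 : ∀ᶠ p' in 𝓝 p, q p' ∈ φ.source :=
      hq.continuous.continuousAt.eventually (φ.open_source.mem_nhds h1)
    have h5 : ∀ᶠ p' in 𝓝 p, q p' ∈ ψ.source :=
      hq.continuous.continuousAt.eventually (ψ.open_source.mem_nhds h2)
    filter_upwards [h4, h5, hφ p h1, hψ p h2] with p' h4 h5 h6 h7
    refine ⟨⟨h4, h5⟩, ?_⟩
    linear_combination h6 - h7 + h3
  have hxT : x ∈ T := ⟨⟨hxφ, hxψ⟩, by simp [hφx, hψx]⟩
  have hTφ : IsOpen (φ '' T) := φ.isOpen_image_of_subset_source hT fun y hy => hy.1.1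
  obtain ⟨ε, hε, hball⟩ := Metric.isOpen_iff.1 hTφ 0 ⟨x, hxT, hφx⟩
  let t : ℂ := ((ε / 2 : ℝ) : ℂ)
  have ht : t ≠ 0 := by
    simp only [t, ne_eq, Complex.ofReal_eq_zero]
    positivity
  have hroot : ∀ ζ ∈ Polynomial.nthRootsFinset (k + 1) (1 : ℂ), ∃ y ∈ T, φ y = t * ζ := by
    intro ζ hζ
    rw [Polynomial.mem_nthRootsFinset (Nat.succ_pos k)] at hζ
    have h1 : ‖ζ‖ = 1 := Complex.norm_eq_one_of_pow_eq_one hζ (Nat.succ_ne_zero k)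
    apply hball
    rw [mem_ball_zero_iff, norm_mul, h1, mul_one, Complex.norm_real, Real.norm_of_nonneg] <;>
      linarith
  have hroot' : ∀ ζ, ∃ y, ζ ∈ Polynomial.nthRootsFinset (k + 1) (1 : ℂ) → y ∈ T ∧ φ y = t * ζ := by
    intro ζ
    by_cases hζ : ζ ∈ Polynomial.nthRootsFinset (k + 1) (1 : ℂ)
    · obtain ⟨y, hy⟩ := hroot ζ hζ
      exact ⟨y, fun _ => hy⟩
    · exact ⟨x, fun h => absurd h hζ⟩
  choose y hy' using hroot'
  have hyT := fun ζ hζ => (hy' ζ hζ).1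
  have hy := fun ζ hζ => (hy' ζ hζ).2
  have hcard : (Polynomial.nthRootsFinset (k + 1) (1 : ℂ)).card = k + 1 :=
    (Complex.isPrimitiveRoot_exp (k + 1) (Nat.succ_ne_zero k)).card_nthRootsFinset
  have hle : (Polynomial.nthRootsFinset (k + 1) (1 : ℂ)).card ≤
      (Polynomial.nthRoots (l + 1) (t ^ (k + 1))).toFinset.card := by
    apply Finset.card_le_card_of_injOn (fun ζ => ψ (y ζ))
    · intro ζ hζ
      simp only [Finset.mem_coe, Multiset.mem_toFinset]
      rw [Polynomial.mem_nthRoots (Nat.succ_pos l), ← (hyT ζ hζ).2, hy ζ hζ, mul_pow,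
        (Polynomial.mem_nthRootsFinset (Nat.succ_pos k) _).1 hζ, mul_one]
    · intro ζ hζ ζ' hζ' h
      have h1 : y ζ = y ζ' := ψ.injOn (hyT ζ hζ).1.2 (hyT ζ' hζ').1.2 h
      have h2 : t * ζ = t * ζ' := by rw [← hy ζ hζ, ← hy ζ' hζ', h1]
      exact mul_left_cancel₀ ht h2
  have := (hle.trans (Multiset.toFinset_card_le _)).trans (Polynomial.card_nthRoots _ _)
  omega

theorem HasOrder.unique (hq : IsQuotientMap q) {x : S} {k l : ℕ} (hk : HasOrder q x k)
    (hl : HasOrder q x l) : k = l :=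
  le_antisymm (hk.le hq hl) (hl.le hq hk)

/-- Away from the centre the power map has nonzero derivative, so by the inverse function theorem
the primitive itself, minus a constant, is a chart. -/
theorem hasOrder_zero_of_chart {φ : OpenPartialHomeomorph S ℂ} {k : ℕ}
    (hφ : IsPrimitive q φ.source (fun y => φ y ^ (k + 1))) {x : S} (hx : x ∈ φ.source)
    (hx0 : φ x ≠ 0) : HasOrder q x 0 := by
  have hd : HasStrictDerivAt (fun ζ : ℂ => ζ ^ (k + 1) - φ x ^ (k + 1))
      (((k + 1 : ℕ) : ℂ) * φ x ^ (k + 1 - 1)) (φ x) :=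
    (hasStrictDerivAt_pow (k + 1) (φ x)).sub_const _
  have hne : ((k + 1 : ℕ) : ℂ) * φ x ^ (k + 1 - 1) ≠ 0 :=
    mul_ne_zero (by exact_mod_cast Nat.succ_ne_zero k) (pow_ne_zero _ hx0)
  have hf := hd.hasStrictFDerivAt_equiv hne
  let e := hf.toOpenPartialHomeomorph
  refine ⟨φ.trans e, ?_, ?_, ?_⟩
  · rw [OpenPartialHomeomorph.trans_source]
    exact ⟨hx, hf.mem_toOpenPartialHomeomorph_source⟩
  · simp [e]
  · intro p hp
    rw [OpenPartialHomeomorph.trans_source] at hp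
    filter_upwards [hφ p hp.1] with p' hp'
    simp only [OpenPartialHomeomorph.coe_trans, Function.comp_apply, e,
      HasStrictFDerivAt.toOpenPartialHomeomorph_coe, zero_add, pow_one]
    linear_combination hp'

end Order

end GridSurface
end

noncomputable section

namespace GridSurface

/-! ### Surfaces glued from rectangles -/

/-- Finitely many rectangles `[0, w i] × [0, h i]`, where the right side of the `i`-th one is to be
glued to the left side of the `r i`-th one, and its top side to the bottom side of the `u i`-th
one. -/
structure RectSystem where
  I : Type
  fin : Finite I
  r : Equiv.Perm I
  u : Equiv.Perm I
  w : I → ℝ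
  h : I → ℝ
  w_pos : ∀ i, 0 < w i
  h_pos : ∀ i, 0 < h i
  w_u : ∀ i, w (u i) = w i
  h_r : ∀ i, h (r i) = h i

namespace RectSystem

variable (D : RectSystem)

instance : Finite D.I := D.fin

/-- The `i`-th rectangle. -/
def rect (i : D.I) : Set ℂ := Set.Icc 0 (D.w i) ×ℂ Set.Icc 0 (D.h i)

/-- The disjoint union of the rectangles. -/
abbrev Pt : Type := Σ i : D.I, D.rect i

variable {D}

/-- The position of a point in its rectangle. -/
def crd (p : D.Pt) : ℂ := (p.2 : ℂ)

theorem mem_rect {i : D.I} {z : ℂ} :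
    z ∈ D.rect i ↔ (0 ≤ z.re ∧ z.re ≤ D.w i) ∧ (0 ≤ z.im ∧ z.im ≤ D.h i) := Iff.rfl

theorem crd_mem (p : D.Pt) : crd p ∈ D.rect p.1 := p.2.2

instance (i : D.I) : CompactSpace (D.rect i) :=
  isCompact_iff_compactSpace.1 (isCompact_Icc.reProdIm isCompact_Icc)

variable (D) in
/-- The gluings of the sides of the rectangles. -/
inductive Glue : D.Pt → D.Pt → Prop
  | horizontal (p q : D.Pt) (h : q.1 = D.r p.1) (hp : (crd p).re = D.w p.1)
      (hq : (crd q).re = 0) (him : (crd q).im = (crd p).im) : Glue p q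
  | vertical (p q : D.Pt) (h : q.1 = D.u p.1) (hp : (crd p).im = D.h p.1)
      (hq : (crd q).im = 0) (hre : (crd q).re = (crd p).re) : Glue p q

/-- The point of the `i`-th rectangle nearest to `z`. -/
def pt (i : D.I) (z : ℂ) : D.Pt :=
  ⟨i, ⟨⟨max 0 (min (D.w i) z.re), max 0 (min (D.h i) z.im)⟩,
    ⟨⟨le_max_left _ _, max_le (D.w_pos i).le (min_le_left _ _)⟩,
      ⟨le_max_left _ _, max_le (D.h_pos i).le (min_le_left _ _)⟩⟩⟩⟩

@[simp]
theorem pt_fst (i : D.I) (z : ℂ) : (pt i z).1 = i := rfl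

theorem crd_pt {i : D.I} {z : ℂ} (hz : z ∈ D.rect i) : crd (pt i z) = z := by
  rw [mem_rect] at hz
  apply Complex.ext
  · exact (congrArg (max 0) (min_eq_right hz.1.2)).trans (max_eq_right hz.1.1)
  · exact (congrArg (max 0) (min_eq_right hz.2.2)).trans (max_eq_right hz.2.1)

theorem pt_eq_mk {i : D.I} {z : ℂ} (hz : z ∈ D.rect i) : pt i z = ⟨i, ⟨z, hz⟩⟩ :=
  congrArg (Sigma.mk i) (Subtype.ext (crd_pt hz))

@[simp]
theorem pt_crd (p : D.Pt) : pt p.1 (crd p) = p := pt_eq_mk p.2.2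

theorem pt_eq {p : D.Pt} {i : D.I} {z : ℂ} (h1 : p.1 = i) (h2 : crd p = z) : p = pt i z := by
  subst h1 h2
  exact (pt_crd p).symm

theorem ext_pt {p p' : D.Pt} (h1 : p.1 = p'.1) (h2 : crd p = crd p') : p = p' := by
  rw [pt_eq h1 h2, pt_crd]

theorem continuous_pt (i : D.I) : Continuous (pt i : ℂ → D.Pt) := by
  refine continuous_sigmaMk.comp (Continuous.subtype_mk ?_ _)
  have : (fun z : ℂ => (⟨max 0 (min (D.w i) z.re), max 0 (min (D.h i) z.im)⟩ : ℂ)) =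
      fun z : ℂ => ((max 0 (min (D.w i) z.re) : ℝ) : ℂ) +
        ((max 0 (min (D.h i) z.im) : ℝ) : ℂ) * Complex.I := by
    funext z
    exact Complex.mk_eq_add_mul_I _ _
  rw [this]
  fun_prop

theorem continuous_crd : Continuous (crd : D.Pt → ℂ) :=
  continuous_sigma fun _ => continuous_subtype_val

theorem zero_mem_rect (i : D.I) : (0 : ℂ) ∈ D.rect i :=
  ⟨⟨le_rfl, (D.w_pos i).le⟩, ⟨le_rfl, (D.h_pos i).le⟩⟩

variable (D) in
/-- The turn by `2π` around the lower left corners of the rectangles. -/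
def C : Equiv.Perm D.I := D.u * D.r * D.u⁻¹ * D.r⁻¹

/-- Going right and up, or up and right, leads from one rectangle to two rectangles at its upper
right corner, which differ by one full turn. This is why corners have a normal form only up to `C`.
-/
theorem C_r_u (i : D.I) : D.C (D.r (D.u i)) = D.u (D.r i) := by
  simp [C]

variable (D) in
/-- The vertices of the surface. -/
def Orb : Type := Quotient (Equiv.Perm.SameCycle.setoid D.C)

instance : Finite D.Orb := inferInstanceAs (Finite (Quotient _))

variable (D) in
/-- The vertex in the lower left corner of a rectangle. -/
def orb (i : D.I) : D.Orb := Quotient.mk _ i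

theorem orb_eq {i j : D.I} : D.orb i = D.orb j ↔ D.C.SameCycle i j := Quotient.eq

theorem orb_C (i : D.I) : D.orb (D.C i) = D.orb i :=
  orb_eq.2 (Equiv.Perm.sameCycle_apply_left.2 (Equiv.Perm.SameCycle.refl _ _))

theorem w_r_u_symm (i : D.I) : D.w (D.u.symm i) = D.w i := by
  rw [← D.w_u, Equiv.apply_symm_apply]

theorem h_r_symm (i : D.I) : D.h (D.r.symm i) = D.h i := by
  rw [← D.h_r, Equiv.apply_symm_apply]

open Classical in
/-- The rectangle of the normal form of a point. -/
def nfI (p : D.Pt) : D.I :=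
  if (crd p).im = D.h p.1 then D.u (if (crd p).re = D.w p.1 then D.r p.1 else p.1)
  else if (crd p).re = D.w p.1 then D.r p.1 else p.1

open Classical in
/-- The position of the normal form of a point. -/
def nfZ (p : D.Pt) : ℂ :=
  ⟨if (crd p).re = D.w p.1 then 0 else (crd p).re,
    if (crd p).im = D.h p.1 then 0 else (crd p).im⟩

open Classical in
/-- The normal form of a point: points are moved away from the right and top sides, and the lower
left corners are labelled by the vertices. -/
def nf (p : D.Pt) : D.Orb ⊕ (D.I × ℂ) :=
  if nfZ p = 0 then Sum.inl (D.orb (nfI p)) else Sum.inr (nfI p, nfZ p)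

theorem nfZ_bounds (p : D.Pt) : (0 ≤ (nfZ p).re ∧ (nfZ p).re < D.w (nfI p)) ∧
    0 ≤ (nfZ p).im ∧ (nfZ p).im < D.h (nfI p) := by
  have h := mem_rect.1 (crd_mem p)
  by_cases h1 : (crd p).im = D.h p.1 <;> by_cases h2 : (crd p).re = D.w p.1 <;>
    simp only [nfI, nfZ, h1, h2, if_true, if_false, D.w_u, D.h_r, le_refl, D.w_pos, D.h_pos,
      true_and, and_true]
  · exact ⟨h.1.1, lt_of_le_of_ne h.1.2 h2⟩
  · exact ⟨h.2.1, lt_of_le_of_ne h.2.2 h1⟩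
  · exact ⟨⟨h.1.1, lt_of_le_of_ne h.1.2 h2⟩, ⟨h.2.1, lt_of_le_of_ne h.2.2 h1⟩⟩

theorem nf_pt {i : D.I} {z : ℂ} (hx : 0 ≤ z.re) (hx' : z.re < D.w i) (hy : 0 ≤ z.im)
    (hy' : z.im < D.h i) (hz : z ≠ 0) : nf (pt i z) = Sum.inr (i, z) := by
  have hz' : crd (pt i z) = z := crd_pt ⟨⟨hx, hx'.le⟩, ⟨hy, hy'.le⟩⟩
  have h1 : nfZ (pt i z) = z := by
    unfold nfZ
    rw [hz']
    simp [hx'.ne, hy'.ne]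
  have h2 : nfI (pt i z) = i := by
    unfold nfI
    rw [hz']
    simp [hx'.ne, hy'.ne]
  unfold nf
  rw [h1, h2, if_neg hz]

theorem nf_pt_zero (i : D.I) : nf (pt i 0) = Sum.inl (D.orb i) := by
  have hz' : crd (pt i 0) = 0 := crd_pt (zero_mem_rect i)
  have h1 : nfZ (pt i 0) = 0 := by
    unfold nfZ
    rw [hz']
    simp only [Complex.zero_re, Complex.zero_im, ite_self]
    rfl
  have h2 : nfI (pt i 0) = i := by
    unfold nfI
    rw [hz']
    simp [(D.w_pos i).ne, (D.h_pos i).ne]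
  unfold nf
  rw [h1, h2, if_pos rfl]

/-- The order of the moves to the right and up matters only for a vertical gluing at a corner, where
the two sides yield `u (r i)` and `r (u i)`; these have the same vertex. -/
theorem nf_glue {p p' : D.Pt} (h : D.Glue p p') : nf p = nf p' := by
  cases h with
  | horizontal h hp hq him =>
    have hw : ¬ (crd p').re = D.w p'.1 := by
      rw [hq]
      exact (D.w_pos _).ne
    have hh : D.h p'.1 = D.h p.1 := by rw [h, D.h_r]
    have hZ : nfZ p = nfZ p' := by
      unfold nfZ
      simp [hp, hq, him, hh]
    by_cases h0 : (crd p).im = D.h p.1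
    · have h1 : nfI p = D.u (D.r p.1) := by simp [nfI, h0, hp]
      have h2 : nfI p' = D.u (D.r p.1) := by
        unfold nfI
        rw [if_pos (by rw [him, hh]; exact h0), if_neg hw, h]
      unfold nf
      rw [hZ, h1, h2]
    · have h1 : nfI p = D.r p.1 := by simp [nfI, h0, hp]
      have h2 : nfI p' = D.r p.1 := by
        unfold nfI
        rw [if_neg (by rw [him, hh]; exact h0), if_neg hw, h]
      unfold nf
      rw [hZ, h1, h2]
  | vertical h hp hq hre =>
    have hh : ¬ (crd p').im = D.h p'.1 := by
      rw [hq]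
      exact (D.h_pos _).ne
    have hw : D.w p'.1 = D.w p.1 := by rw [h, D.w_u]
    have hZ : nfZ p = nfZ p' := by
      unfold nfZ
      simp [hp, hq, hre, hw]
    by_cases h0 : (crd p).re = D.w p.1
    · have h1 : nfI p = D.u (D.r p.1) := by simp [nfI, h0, hp]
      have h2 : nfI p' = D.r (D.u p.1) := by
        unfold nfI
        rw [if_neg hh, if_pos (by rw [hre, hw]; exact h0), h]
      have h3 : nfZ p' = 0 := by
        unfold nfZ
        rw [if_pos (by rw [hre, hw]; exact h0), if_neg hh, hq]
        rfl
      unfold nf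
      rw [hZ, h3, if_pos rfl, if_pos rfl, h1, h2, ← C_r_u, orb_C]
    · have h1 : nfI p = D.u p.1 := by simp [nfI, h0, hp]
      have h2 : nfI p' = D.u p.1 := by
        unfold nfI
        rw [if_neg hh, if_neg (by rw [hre, hw]; exact h0), h]
      unfold nf
      rw [hZ, h1, h2]

/-- `q` exhibits the space `S` as the surface glued from the rectangles of `D`. -/
structure IsSurface {S : Type} [TopologicalSpace S] (q : D.Pt → S) : Prop where
  quot : IsQuotientMap q
  ker : ∀ p p', q p = q p' ↔ Relation.EqvGen D.Glue p p'

section Surface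

variable {S : Type} [TopologicalSpace S] {q : D.Pt → S} (hS : IsSurface q)
include hS

theorem IsSurface.glue {p p' : D.Pt} (h : D.Glue p p') : q p = q p' :=
  (hS.ker p p').2 (Relation.EqvGen.rel _ _ h)

theorem IsSurface.glue_r (i : D.I) {y : ℝ} (hy : 0 ≤ y) (hy' : y ≤ D.h i) :
    q (pt i ⟨D.w i, y⟩) = q (pt (D.r i) ⟨0, y⟩) := by
  have h1 : crd (pt i ⟨D.w i, y⟩) = ⟨D.w i, y⟩ := crd_pt ⟨⟨(D.w_pos i).le, le_rfl⟩, ⟨hy, hy'⟩⟩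
  have h2 : crd (pt (D.r i) ⟨0, y⟩) = ⟨0, y⟩ :=
    crd_pt ⟨⟨le_rfl, (D.w_pos _).le⟩, ⟨hy, by rwa [D.h_r]⟩⟩
  exact hS.glue (.horizontal _ _ rfl (by rw [h1]; rfl) (by rw [h2]) (by rw [h1, h2]))

theorem IsSurface.glue_u (i : D.I) {x : ℝ} (hx : 0 ≤ x) (hx' : x ≤ D.w i) :
    q (pt i ⟨x, D.h i⟩) = q (pt (D.u i) ⟨x, 0⟩) := by
  have h1 : crd (pt i ⟨x, D.h i⟩) = ⟨x, D.h i⟩ := crd_pt ⟨⟨hx, hx'⟩, ⟨(D.h_pos i).le, le_rfl⟩⟩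
  have h2 : crd (pt (D.u i) ⟨x, 0⟩) = ⟨x, 0⟩ :=
    crd_pt ⟨⟨hx, by rwa [D.w_u]⟩, ⟨le_rfl, (D.h_pos _).le⟩⟩
  exact hS.glue (.vertical _ _ rfl (by rw [h1]; rfl) (by rw [h2]) (by rw [h1, h2]))

theorem IsSurface.nf_eq {p p' : D.Pt} (h : q p = q p') : nf p = nf p' := by
  have := (hS.ker p p').1 h
  induction this with
  | rel _ _ h' => exact nf_glue h'
  | refl _ => rfl
  | symm x y _ ih => exact (ih ((hS.ker _ _).2 ‹_›)).symm
  | trans x y z _ _ ih1 ih2 =>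
    exact (ih1 ((hS.ker _ _).2 ‹_›)).trans (ih2 ((hS.ker _ _).2 ‹_›))

/-- Both points are glued to the upper right corner of the `i`-th rectangle, along the two different
routes. -/
theorem IsSurface.q_corner (i : D.I) : q (pt (D.u (D.r i)) 0) = q (pt (D.r (D.u i)) 0) := by
  have hw := (D.w_pos i).le
  have hh := (D.h_pos i).le
  have h1 := hS.glue_r i hh le_rfl
  have h2 := hS.glue_u i hw le_rfl
  have h3 := hS.glue_u (D.r i) le_rfl (D.w_pos _).le
  have h4 := hS.glue_r (D.u i) le_rfl (D.h_pos _).le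
  rw [D.h_r] at h3
  rw [D.w_u] at h4
  exact (h3.symm.trans h1.symm).trans (h2.trans h4)

theorem IsSurface.q_orb {i j : D.I} (h : D.orb i = D.orb j) : q (pt i 0) = q (pt j 0) := by
  have hC : ∀ i, q (pt (D.C i) 0) = q (pt i 0) := by
    intro i
    have := hS.q_corner (D.u.symm (D.r.symm i))
    simpa [C] using this
  have hz : ∀ (k : ℤ) i, q (pt ((D.C ^ k) i) 0) = q (pt i 0) := by
    intro k
    induction k using Int.induction_on with
    | zero => intro i; rfl
    | succ k ih => intro i; rw [zpow_add_one, Equiv.Perm.mul_apply, ih, hC]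
    | pred k ih =>
      intro i
      rw [zpow_sub_one, Equiv.Perm.mul_apply, ih, ← hC]
      simp
  obtain ⟨k, rfl⟩ := orb_eq.1 h
  exact (hz k i).symm

theorem IsSurface.q_nf (p : D.Pt) : q p = q (pt (nfI p) (nfZ p)) := by
  have h := mem_rect.1 (crd_mem p)
  have hp : p = pt p.1 ⟨(crd p).re, (crd p).im⟩ := (pt_crd p).symm
  by_cases h1 : (crd p).im = D.h p.1 <;> by_cases h2 : (crd p).re = D.w p.1
  · have e1 : nfI p = D.u (D.r p.1) := by simp [nfI, h1, h2]
    have e2 : nfZ p = ⟨0, 0⟩ := by simp [nfZ, h1, h2]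
    rw [h1, h2] at hp
    rw [e1, e2]
    conv_lhs => rw [hp]
    rw [hS.glue_r _ (D.h_pos _).le le_rfl, ← D.h_r, hS.glue_u _ le_rfl (D.w_pos _).le]
  · have e1 : nfI p = D.u p.1 := by simp [nfI, h1, h2]
    have e2 : nfZ p = ⟨(crd p).re, 0⟩ := by simp [nfZ, h1, h2]
    rw [h1] at hp
    rw [e1, e2]
    conv_lhs => rw [hp]
    rw [hS.glue_u _ h.1.1 h.1.2]
  · have e1 : nfI p = D.r p.1 := by simp [nfI, h1, h2]
    have e2 : nfZ p = ⟨0, (crd p).im⟩ := by simp [nfZ, h1, h2]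
    rw [h2] at hp
    rw [e1, e2]
    conv_lhs => rw [hp]
    rw [hS.glue_r _ h.2.1 h.2.2]
  · have e1 : nfI p = p.1 := by simp [nfI, h1, h2]
    have e2 : nfZ p = crd p := by simp [nfZ, h1, h2]
    rw [e1, e2, pt_crd]

/-- The normal form is invariant under gluing, and conversely each point is identified with the one
that its normal form describes. This decides the generated equivalence relation. -/
theorem IsSurface.q_eq_iff {p p' : D.Pt} : q p = q p' ↔ nf p = nf p' := by
  refine ⟨hS.nf_eq, fun h => ?_⟩
  rw [hS.q_nf p, hS.q_nf p']
  unfold nf at h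
  split_ifs at h with h1 h2 h2
  · rw [h1, h2]
    exact hS.q_orb (Sum.inl.inj h)
  · have := Prod.mk.inj (Sum.inr.inj h)
    rw [this.1, this.2]

/-- Away from the corners a point lies on at most one side, so its class has at most two members,
related by a single gluing. Only the corners have larger classes. -/
theorem IsSurface.eq_cases {p p' : D.Pt} (h : q p = q p') :
    p = p' ∨ (p'.1 = D.r p.1 ∧ (crd p).re = D.w p.1 ∧ (crd p').re = 0 ∧ (crd p').im = (crd p).im) ∨
    (p.1 = D.r p'.1 ∧ (crd p').re = D.w p'.1 ∧ (crd p).re = 0 ∧ (crd p).im = (crd p').im) ∨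
    (p'.1 = D.u p.1 ∧ (crd p).im = D.h p.1 ∧ (crd p').im = 0 ∧ (crd p').re = (crd p).re) ∨
    (p.1 = D.u p'.1 ∧ (crd p').im = D.h p'.1 ∧ (crd p).im = 0 ∧ (crd p).re = (crd p').re) ∨
    (nfZ p = 0 ∧ nfZ p' = 0) := by
  replace h := hS.nf_eq h
  unfold nf at h
  split_ifs at h with h1 h2 h2
  · tauto
  · obtain ⟨hI, hZ⟩ := Prod.mk.inj (Sum.inr.inj h)
    clear h
    by_cases a1 : (crd p).im = D.h p.1 <;> by_cases a2 : (crd p).re = D.w p.1 <;>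
    by_cases b1 : (crd p').im = D.h p'.1 <;> by_cases b2 : (crd p').re = D.w p'.1 <;>
    simp only [nfI, nfZ, a1, a2, b1, b2, if_true, if_false, Complex.ext_iff, Complex.zero_re,
      Complex.zero_im, EmbeddingLike.apply_eq_iff_eq] at hI hZ h1 h2 
    all_goals first
    | exact (h1 ⟨trivial, trivial⟩).elim
    | exact (h2 ⟨trivial, trivial⟩).elim
    | exact (h1 hZ).elim
    | exact (h2 ⟨hZ.1.symm, hZ.2.symm⟩).elim
    | exact (h1 ⟨hZ.1, trivial⟩).elim
    | exact (h1 ⟨trivial, hZ.2⟩).elim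
    | exact (h2 ⟨hZ.1.symm, trivial⟩).elim
    | exact (h2 ⟨trivial, hZ.2.symm⟩).elim
    | exact Or.inl (ext_pt hI (Complex.ext (by first | exact hZ.1 | rw [a2, b2, hI])
        (by first | exact hZ.2 | rw [a1, b1, hI])))
    | exact Or.inr (Or.inl ⟨hI.symm, a2, hZ.1.symm, hZ.2.symm⟩)
    | exact Or.inr (Or.inr (Or.inl ⟨hI, b2, hZ.1, hZ.2⟩))
    | exact Or.inr (Or.inr (Or.inr (Or.inl ⟨hI.symm, a1, hZ.2.symm, hZ.1.symm⟩)))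
    | exact Or.inr (Or.inr (Or.inr (Or.inr (Or.inl ⟨hI, b1, hZ.2, hZ.1⟩))))

omit hS in
theorem finite_nfZ_eq_zero : {p : D.Pt | nfZ p = 0}.Finite := by
  have hfin : (Set.univ : Set D.I).Finite := Set.finite_univ
  have h0 : (Set.range fun x : D.I × Bool × Bool =>
      (pt x.1 ⟨if x.2.1 then D.w x.1 else 0, if x.2.2 then D.h x.1 else 0⟩ : D.Pt)).Finite :=
    Set.finite_range _
  refine h0.subset ?_
  intro p hp
  rw [Set.mem_ofPred_eq, Complex.ext_iff] at hp
  obtain ⟨hx, hy⟩ := hp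
  simp only [nfZ, Complex.zero_re, Complex.zero_im] at hx hy
  by_cases a1 : (crd p).im = D.h p.1 <;> by_cases a2 : (crd p).re = D.w p.1 <;>
    simp only [a1, a2, if_true, if_false] at hx hy
  · exact ⟨(p.1, true, true), (pt_eq rfl (Complex.ext a2 a1)).symm⟩
  · exact ⟨(p.1, false, true), (pt_eq rfl (Complex.ext hx a1)).symm⟩
  · exact ⟨(p.1, true, false), (pt_eq rfl (Complex.ext a2 hy)).symm⟩
  · exact ⟨(p.1, false, false), (pt_eq rfl (Complex.ext hx hy)).symm⟩

/-! ### Compactness, the Hausdorff property and connectedness of the glued surface -/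

theorem IsSurface.compactSpace : CompactSpace S :=
  hS.quot.surjective.compactSpace hS.quot.continuous

theorem IsSurface.t2Space : T2Space S := by
  apply t2Space_of_isClosed_ker hS.quot
  -- With the discrete topology on the indices, all data of the gluings are continuous, so that each
  -- gluing relation is closed.
  let : TopologicalSpace D.I := ⊥
  have : DiscreteTopology D.I := ⟨rfl⟩
  have hfst : Continuous (fun p : D.Pt => p.1) :=
    continuous_sigma fun _ => continuous_const
  have hw : Continuous D.w := continuous_of_discreteTopology
  have hh : Continuous D.h := continuous_of_discreteTopology
  have hr : Continuous D.r := continuous_of_discreteTopology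
  have hu : Continuous D.u := continuous_of_discreteTopology
  have c1 : Continuous fun p : D.Pt => (crd p).re := Complex.continuous_re.comp continuous_crd
  have c2 : Continuous fun p : D.Pt => (crd p).im := Complex.continuous_im.comp continuous_crd
  let H : Set (D.Pt × D.Pt) := {x | x.2.1 = D.r x.1.1 ∧ (crd x.1).re = D.w x.1.1 ∧
    (crd x.2).re = 0 ∧ (crd x.2).im = (crd x.1).im}
  let V : Set (D.Pt × D.Pt) := {x | x.2.1 = D.u x.1.1 ∧ (crd x.1).im = D.h x.1.1 ∧
    (crd x.2).im = 0 ∧ (crd x.2).re = (crd x.1).re}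
  have hH : IsClosed H :=
    (isClosed_eq (hfst.comp continuous_snd) (hr.comp (hfst.comp continuous_fst))).inter
      ((isClosed_eq (c1.comp continuous_fst) (hw.comp (hfst.comp continuous_fst))).inter
      ((isClosed_eq (c1.comp continuous_snd) continuous_const).inter
      (isClosed_eq (c2.comp continuous_snd) (c2.comp continuous_fst))))
  have hV : IsClosed V :=
    (isClosed_eq (hfst.comp continuous_snd) (hu.comp (hfst.comp continuous_fst))).inter
      ((isClosed_eq (c2.comp continuous_fst) (hh.comp (hfst.comp continuous_fst))).inter
      ((isClosed_eq (c2.comp continuous_snd) continuous_const).inter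
      (isClosed_eq (c1.comp continuous_snd) (c1.comp continuous_fst))))
  let F : Set (D.Pt × D.Pt) := ({p | nfZ p = 0} ×ˢ {p | nfZ p = 0}) ∩ {x | q x.1 = q x.2}
  have hF : IsClosed F :=
    ((finite_nfZ_eq_zero.prod finite_nfZ_eq_zero).subset Set.inter_subset_left).isClosed
  -- The kernel is the union of the diagonal, the two gluings, their inverses, and a finite set of
  -- pairs of corners.
  have hK : {x : D.Pt × D.Pt | q x.1 = q x.2} =
      Set.diagonal D.Pt ∪ (H ∪ (Prod.swap ⁻¹' H ∪ (V ∪ (Prod.swap ⁻¹' V ∪ F)))) := by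
    ext ⟨p, p'⟩
    constructor
    · intro h
      rcases hS.eq_cases h with h' | h' | h' | h' | h' | h'
      · exact Or.inl h'
      · exact Or.inr (Or.inl h')
      · exact Or.inr (Or.inr (Or.inl h'))
      · exact Or.inr (Or.inr (Or.inr (Or.inl h')))
      · exact Or.inr (Or.inr (Or.inr (Or.inr (Or.inl h'))))
      · exact Or.inr (Or.inr (Or.inr (Or.inr (Or.inr ⟨h', h⟩))))
    · rintro (h | ⟨h1, h2, h3, h4⟩ | ⟨h1, h2, h3, h4⟩ | ⟨h1, h2, h3, h4⟩ | ⟨h1, h2, h3, h4⟩ | h)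
      · exact congrArg q h
      · exact hS.glue (.horizontal _ _ h1 h2 h3 h4)
      · exact (hS.glue (.horizontal _ _ h1 h2 h3 h4)).symm
      · exact hS.glue (.vertical _ _ h1 h2 h3 h4)
      · exact (hS.glue (.vertical _ _ h1 h2 h3 h4)).symm
      · exact h.2
  rw [hK]
  exact isClosed_diagonal.union (hH.union ((hH.preimage continuous_swap).union
    (hV.union ((hV.preimage continuous_swap).union hF))))

/-- Each rectangle is convex and thus lies in one component; gluings pass from a rectangle to its
images under `r` and `u`, which act transitively by `hconn`. -/
theorem IsSurface.connectedSpace [Nonempty D.I]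
    (hconn : ∀ P : D.I → Prop, (∀ i, P i ↔ P (D.r i)) → (∀ i, P i ↔ P (D.u i)) →
      ∀ i j, P i → P j) : ConnectedSpace S := by
  have hcell : ∀ (i : D.I) (z : ℂ), z ∈ D.rect i → ∀ z', z' ∈ D.rect i →
      connectedComponent (q (pt i z)) = connectedComponent (q (pt i z')) := by
    intro i z hz z' hz'
    have hcvx : IsPreconnected (D.rect i) :=
      (((convex_Icc (0 : ℝ) (D.w i)).is_linear_preimage Complex.reLm.isLinear).inter
        ((convex_Icc (0 : ℝ) (D.h i)).is_linear_preimage Complex.imLm.isLinear)).isPreconnected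
    have himg : IsPreconnected ((fun z => q (pt i z)) '' D.rect i) :=
      hcvx.image _ (hS.quot.continuous.comp (continuous_pt i)).continuousOn
    exact connectedComponent_eq
      (himg.subset_connectedComponent ⟨z, hz, rfl⟩ ⟨z', hz', rfl⟩)
  obtain ⟨i₀⟩ := ‹Nonempty D.I›
  have hall : ∀ i, connectedComponent (q (pt i 0)) = connectedComponent (q (pt i₀ 0)) := by
    intro i
    refine hconn (fun i => connectedComponent (q (pt i 0)) = connectedComponent (q (pt i₀ 0)))
      ?_ ?_ i₀ i rfl
    · intro i
      have h1 := hcell i 0 (zero_mem_rect i) ⟨D.w i, 0⟩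
        ⟨⟨(D.w_pos i).le, le_rfl⟩, ⟨le_rfl, (D.h_pos i).le⟩⟩
      rw [hS.glue_r i le_rfl (D.h_pos i).le] at h1
      exact iff_of_eq (congrArg (· = _) h1)
    · intro i
      have h1 := hcell i 0 (zero_mem_rect i) ⟨0, D.h i⟩
        ⟨⟨le_rfl, (D.w_pos i).le⟩, ⟨(D.h_pos i).le, le_rfl⟩⟩
      rw [hS.glue_u i le_rfl (D.w_pos i).le] at h1
      exact iff_of_eq (congrArg (· = _) h1)
  rw [connectedSpace_iff_connectedComponent]
  refine ⟨q (pt i₀ 0), Set.eq_univ_of_forall fun x => ?_⟩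
  obtain ⟨p, rfl⟩ := hS.quot.surjective x
  rw [← hall p.1, hcell p.1 0 (zero_mem_rect _) (crd p) (crd_mem p), pt_crd]
  exact mem_connectedComponent

end Surface

end RectSystem

end GridSurface
end

noncomputable section

namespace GridSurface

/-! ### The model of a cone point -/

/-- The closed first quadrant. -/
def quad : Set ℂ := {ζ | 0 ≤ ζ.re ∧ 0 ≤ ζ.im}

/-- The `N`-th root map from the first quadrant to the `s`-th of `4N` sectors of the plane. -/
def sec (N : ℕ) (s : ℤ) (ζ : ℂ) : ℂ :=
  Complex.exp (s * (Real.pi / 2 * Complex.I) / N) * ζ ^ ((N : ℂ)⁻¹)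

section Sector

theorem exp_mul_pi_div_two (s : ℤ) :
    Complex.exp (s * (Real.pi / 2 * Complex.I)) = Complex.I ^ s := by
  rw [Complex.exp_int_mul, Complex.exp_pi_div_two_mul_I]

variable {N : ℕ} (hN : 0 < N)
include hN

theorem sec_pow (s : ℤ) (ζ : ℂ) : sec N s ζ ^ N = Complex.I ^ s * ζ := by
  have hN' : (N : ℂ) ≠ 0 := by exact_mod_cast hN.ne'
  unfold sec
  rw [mul_pow, Complex.cpow_nat_inv_pow _ hN.ne', ← Complex.exp_nat_mul,
    mul_div_cancel₀ _ hN', exp_mul_pi_div_two]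

theorem sec_zero (s : ℤ) : sec N s 0 = 0 := by
  have hN' : (N : ℂ) ≠ 0 := by exact_mod_cast hN.ne'
  unfold sec
  rw [Complex.zero_cpow (inv_ne_zero hN'), mul_zero]

theorem sec_eq_zero {s : ℤ} {ζ : ℂ} (h : sec N s ζ = 0) : ζ = 0 := by
  have h1 := sec_pow hN s ζ
  rw [h, zero_pow hN.ne'] at h1
  exact (mul_eq_zero.1 h1.symm).resolve_left (zpow_ne_zero _ Complex.I_ne_zero)

omit hN in
theorem sec_eq_exp (s : ℤ) {ζ : ℂ} (hζ : ζ ≠ 0) :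
    sec N s ζ = Complex.exp ((Complex.log ζ + s * (Real.pi / 2 * Complex.I)) / N) := by
  unfold sec
  rw [Complex.cpow_def_of_ne_zero hζ, ← Complex.exp_add]
  congr 1
  ring

/-- Comparing logarithms, the arguments differ by an integral multiple of `π/2`. Both lie in `[0,
π/2]`, so the multiple is `0`, `1` or `-1`: the points agree, or they lie on the common ray of
adjacent sectors. -/
theorem sec_eq_cases {s s' : ℤ} {ζ ζ' : ℂ} (hζ : ζ ∈ quad) (hζ' : ζ' ∈ quad)
    (h : sec N s ζ = sec N s' ζ') :
    (ζ = 0 ∧ ζ' = 0) ∨ ((4 * N : ℤ) ∣ s' - s ∧ ζ = ζ') ∨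
    ((4 * N : ℤ) ∣ s' - (s + 1) ∧ ζ.re = 0 ∧ ζ' = ζ.im) ∨
    ((4 * N : ℤ) ∣ s - (s' + 1) ∧ ζ'.re = 0 ∧ ζ = ζ'.im) := by
  have hN' : (N : ℂ) ≠ 0 := by exact_mod_cast hN.ne'
  by_cases h0 : ζ = 0
  · left
    rw [h0, sec_zero hN] at h
    exact ⟨h0, sec_eq_zero hN h.symm⟩
  by_cases h0' : ζ' = 0
  · left
    rw [h0', sec_zero hN] at h
    exact ⟨sec_eq_zero hN h, h0'⟩
  right
  have habs : ‖ζ‖ = ‖ζ'‖ := by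
    have := congrArg (fun z => ‖z ^ N‖) h
    simpa [sec_pow hN, norm_mul, norm_zpow] using this
  rw [sec_eq_exp _ h0, sec_eq_exp _ h0', Complex.exp_eq_exp_iff_exists_int] at h
  obtain ⟨k, hk⟩ := h
  have hk' : Complex.log ζ + s * (Real.pi / 2 * Complex.I) =
      Complex.log ζ' + s' * (Real.pi / 2 * Complex.I) + (4 * N * k) * (Real.pi / 2 * Complex.I) := by
    have := congrArg (fun z : ℂ => (N : ℂ) * z) hk
    simp only [mul_add, mul_div_cancel₀ _ hN'] at this
    rw [this]
    ring
  have him := congrArg Complex.im hk'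
  have himm : ζ.arg + s * (Real.pi / 2) =
      ζ'.arg + s' * (Real.pi / 2) + 4 * N * k * (Real.pi / 2) := by
    have e : ((Real.pi : ℂ) / 2) = ((Real.pi / 2 : ℝ) : ℂ) := by push_cast; rfl
    rw [e] at him
    simpa [Complex.log_im, -Complex.ofReal_div] using him
  have ha1 : 0 ≤ ζ.arg := Complex.arg_nonneg_iff.2 hζ.2
  have ha2 : ζ.arg ≤ Real.pi / 2 := by
    have := Complex.abs_arg_le_pi_div_two_iff.2 hζ.1
    exact (abs_le.1 this).2
  have hb1 : 0 ≤ ζ'.arg := Complex.arg_nonneg_iff.2 hζ'.2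
  have hb2 : ζ'.arg ≤ Real.pi / 2 := by
    have := Complex.abs_arg_le_pi_div_two_iff.2 hζ'.1
    exact (abs_le.1 this).2
  have hpi := Real.pi_pos
  have hd : ζ.arg - ζ'.arg = ((s' - s + 4 * N * k : ℤ) : ℝ) * (Real.pi / 2) := by
    push_cast
    linarith
  have hd1 : ((s' - s + 4 * N * k : ℤ) : ℝ) ≤ 1 := by
    by_contra hc
    nlinarith
  have hd2 : (-1 : ℝ) ≤ ((s' - s + 4 * N * k : ℤ) : ℝ) := by
    by_contra hc
    nlinarith
  have hd1' : s' - s + 4 * N * k ≤ 1 := by exact_mod_cast hd1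
  have hd2' : -1 ≤ s' - s + 4 * N * k := by exact_mod_cast hd2
  have hvert : ∀ z z' : ℂ, z.arg = Real.pi / 2 → z'.arg = 0 → ‖z‖ = ‖z'‖ →
      z.re = 0 ∧ z' = z.im := by
    intro z z' hz hz' hzz
    have h1 := Complex.norm_mul_exp_arg_mul_I z
    have h2 := Complex.norm_mul_exp_arg_mul_I z'
    rw [hz] at h1
    rw [hz', ← hzz] at h2
    push_cast at h1
    rw [Complex.exp_pi_div_two_mul_I] at h1
    have h3 : z.re = 0 := by rw [← h1]; simp
    have h4 : z.im = ‖z‖ := by conv_lhs => rw [← h1]; simp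
    exact ⟨h3, by rw [h4, ← h2]; simp⟩
  have hcase : s' - s + 4 * N * k = 0 ∨ s' - s + 4 * N * k = 1 ∨ s' - s + 4 * N * k = -1 := by
    omega
  rcases hcase with hc | hc | hc <;> rw [hc] at hd <;> push_cast at hd
  · left
    refine ⟨⟨-k, by linarith⟩, Complex.ext_norm_arg habs (by linarith)⟩
  · right; left
    refine ⟨⟨-k, by linarith⟩, hvert ζ ζ' (by linarith) (by linarith) habs⟩
  · right; right
    refine ⟨⟨k, by linarith⟩, hvert ζ' ζ (by linarith) (by linarith) habs.symm⟩

/-- Consecutive sectors fit together: the logarithm of `iy` is that of `y` plus `iπ/2`, which is the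
increment from `s` to `s + 1`. -/
theorem sec_succ {ζ : ℂ} (s : ℤ) (hζ : ζ.re = 0) (hζ' : 0 ≤ ζ.im) :
    sec N (s + 1) ζ.im = sec N s ζ := by
  have hN' : (N : ℂ) ≠ 0 := by exact_mod_cast hN.ne'
  have e : ζ = (ζ.im : ℂ) * Complex.I := by
    apply Complex.ext <;> simp [hζ]
  rcases hζ'.eq_or_lt with h0 | h0
  · have : ζ = 0 := by rw [e, ← h0]; simp
    rw [← h0, this]
    simp [sec_zero hN]
  have hne : ((ζ.im : ℝ) : ℂ) ≠ 0 := by exact_mod_cast h0.ne'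
  have hne' : ζ ≠ 0 := by
    rw [e]
    exact mul_ne_zero hne Complex.I_ne_zero
  rw [sec_eq_exp _ hne, sec_eq_exp _ hne']
  congr 2
  have hl : Complex.log ζ = Complex.log (ζ.im : ℂ) + Real.pi / 2 * Complex.I := by
    conv_lhs => rw [e]
    rw [Complex.log_ofReal_mul h0 Complex.I_ne_zero, Complex.log_I, Complex.ofReal_log h0.le]
  rw [hl]
  push_cast
  ring

theorem sec_add (s k : ℤ) (ζ : ℂ) : sec N (s + 4 * N * k) ζ = sec N s ζ := by
  have hN' : (N : ℂ) ≠ 0 := by exact_mod_cast hN.ne'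
  unfold sec
  congr 1
  rw [Complex.exp_eq_exp_iff_exists_int]
  refine ⟨k, ?_⟩
  push_cast
  field_simp
  ring

theorem sec_eq_of_dvd {s s' : ℤ} (h : (4 * N : ℤ) ∣ s' - s) (ζ : ℂ) : sec N s' ζ = sec N s ζ := by
  obtain ⟨k, hk⟩ := h
  rw [← sec_add hN s k, ← hk]
  congr 1
  ring

theorem sec_surj (ω : ℂ) : ∃ s : ℤ, 0 ≤ s ∧ s < 4 * N ∧ ∃ ζ ∈ quad, sec N s ζ = ω := by
  have hN' : (N : ℂ) ≠ 0 := by exact_mod_cast hN.ne'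
  have hpi := Real.pi_pos
  suffices H : ∃ s : ℤ, ∃ ζ ∈ quad, sec N s ζ = ω by
    obtain ⟨s, ζ, hζ, h⟩ := H
    have hpos : (0 : ℤ) < 4 * N := by exact_mod_cast Nat.mul_pos (by norm_num) hN
    refine ⟨s % (4 * N), Int.emod_nonneg _ hpos.ne', Int.emod_lt_of_pos _ hpos, ζ, hζ, ?_⟩
    rw [← h]
    exact sec_eq_of_dvd hN (by rw [← dvd_neg, neg_sub]; exact Int.dvd_self_sub_emod) ζ
  by_cases h0 : ω = 0
  · exact ⟨0, 0, ⟨le_rfl, le_rfl⟩, by rw [h0, sec_zero hN]⟩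
  let a : ℝ := N * ω.arg
  -- The number of full quarter turns in the argument of `ω ^ N`, taken as `N` times the argument of
  -- `ω`; the remaining angle `θ` lies in the first quadrant.
  let s : ℤ := ⌊a / (Real.pi / 2)⌋
  let θ : ℝ := a - s * (Real.pi / 2)
  have h1 : (s : ℝ) * (Real.pi / 2) ≤ a := by
    have := Int.floor_le (a / (Real.pi / 2))
    rwa [le_div_iff₀ (by positivity)] at this
  have h2 : a < (s + 1 : ℝ) * (Real.pi / 2) := by
    have := Int.lt_floor_add_one (a / (Real.pi / 2))
    rwa [div_lt_iff₀ (by positivity)] at this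
  have hθ : 0 ≤ θ := by simp only [θ]; linarith
  have hθ' : θ ≤ Real.pi / 2 := by simp only [θ]; linarith
  have hR : 0 < ‖ω‖ ^ N := pow_pos (norm_pos_iff.2 h0) _
  have hlog : Complex.log (((‖ω‖ ^ N : ℝ) : ℂ) * Complex.exp (θ * Complex.I)) =
      N * Real.log ‖ω‖ + θ * Complex.I := by
    rw [Complex.log_ofReal_mul hR (Complex.exp_ne_zero _), Complex.log_exp (by simp; linarith)
      (by simp; linarith), Real.log_pow]
    push_cast
    ring
  refine ⟨s, ((‖ω‖ ^ N : ℝ) : ℂ) * Complex.exp (θ * Complex.I), ⟨?_, ?_⟩, ?_⟩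
  · rw [Complex.re_ofReal_mul, Complex.exp_ofReal_mul_I_re]
    exact mul_nonneg hR.le (Real.cos_nonneg_of_mem_Icc ⟨by linarith, hθ'⟩)
  · rw [Complex.im_ofReal_mul, Complex.exp_ofReal_mul_I_im]
    exact mul_nonneg hR.le (Real.sin_nonneg_of_mem_Icc ⟨hθ, by linarith⟩)
  · rw [sec_eq_exp _ (mul_ne_zero (by exact_mod_cast hR.ne') (Complex.exp_ne_zero _)), hlog]
    have : (N * (Real.log ‖ω‖ : ℂ) + θ * Complex.I + s * (Real.pi / 2 * Complex.I)) / N =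
        Complex.log ω := by
      rw [div_eq_iff hN']
      apply Complex.ext
      · simp [Complex.log_re]
        ring
      · have e : ((Real.pi : ℂ) / 2) = ((Real.pi / 2 : ℝ) : ℂ) := by push_cast; rfl
        rw [e]
        simp [Complex.log_im, -Complex.ofReal_div, θ, a]
        ring
    rw [this, Complex.exp_log h0]

theorem continuousOn_sec (s : ℤ) : ContinuousOn (sec N s) quad := by
  intro ζ hζ
  refine (continuousAt_const.mul ?_).continuousWithinAt
  apply Complex.continuousAt_cpow_const_of_re_pos (Or.inl hζ.1)
  have : ((N : ℂ)⁻¹).re = (N : ℝ)⁻¹ := by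
    rw [← Complex.ofReal_natCast, ← Complex.ofReal_inv, Complex.ofReal_re]
  rw [this]
  positivity

/-- The root map has the continuous left inverse `G`, so the image consists of the `ω` with `G ω ∈
T` that `sec` recovers from `G ω`. -/
theorem isClosed_sec_image (s : ℤ) {T : Set ℂ} (hT : IsClosed T) (hTq : T ⊆ quad) :
    IsClosed (sec N s '' T) := by
  let G : ℂ → ℂ := fun ω => (Complex.I ^ s)⁻¹ * ω ^ N
  -- Folding the plane onto the quadrant makes the last condition continuous everywhere, although
  -- the root is continuous only on the quadrant.
  let ret : ℂ → ℂ := fun ζ => ((|ζ.re| : ℝ) : ℂ) + ((|ζ.im| : ℝ) : ℂ) * Complex.I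
  have hI : Complex.I ^ s ≠ 0 := zpow_ne_zero _ Complex.I_ne_zero
  have hG : ∀ ζ, G (sec N s ζ) = ζ := by
    intro ζ
    simp only [G]
    rw [sec_pow hN, inv_mul_cancel_left₀ hI]
  have hGc : Continuous G := by fun_prop
  have hret : ∀ ζ ∈ quad, ret ζ = ζ := by
    intro ζ hζ
    apply Complex.ext <;> simp [ret, abs_of_nonneg hζ.1, abs_of_nonneg hζ.2]
  have hretc : Continuous ret := by fun_prop
  have hretq : ∀ ζ, ret ζ ∈ quad := fun ζ => ⟨by simp [ret], by simp [ret]⟩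
  have hc : Continuous fun ω => sec N s (ret (G ω)) :=
    (continuousOn_sec hN s).comp_continuous (hretc.comp hGc) fun ω => hretq _
  have : sec N s '' T = G ⁻¹' T ∩ {ω | sec N s (ret (G ω)) = ω} := by
    ext ω
    constructor
    · rintro ⟨ζ, hζ, rfl⟩
      refine ⟨by rw [Set.mem_preimage, hG]; exact hζ, ?_⟩
      change sec N s (ret (G (sec N s ζ))) = _
      rw [hG, hret ζ (hTq hζ)]
    · rintro ⟨h1, h2⟩
      exact ⟨G ω, h1, by rw [← hret _ (hTq h1)]; exact h2⟩
  rw [this]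
  exact (hT.preimage hGc).inter (isClosed_eq hc continuous_id)

end Sector

/-- The union of sectors with boundary lengths `A s`, before the identification of their sides. -/
abbrev Star (A : ℤ → ℝ) : Type :=
  {x : ℤ × ℂ // x.2 ∈ quad ∧ x.2.re < A x.1 ∧ x.2.im < A (x.1 + 1)}

/-- The map of the union of the sectors to the plane. -/
def Star.toPlane {A : ℤ → ℝ} (N : ℕ) (x : Star A) : ℂ := sec N x.1.1 x.1.2

theorem Star.continuous_toPlane {A : ℤ → ℝ} {N : ℕ} (hN : 0 < N) :
    Continuous (Star.toPlane N : Star A → ℂ) := by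
  rw [continuous_iff_continuousAt]
  intro x
  have hfst : Continuous fun y : Star A => y.1.1 := continuous_fst.comp continuous_subtype_val
  have h1 : ∀ᶠ y : Star A in 𝓝 x, y.1.1 = x.1.1 :=
    hfst.continuousAt.eventually ((isOpen_discrete {x.1.1}).mem_nhds rfl)
  have h2 : Continuous fun y : Star A => sec N x.1.1 y.1.2 :=
    (continuousOn_sec hN _).comp_continuous (continuous_snd.comp continuous_subtype_val)
      fun y => y.2.1
  refine h2.continuousAt.congr ?_
  filter_upwards [h1] with y hy
  simp only [Star.toPlane, hy]

/-- The complement of the image is a union of closed sets, one for each sector. Finitely many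
sectors suffice because the index matters only modulo `4N`; saturation ensures that a point missing
in one sector is missing in the adjacent one too. -/
theorem Star.isOpen_toPlane_image {A : ℤ → ℝ} {N : ℕ} (hN : 0 < N) (hA : ∀ s, 0 < A s)
    (hA' : ∀ s s', (4 * N : ℤ) ∣ s' - s → A s' = A s) {V : Set (Star A)} (hV : IsOpen V)
    (hsat : ∀ x y : Star A, x.toPlane N = y.toPlane N → x ∈ V → y ∈ V) :
    IsOpen (Star.toPlane N '' V) := by
  obtain ⟨W, hW, rfl⟩ := isOpen_induced_iff.1 hV
  let T : ℤ → Set ℂ := fun s => quad ∩ {ζ | (s, ζ) ∈ W ∧ ζ.re < A s ∧ ζ.im < A (s + 1)}ᶜ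
  have hquad : IsClosed quad :=
    (isClosed_le continuous_const Complex.continuous_re).inter
      (isClosed_le continuous_const Complex.continuous_im)
  have hT : ∀ s, IsClosed (T s) := by
    intro s
    refine hquad.inter (IsOpen.isClosed_compl ?_)
    exact (hW.preimage (by fun_prop)).inter
      ((isOpen_lt Complex.continuous_re continuous_const).inter
        (isOpen_lt Complex.continuous_im continuous_const))
  have hcompl : (Star.toPlane N '' (Subtype.val ⁻¹' W : Set (Star A)))ᶜ =
      ⋃ s ∈ Finset.Ico (0 : ℤ) (4 * N), sec N s '' T s := by
    ext ω
    simp only [Set.mem_compl_iff, Set.mem_iUnion, Finset.mem_Ico, exists_prop]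
    constructor
    · intro hω
      obtain ⟨s, h0, h1, ζ, hζ, rfl⟩ := sec_surj hN ω
      refine ⟨s, ⟨h0, h1⟩, ζ, ⟨hζ, ?_⟩, rfl⟩
      rintro ⟨h2, h3, h4⟩
      exact hω ⟨⟨(s, ζ), hζ, h3, h4⟩, h2, rfl⟩
    · rintro ⟨s, -, ζ, ⟨hζ, hζT⟩, rfl⟩ ⟨x, hxW, hx⟩
      -- The bound `A s` belongs to the ray shared by the sectors `s - 1` and `s`, so it does not
      -- depend on the sector in which the point is written.
      have hreg : ζ.re < A s ∧ ζ.im < A (s + 1) := by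
        obtain ⟨⟨s', ζ'⟩, hq', h1, h2⟩ := x
        simp only at h1 h2 hq'
        rcases sec_eq_cases hN hζ hq' hx.symm with h | h | h | h
        · rw [h.1]
          exact ⟨hA _, hA _⟩
        · rw [h.2, ← hA' _ _ h.1, ← hA' (s + 1) (s' + 1) (by simpa using h.1)]
          exact ⟨h1, h2⟩
        · obtain ⟨h3, h4, h5⟩ := h
          rw [h4, ← hA' _ _ h3]
          refine ⟨hA _, ?_⟩
          rw [h5] at h1
          simpa using h1
        · obtain ⟨h3, h4, h5⟩ := h
          rw [h5, hA' _ _ h3]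
          refine ⟨?_, ?_⟩
          · simpa using h2
          · simpa using hA _
      exact hζT ⟨hsat x ⟨(s, ζ), hζ, hreg.1, hreg.2⟩ hx hxW, hreg⟩
  rw [← isClosed_compl_iff, hcompl]
  exact isClosed_biUnion_finset fun s _ => isClosed_sec_image hN s (hT s) Set.inter_subset_left

end GridSurface
end

noncomputable section

namespace GridSurface

namespace RectSystem

variable {D : RectSystem}

/-! ### The corners of the rectangles -/

variable (D) in
/-- A corner of a rectangle: lower left, lower right, upper right, upper left. -/
abbrev Corner : Type := D.I × Fin 4

/-- The next corner, counter-clockwise, at the same vertex. -/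
def rotFun : D.Corner → D.Corner
  | (i, 0) => (D.r.symm i, 1)
  | (i, 1) => (D.u.symm i, 2)
  | (i, 2) => (D.r i, 3)
  | (i, 3) => (D.u i, 0)

/-- The preceding corner at the same vertex. -/
def rotInv : D.Corner → D.Corner
  | (i, 0) => (D.u.symm i, 3)
  | (i, 1) => (D.r i, 0)
  | (i, 2) => (D.u i, 1)
  | (i, 3) => (D.r.symm i, 2)

variable (D) in
/-- The quarter turn of the corners around their vertices. -/
def rot : Equiv.Perm D.Corner where
  toFun := rotFun
  invFun := rotInv
  left_inv := by
    rintro ⟨i, t⟩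
    fin_cases t <;> simp [rotFun, rotInv]
  right_inv := by
    rintro ⟨i, t⟩
    fin_cases t <;> simp [rotFun, rotInv]

/-- The coordinate in a rectangle of the point with the given coordinate at a corner. -/
def loc : D.Corner → ℂ → ℂ
  | (_, 0), ζ => ζ
  | (i, 1), ζ => ⟨D.w i - ζ.im, ζ.re⟩
  | (i, 2), ζ => ⟨D.w i - ζ.re, D.h i - ζ.im⟩
  | (i, 3), ζ => ⟨ζ.im, D.h i - ζ.re⟩

/-- The coordinate at a corner of a point of the rectangle. -/
def locInv : D.Corner → ℂ → ℂ
  | (_, 0), z => z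
  | (i, 1), z => ⟨z.im, D.w i - z.re⟩
  | (i, 2), z => ⟨D.w i - z.re, D.h i - z.im⟩
  | (i, 3), z => ⟨D.h i - z.im, z.re⟩

theorem loc_locInv (κ : D.Corner) (z : ℂ) : loc κ (locInv κ z) = z := by
  obtain ⟨i, t⟩ := κ
  fin_cases t <;> simp [loc, locInv]

theorem locInv_loc (κ : D.Corner) (z : ℂ) : locInv κ (loc κ z) = z := by
  obtain ⟨i, t⟩ := κ
  fin_cases t <;> simp [loc, locInv]

theorem continuous_mk {X : Type*} [TopologicalSpace X] {f g : X → ℝ} (hf : Continuous f)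
    (hg : Continuous g) : Continuous fun x => (⟨f x, g x⟩ : ℂ) := by
  simp only [Complex.mk_eq_add_mul_I]
  fun_prop

theorem continuous_loc (κ : D.Corner) : Continuous (loc κ) := by
  obtain ⟨i, t⟩ := κ
  fin_cases t
  · exact continuous_id
  · exact continuous_mk (continuous_const.sub Complex.continuous_im) Complex.continuous_re
  · exact continuous_mk (continuous_const.sub Complex.continuous_re)
      (continuous_const.sub Complex.continuous_im)
  · exact continuous_mk Complex.continuous_im (continuous_const.sub Complex.continuous_re)

theorem continuous_locInv (κ : D.Corner) : Continuous (locInv κ) := by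
  obtain ⟨i, t⟩ := κ
  fin_cases t
  · exact continuous_id
  · exact continuous_mk Complex.continuous_im (continuous_const.sub Complex.continuous_re)
  · exact continuous_mk (continuous_const.sub Complex.continuous_re)
      (continuous_const.sub Complex.continuous_im)
  · exact continuous_mk (continuous_const.sub Complex.continuous_im) Complex.continuous_re

/-- The position of a corner. -/
def cpos (κ : D.Corner) : ℂ := loc κ 0

/-- The corner coordinates differ from the coordinate of the rectangle by a quarter-turn rotation
and a translation, which makes the charts at vertices compatible with `dz`. -/
theorem loc_eq (κ : D.Corner) (ζ : ℂ) : loc κ ζ = cpos κ + Complex.I ^ (κ.2 : ℕ) * ζ := by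
  obtain ⟨i, t⟩ := κ
  fin_cases t <;> apply Complex.ext <;> simp [loc, cpos, pow_succ] <;> ring

theorem locInv_mem_quad {κ : D.Corner} {z : ℂ} (hz : z ∈ D.rect κ.1) : locInv κ z ∈ quad := by
  obtain ⟨i, t⟩ := κ
  rw [mem_rect] at hz
  simp only at hz
  obtain ⟨⟨h1, h2⟩, h3, h4⟩ := hz
  fin_cases t
  · exact ⟨h1, h3⟩
  · exact ⟨h3, sub_nonneg.2 h2⟩
  · exact ⟨sub_nonneg.2 h2, sub_nonneg.2 h4⟩
  · exact ⟨sub_nonneg.2 h4, h1⟩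

/-- The size of the part of a rectangle that belongs to a corner, if the rectangles are cut
vertically and horizontally in the ratios `c` and `d`. -/
def cut (c d : ℝ) : D.Corner → ℝ
  | (i, 0) => c * D.w i
  | (i, 1) => d * D.h i
  | (i, 2) => (1 - c) * D.w i
  | (i, 3) => (1 - d) * D.h i

section Cut

variable {c d : ℝ} (hc : 0 < c ∧ c < 1) (hd : 0 < d ∧ d < 1)
include hc hd

theorem cut_pos (κ : D.Corner) : 0 < cut c d κ := by
  obtain ⟨i, t⟩ := κ
  have h1 := D.w_pos i
  have h2 := D.h_pos i
  fin_cases t <;> simp only [cut] <;> apply mul_pos <;> linarith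

/-- The part of a corner chart that belongs to the corner. -/
def Part (c d : ℝ) (κ : D.Corner) (ζ : ℂ) : Prop :=
  -- The imaginary axis at a corner is the real axis at the next one, so a single function `cut`
  -- bounds both coordinates.
  ζ ∈ quad ∧ ζ.re < cut c d κ ∧ ζ.im < cut c d (D.rot κ)

omit hc hd in
theorem part_zero_iff {i : D.I} {ζ : ℂ} : Part c d (i, 0) ζ ↔
    (0 ≤ ζ.re ∧ 0 ≤ ζ.im) ∧ ζ.re < c * D.w i ∧ ζ.im < d * D.h i := by
  change (_ ∧ _ ∧ ζ.im < d * D.h (D.r.symm i)) ↔ _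
  rw [h_r_symm]
  rfl

omit hc hd in
theorem part_one_iff {i : D.I} {ζ : ℂ} : Part c d (i, 1) ζ ↔
    (0 ≤ ζ.re ∧ 0 ≤ ζ.im) ∧ ζ.re < d * D.h i ∧ ζ.im < (1 - c) * D.w i := by
  change (_ ∧ _ ∧ ζ.im < (1 - c) * D.w (D.u.symm i)) ↔ _
  rw [w_r_u_symm]
  rfl

omit hc hd in
theorem part_two_iff {i : D.I} {ζ : ℂ} : Part c d (i, 2) ζ ↔
    (0 ≤ ζ.re ∧ 0 ≤ ζ.im) ∧ ζ.re < (1 - c) * D.w i ∧ ζ.im < (1 - d) * D.h i := by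
  change (_ ∧ _ ∧ ζ.im < (1 - d) * D.h (D.r i)) ↔ _
  rw [D.h_r]
  rfl

omit hc hd in
theorem part_three_iff {i : D.I} {ζ : ℂ} : Part c d (i, 3) ζ ↔
    (0 ≤ ζ.re ∧ 0 ≤ ζ.im) ∧ ζ.re < (1 - d) * D.h i ∧ ζ.im < c * D.w i := by
  change (_ ∧ _ ∧ ζ.im < c * D.w (D.u i)) ↔ _
  rw [D.w_u]
  rfl

theorem Part.loc_mem {κ : D.Corner} {ζ : ℂ} (h : Part c d κ ζ) : loc κ ζ ∈ D.rect κ.1 := by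
  obtain ⟨i, t⟩ := κ
  have h1 := D.w_pos i
  have h2 := D.h_pos i
  rw [mem_rect]
  fin_cases t
  · replace h := part_zero_iff.1 h
    simp only [loc]
    refine ⟨⟨?_, ?_⟩, ?_, ?_⟩ <;> nlinarith
  · replace h := part_one_iff.1 h
    simp only [loc]
    refine ⟨⟨?_, ?_⟩, ?_, ?_⟩ <;> nlinarith
  · replace h := part_two_iff.1 h
    simp only [loc]
    refine ⟨⟨?_, ?_⟩, ?_, ?_⟩ <;> nlinarith
  · replace h := part_three_iff.1 h
    simp only [loc]
    refine ⟨⟨?_, ?_⟩, ?_, ?_⟩ <;> nlinarith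

omit hc hd in
/-- A point determines the corner it belongs to. -/
theorem Part.corner_eq {i : D.I} {t t' : Fin 4} {ζ ζ' : ℂ} (h : Part c d (i, t) ζ)
    (h' : Part c d (i, t') ζ') (he : loc (i, t) ζ = loc (i, t') ζ') : t = t' := by
  have h1 := D.w_pos i
  have h2 := D.h_pos i
  have hre := congrArg Complex.re he
  have him := congrArg Complex.im he
  fin_cases t <;> fin_cases t' <;>
    simp only [Fin.zero_eta, Fin.mk_one, Fin.reduceFinMk, part_zero_iff, part_one_iff,
      part_two_iff, part_three_iff, loc] at h h' hre him ⊢ <;>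
    exfalso <;> linarith

-- A right side meets only the parts of its two end corners, along the real axis of the lower one
-- and the imaginary axis of the upper one. Across it, these continue to the preceding and to the
-- next corner at the same vertex. The three lemmas below treat the other sides in the same way.
omit hd in
theorem Part.horizontal {p p' : D.Pt} (hg1 : p'.1 = D.r p.1) (hg2 : (crd p).re = D.w p.1)
    (hg3 : (crd p').re = 0) (hg4 : (crd p').im = (crd p).im) {t : Fin 4} {ζ : ℂ}
    (h : Part c d (p.1, t) ζ) (hp : crd p = loc (p.1, t) ζ) :
    (ζ.re = 0 ∧ p' = pt (D.rot (p.1, t)).1 (loc (D.rot (p.1, t)) ζ.im)) ∨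
    (ζ.im = 0 ∧ p' = pt (D.rot⁻¹ (p.1, t)).1 (loc (D.rot⁻¹ (p.1, t)) ⟨0, ζ.re⟩)) := by
  have h1 := D.w_pos p.1
  have h2 := D.h_pos p.1
  have hre := congrArg Complex.re hp
  have him := congrArg Complex.im hp
  fin_cases t <;>
    simp only [Fin.zero_eta, Fin.mk_one, Fin.reduceFinMk, part_zero_iff, part_one_iff,
      part_two_iff, part_three_iff, loc] at h hre him ⊢
  · exfalso
    nlinarith
  · right
    refine ⟨by linarith, pt_eq hg1 ?_⟩
    change _ = (⟨0, ζ.re⟩ : ℂ)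
    exact Complex.ext hg3 (by rw [hg4, him])
  · left
    refine ⟨by linarith, pt_eq hg1 ?_⟩
    change _ = (⟨(ζ.im : ℂ).im, D.h (D.r p.1) - (ζ.im : ℂ).re⟩ : ℂ)
    rw [D.h_r]
    exact Complex.ext hg3 (by rw [hg4, him]; rfl)
  · exfalso
    nlinarith

omit hd in
theorem Part.horizontal_symm {p p' : D.Pt} (hg1 : p'.1 = D.r p.1) (hg2 : (crd p).re = D.w p.1)
    (hg3 : (crd p').re = 0) (hg4 : (crd p').im = (crd p).im) {t : Fin 4} {ζ : ℂ}
    (h : Part c d (p'.1, t) ζ) (hp : crd p' = loc (p'.1, t) ζ) :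
    (ζ.re = 0 ∧ p = pt (D.rot (p'.1, t)).1 (loc (D.rot (p'.1, t)) ζ.im)) ∨
    (ζ.im = 0 ∧ p = pt (D.rot⁻¹ (p'.1, t)).1 (loc (D.rot⁻¹ (p'.1, t)) ⟨0, ζ.re⟩)) := by
  have h1 := D.w_pos p'.1
  have h2 := D.h_pos p'.1
  have hre := congrArg Complex.re hp
  have him := congrArg Complex.im hp
  have hg1' : p.1 = D.r.symm p'.1 := by rw [hg1, Equiv.symm_apply_apply]
  fin_cases t <;>
    simp only [Fin.zero_eta, Fin.mk_one, Fin.reduceFinMk, part_zero_iff, part_one_iff,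
      part_two_iff, part_three_iff, loc] at h hre him ⊢
  · left
    refine ⟨by linarith, pt_eq hg1' ?_⟩
    change _ = (⟨D.w (D.r.symm p'.1) - (ζ.im : ℂ).im, (ζ.im : ℂ).re⟩ : ℂ)
    rw [← hg1', Complex.ofReal_im, sub_zero]
    exact Complex.ext hg2 (by rw [← hg4, him]; rfl)
  · exfalso
    nlinarith
  · exfalso
    nlinarith
  · right
    refine ⟨by linarith, pt_eq hg1' ?_⟩
    change _ = (⟨D.w (D.r.symm p'.1) - 0, D.h (D.r.symm p'.1) - ζ.re⟩ : ℂ)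
    rw [h_r_symm, ← hg1', sub_zero]
    exact Complex.ext hg2 (by rw [← hg4, him])

omit hc in
theorem Part.vertical {p p' : D.Pt} (hg1 : p'.1 = D.u p.1) (hg2 : (crd p).im = D.h p.1)
    (hg3 : (crd p').im = 0) (hg4 : (crd p').re = (crd p).re) {t : Fin 4} {ζ : ℂ}
    (h : Part c d (p.1, t) ζ) (hp : crd p = loc (p.1, t) ζ) :
    (ζ.re = 0 ∧ p' = pt (D.rot (p.1, t)).1 (loc (D.rot (p.1, t)) ζ.im)) ∨
    (ζ.im = 0 ∧ p' = pt (D.rot⁻¹ (p.1, t)).1 (loc (D.rot⁻¹ (p.1, t)) ⟨0, ζ.re⟩)) := by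
  have h1 := D.w_pos p.1
  have h2 := D.h_pos p.1
  have hre := congrArg Complex.re hp
  have him := congrArg Complex.im hp
  fin_cases t <;>
    simp only [Fin.zero_eta, Fin.mk_one, Fin.reduceFinMk, part_zero_iff, part_one_iff,
      part_two_iff, part_three_iff, loc] at h hre him ⊢
  · exfalso
    nlinarith
  · exfalso
    nlinarith
  · right
    refine ⟨by linarith, pt_eq hg1 ?_⟩
    change _ = (⟨D.w (D.u p.1) - ζ.re, 0⟩ : ℂ)
    rw [D.w_u]
    exact Complex.ext (by rw [hg4, hre]) hg3
  · left
    refine ⟨by linarith, pt_eq hg1 ?_⟩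
    change _ = (ζ.im : ℂ)
    exact Complex.ext (by rw [hg4, hre]; rfl) hg3

omit hc in
theorem Part.vertical_symm {p p' : D.Pt} (hg1 : p'.1 = D.u p.1) (hg2 : (crd p).im = D.h p.1)
    (hg3 : (crd p').im = 0) (hg4 : (crd p').re = (crd p).re) {t : Fin 4} {ζ : ℂ}
    (h : Part c d (p'.1, t) ζ) (hp : crd p' = loc (p'.1, t) ζ) :
    (ζ.re = 0 ∧ p = pt (D.rot (p'.1, t)).1 (loc (D.rot (p'.1, t)) ζ.im)) ∨
    (ζ.im = 0 ∧ p = pt (D.rot⁻¹ (p'.1, t)).1 (loc (D.rot⁻¹ (p'.1, t)) ⟨0, ζ.re⟩)) := by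
  have h1 := D.w_pos p'.1
  have h2 := D.h_pos p'.1
  have hre := congrArg Complex.re hp
  have him := congrArg Complex.im hp
  have hg1' : p.1 = D.u.symm p'.1 := by rw [hg1, Equiv.symm_apply_apply]
  fin_cases t <;>
    simp only [Fin.zero_eta, Fin.mk_one, Fin.reduceFinMk, part_zero_iff, part_one_iff,
      part_two_iff, part_three_iff, loc] at h hre him ⊢
  · right
    refine ⟨by linarith, pt_eq hg1' ?_⟩
    change _ = (⟨ζ.re, D.h (D.u.symm p'.1) - 0⟩ : ℂ)
    rw [← hg1', sub_zero]
    exact Complex.ext (by rw [← hg4, hre]) hg2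
  · left
    refine ⟨by linarith, pt_eq hg1' ?_⟩
    change _ = (⟨D.w (D.u.symm p'.1) - (ζ.im : ℂ).re, D.h (D.u.symm p'.1) - (ζ.im : ℂ).im⟩ : ℂ)
    rw [w_r_u_symm, ← hg1', Complex.ofReal_im, sub_zero]
    exact Complex.ext (by rw [← hg4, hre]; rfl) hg2
  · exfalso
    nlinarith
  · exfalso
    nlinarith

end Cut

end RectSystem

end GridSurface
end

noncomputable section

namespace GridSurface

namespace RectSystem

variable {D : RectSystem}

/-! ### The corners around a vertex -/

/-- The corners around the vertex in the lower left corner of the `i`-th rectangle. -/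
def around (i : D.I) (s : ℤ) : D.Corner := (D.rot ^ s) (i, 0)

theorem around_zero (i : D.I) : around i 0 = (i, 0) := rfl

theorem around_succ (i : D.I) (s : ℤ) : around i (s + 1) = D.rot (around i s) := by
  unfold around
  rw [add_comm, zpow_one_add, Equiv.Perm.mul_apply]

theorem around_pred (i : D.I) (s : ℤ) : around i (s - 1) = D.rot⁻¹ (around i s) := by
  rw [Equiv.Perm.eq_inv_iff_eq, ← around_succ, sub_add_cancel]

theorem I_pow_rot (κ : D.Corner) :
    Complex.I ^ ((D.rot κ).2 : ℕ) = Complex.I ^ (κ.2 : ℕ) * Complex.I := by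
  obtain ⟨i, t⟩ := κ
  rw [← pow_succ]
  fin_cases t
  · rfl
  · rfl
  · rfl
  · change Complex.I ^ 0 = Complex.I ^ 4
    simp

/-- The label of the corner after `s` quarter turns is `s` modulo `4`, expressed by powers of `I`,
which is also how it enters the charts. -/
theorem I_pow_around (i : D.I) (s : ℤ) :
    Complex.I ^ ((around i s).2 : ℕ) = Complex.I ^ s := by
  have hI := Complex.I_ne_zero
  induction s using Int.induction_on with
  | zero => simp [around_zero]
  | succ s ih => rw [around_succ, I_pow_rot, ih, zpow_add_one₀ hI]
  | pred s ih =>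
    have h := I_pow_rot (around i (-(s : ℤ) - 1))
    rw [← around_succ, sub_add_cancel, ih] at h
    rw [zpow_sub_one₀ hI, h, mul_assoc, mul_inv_cancel₀ hI, mul_one]

theorem around_four_mul (i : D.I) (k : ℤ) : around i (4 * k) = ((D.C ^ k) i, 0) := by
  have h4 : ∀ j : D.I, (D.rot ^ (4 : ℤ)) (j, 0) = (D.C j, 0) := fun j => rfl
  unfold around
  rw [zpow_mul]
  induction k using Int.induction_on with
  | zero => rfl
  | succ k ih =>
    rw [add_comm, zpow_one_add, zpow_one_add, Equiv.Perm.mul_apply, Equiv.Perm.mul_apply, ih, h4]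
  | pred k ih =>
    rw [sub_eq_neg_add, zpow_add, zpow_add, Equiv.Perm.mul_apply, Equiv.Perm.mul_apply, ih,
      zpow_neg_one, zpow_neg_one, Equiv.Perm.inv_eq_iff_eq, h4]
    simp

variable (D) in
/-- The cone angle at a vertex, as a multiple of `2π`. -/
def mult (i : D.I) : ℕ := Function.minimalPeriod D.C i

theorem mult_pos (i : D.I) : 0 < D.mult i := by
  apply Function.minimalPeriod_pos_of_mem_periodicPts
  refine Function.mk_mem_periodicPts (orderOf_pos D.C) ?_
  rw [Function.IsPeriodicPt, Function.IsFixedPt, Equiv.Perm.iterate_eq_pow, pow_orderOf_eq_one]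
  rfl

theorem zpow_C_eq_iff (i : D.I) (k : ℤ) : (D.C ^ k) i = i ↔ (D.mult i : ℤ) ∣ k :=
  MulAction.zpow_smul_eq_iff_minimalPeriod_dvd (a := D.C) (b := i)

theorem four_dvd_of_I_zpow {s : ℤ} (h : Complex.I ^ s = 1) : (4 : ℤ) ∣ s := by
  have := Complex.isPrimitiveRoot_exp 4 (by norm_num)
  have e : Complex.exp (2 * Real.pi * Complex.I / (4 : ℕ)) = Complex.I := by
    rw [show 2 * (Real.pi : ℂ) * Complex.I / (4 : ℕ) = Real.pi / 2 * Complex.I by push_cast; ring]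
    exact Complex.exp_pi_div_two_mul_I
  rw [e] at this
  exact (this.zpow_eq_one_iff_dvd s).1 h

/-- Equal corners have equal labels, so the number of quarter turns between them is a multiple of
`4`; four quarter turns make one application of `C`. -/
theorem around_eq_iff (i : D.I) (s s' : ℤ) :
    around i s = around i s' ↔ (4 * D.mult i : ℤ) ∣ s' - s := by
  have h0 : around i s = around i s' ↔ around i (s' - s) = (i, 0) := by
    unfold around
    rw [sub_eq_neg_add, zpow_add, zpow_neg, Equiv.Perm.mul_apply, Equiv.Perm.inv_eq_iff_eq, eq_comm]
  rw [h0]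
  constructor
  · intro h
    have h1 := I_pow_around i (s' - s)
    rw [h] at h1
    obtain ⟨k, hk⟩ := four_dvd_of_I_zpow (h1.symm.trans (by simp))
    rw [hk, around_four_mul, Prod.mk.injEq, zpow_C_eq_iff] at h
    rw [hk]
    exact mul_dvd_mul_left 4 h.1
  · rintro ⟨k, hk⟩
    rw [hk, mul_assoc, around_four_mul, (zpow_C_eq_iff i _).2 (dvd_mul_right _ _)]

theorem exists_around (κ : D.Corner) : ∃ i s, around i s = κ := by
  obtain ⟨i, t⟩ := κ
  fin_cases t
  · exact ⟨i, 0, rfl⟩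
  · refine ⟨D.r i, 1, ?_⟩
    change (D.r.symm (D.r i), _) = _
    rw [Equiv.symm_apply_apply]
    rfl
  · refine ⟨D.r (D.u i), 2, ?_⟩
    change (D.u.symm (D.r.symm (D.r (D.u i))), _) = _
    rw [Equiv.symm_apply_apply, Equiv.symm_apply_apply]
    rfl
  · refine ⟨D.u i, -1, ?_⟩
    change (D.u.symm (D.u i), _) = _
    rw [Equiv.symm_apply_apply]
    rfl

/-! ### The charts around the vertices -/

/-- The sectors around a vertex. -/
abbrev VStar (c d : ℝ) (i : D.I) : Type := Star fun s => cut c d (around i s)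

theorem vstar_part {c d : ℝ} {i : D.I} (x : VStar c d i) :
    Part c d (around i x.1.1) x.1.2 := by
  refine ⟨x.2.1, x.2.2.1, ?_⟩
  rw [← around_succ]
  exact x.2.2.2

/-- The point of the sectors around a vertex with a given position at a corner. -/
def VStar.mk {c d : ℝ} {i : D.I} (s : ℤ) (ζ : ℂ) (h : Part c d (around i s) ζ) : VStar c d i :=
  ⟨(s, ζ), h.1, h.2.1, by
    change ζ.im < cut c d (around i (s + 1))
    rw [around_succ]
    exact h.2.2⟩

/-- The map of the sectors around a vertex to the rectangles. -/
def VStar.emb {c d : ℝ} {i : D.I} (x : VStar c d i) : D.Pt :=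
  pt (around i x.1.1).1 (loc (around i x.1.1) x.1.2)

section Chart

variable {c d : ℝ} (hc : 0 < c ∧ c < 1) (hd : 0 < d ∧ d < 1)
include hc hd

theorem VStar.crd_emb {i : D.I} (x : VStar c d i) :
    crd x.emb = loc (around i x.1.1) x.1.2 :=
  crd_pt ((vstar_part x).loc_mem hc hd)

omit hc hd in
theorem VStar.continuous_emb {i : D.I} : Continuous (VStar.emb : VStar c d i → D.Pt) := by
  rw [continuous_iff_continuousAt]
  intro x
  have hfst : Continuous fun y : VStar c d i => y.1.1 := continuous_fst.comp continuous_subtype_val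
  have hsnd : Continuous fun y : VStar c d i => y.1.2 := continuous_snd.comp continuous_subtype_val
  have h1 : ∀ᶠ y : VStar c d i in 𝓝 x, y.1.1 = x.1.1 :=
    hfst.continuousAt.eventually ((isOpen_discrete {x.1.1}).mem_nhds rfl)
  have h2 : Continuous fun y : VStar c d i => pt (around i x.1.1).1 (loc (around i x.1.1) y.1.2) :=
    (continuous_pt _).comp ((continuous_loc _).comp hsnd)
  refine h2.continuousAt.congr ?_
  filter_upwards [h1] with y hy
  simp only [VStar.emb, hy]

theorem VStar.emb_eq_iff {i : D.I} {x : VStar c d i} {p : D.Pt} :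
    x.emb = p ↔ p.1 = (around i x.1.1).1 ∧ x.1.2 = locInv (around i x.1.1) (crd p) := by
  constructor
  · rintro rfl
    exact ⟨rfl, by rw [VStar.crd_emb hc hd, locInv_loc]⟩
  · rintro ⟨h1, h2⟩
    exact (pt_eq h1 (by rw [h2, loc_locInv])).symm

/-- The defining bounds are strict, and the condition to lie in the quadrant holds automatically for
points of a rectangle. -/
theorem VStar.isOpenMap_emb {i : D.I} : IsOpenMap (VStar.emb : VStar c d i → D.Pt) := by
  intro V hV
  obtain ⟨W, hW, rfl⟩ := isOpen_induced_iff.1 hV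
  let : TopologicalSpace D.I := ⊥
  have : DiscreteTopology D.I := ⟨rfl⟩
  have hfst : Continuous (fun p : D.Pt => p.1) :=
    continuous_sigma fun _ => continuous_const
  have hl : ∀ s, Continuous fun p : D.Pt => locInv (around i s) (crd p) :=
    fun s => (continuous_locInv _).comp continuous_crd
  have h : VStar.emb '' (Subtype.val ⁻¹' W : Set (VStar c d i)) = ⋃ s : ℤ,
      ((fun p : D.Pt => p.1) ⁻¹' {(around i s).1} ∩
        {p | (locInv (around i s) (crd p)).re < cut c d (around i s)} ∩
        {p | (locInv (around i s) (crd p)).im < cut c d (around i (s + 1))} ∩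
        (fun p => (s, locInv (around i s) (crd p))) ⁻¹' W) := by
    ext p
    constructor
    · rintro ⟨x, hx, hxp⟩
      rw [VStar.emb_eq_iff hc hd] at hxp
      refine Set.mem_iUnion.2 ⟨x.1.1, ⟨⟨hxp.1, ?_⟩, ?_⟩, ?_⟩
      · change Complex.re _ < _
        rw [← hxp.2]
        exact x.2.2.1
      · change Complex.im _ < _
        rw [← hxp.2]
        exact x.2.2.2
      · rw [Set.mem_preimage, ← hxp.2]
        exact hx
    · intro hp
      obtain ⟨s, ⟨⟨hs1, hs2⟩, hs3⟩, hs4⟩ := Set.mem_iUnion.1 hp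
      have hs1' : p.1 = (around i s).1 := hs1
      refine ⟨⟨(s, locInv (around i s) (crd p)), ?_, hs2, hs3⟩, hs4, ?_⟩
      · apply locInv_mem_quad
        rw [← hs1']
        exact crd_mem p
      · rw [VStar.emb_eq_iff hc hd]
        exact ⟨hs1, rfl⟩
  rw [h]
  refine isOpen_iUnion fun s => IsOpen.inter (IsOpen.inter (IsOpen.inter ?_ ?_) ?_) ?_
  · exact (isOpen_discrete _).preimage hfst
  · exact isOpen_lt (Complex.continuous_re.comp (hl s)) continuous_const
  · exact isOpen_lt (Complex.continuous_im.comp (hl s)) continuous_const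
  · exact hW.preimage (continuous_const.prodMk (hl s))

/-- A point of a rectangle lies in the part of at most one corner, and that corner fixes the sector
modulo `4N`. -/
theorem VStar.toPlane_eq_of_emb_eq {i : D.I} {x y : VStar c d i} (h : x.emb = y.emb) :
    x.toPlane (D.mult i) = y.toPlane (D.mult i) := by
  have h0 := congrArg Sigma.fst h
  have h1 := congrArg crd h
  rw [VStar.crd_emb hc hd, VStar.crd_emb hc hd] at h1
  have hI : (around i x.1.1).1 = (around i y.1.1).1 := h0
  have hx := vstar_part x
  have hy := vstar_part y
  have hκ : around i x.1.1 = around i y.1.1 := by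
    refine Prod.ext hI ?_
    generalize around i x.1.1 = κ at *
    generalize around i y.1.1 = κ' at *
    obtain ⟨j, t⟩ := κ
    obtain ⟨j', t'⟩ := κ'
    simp only at hI
    subst hI
    exact Part.corner_eq hx hy h1
  have hζ : x.1.2 = y.1.2 := by
    rw [← locInv_loc (around i x.1.1) x.1.2, h1, hκ, locInv_loc]
  have hs := (around_eq_iff i _ _).1 hκ
  unfold Star.toPlane
  rw [hζ, sec_eq_of_dvd (mult_pos i) hs]

theorem Part.fwd {κ : D.Corner} {ζ : ℂ} (h : Part c d κ ζ) :
    Part c d (D.rot κ) ζ.im :=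
  ⟨⟨h.1.2, le_rfl⟩, h.2.2, cut_pos hc hd _⟩

theorem Part.bwd {κ : D.Corner} {ζ : ℂ} (h : Part c d κ ζ) :
    Part c d (D.rot⁻¹ κ) ⟨0, ζ.re⟩ :=
  ⟨⟨le_rfl, h.1.1⟩, cut_pos hc hd _, by simpa using h.2.1⟩

theorem VStar.step {i : D.I} (x : VStar c d i) {p : D.Pt}
    (h : (x.1.2.re = 0 ∧ p = pt (D.rot (around i x.1.1)).1 (loc (D.rot (around i x.1.1)) x.1.2.im)) ∨
      (x.1.2.im = 0 ∧
        p = pt (D.rot⁻¹ (around i x.1.1)).1 (loc (D.rot⁻¹ (around i x.1.1)) ⟨0, x.1.2.re⟩))) :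
    ∃ y : VStar c d i, y.emb = p ∧ y.toPlane (D.mult i) = x.toPlane (D.mult i) := by
  have hx := vstar_part x
  rcases h with ⟨h0, h1⟩ | ⟨h0, h1⟩
  · have hp := hx.fwd hc hd
    rw [← around_succ] at hp h1
    refine ⟨VStar.mk (x.1.1 + 1) x.1.2.im hp, h1.symm, ?_⟩
    exact sec_succ (mult_pos i) _ h0 hx.1.2
  · have hp := hx.bwd hc hd
    rw [← around_pred] at hp h1
    refine ⟨VStar.mk (x.1.1 - 1) ⟨0, x.1.2.re⟩ hp, h1.symm, ?_⟩
    have := sec_succ (mult_pos i) (ζ := ⟨0, x.1.2.re⟩) (x.1.1 - 1) rfl hx.1.1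
    rw [sub_add_cancel] at this
    have e : x.1.2 = ((⟨0, x.1.2.re⟩ : ℂ).im : ℂ) := Complex.ext rfl h0
    refine this.symm.trans ?_
    rw [← e]
    rfl

/-- The values of the chart of a vertex at a point of the rectangles. -/
def chartVal (c d : ℝ) (i : D.I) (p : D.Pt) : Set ℂ :=
  {ω | ∃ x : VStar c d i, x.emb = p ∧ x.toPlane (D.mult i) = ω}

/-- As a set, the values of the chart are unchanged by a gluing, hence by the generated relation.
This avoids chains of gluings that might leave the domain of the chart. -/
theorem chartVal_glue (i : D.I) {p p' : D.Pt} (h : D.Glue p p') :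
    chartVal c d i p = chartVal c d i p' := by
  ext ω
  constructor
  · rintro ⟨x, rfl, rfl⟩
    refine VStar.step hc hd x ?_
    have hx := vstar_part x
    have hcrd := VStar.crd_emb hc hd x
    cases h with
    | horizontal h1 h2 h3 h4 => exact Part.horizontal hc h1 h2 h3 h4 hx hcrd
    | vertical h1 h2 h3 h4 => exact Part.vertical hd h1 h2 h3 h4 hx hcrd
  · rintro ⟨x, rfl, rfl⟩
    refine VStar.step hc hd x ?_
    have hx := vstar_part x
    have hcrd := VStar.crd_emb hc hd x
    cases h with
    | horizontal h1 h2 h3 h4 => exact Part.horizontal_symm hc h1 h2 h3 h4 hx hcrd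
    | vertical h1 h2 h3 h4 => exact Part.vertical_symm hd h1 h2 h3 h4 hx hcrd

variable {S : Type} [TopologicalSpace S] {q : D.Pt → S} (hS : IsSurface q)
include hS

theorem IsSurface.chartVal_eq (i : D.I) {p p' : D.Pt} (h : q p = q p') :
    chartVal c d i p = chartVal c d i p' := by
  have := (hS.ker p p').1 h
  clear h
  induction this with
  | rel _ _ h' => exact chartVal_glue hc hd i h'
  | refl _ => rfl
  | symm x y _ ih => exact ih.symm
  | trans x y z _ _ ih1 ih2 => exact ih1.trans ih2

theorem IsSurface.q_rot {κ : D.Corner} {ζ : ℂ} (h : Part c d κ ζ) (h0 : ζ.re = 0) :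
    q (pt κ.1 (loc κ ζ)) = q (pt (D.rot κ).1 (loc (D.rot κ) ζ.im)) := by
  obtain ⟨i, t⟩ := κ
  have h1 := D.w_pos i
  have h2 := D.h_pos i
  have e : ζ = ⟨0, ζ.im⟩ := Complex.ext h0 rfl
  fin_cases t
  · replace h := part_zero_iff.1 h
    have hg := hS.glue_r (D.r.symm i) h.1.2 (by rw [h_r_symm]; nlinarith)
    rw [Equiv.apply_symm_apply, ← e] at hg
    refine hg.symm.trans ?_
    change _ = q (pt (D.r.symm i) ⟨D.w (D.r.symm i) - (ζ.im : ℂ).im, (ζ.im : ℂ).re⟩)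
    simp
  · replace h := part_one_iff.1 h
    have hg := hS.glue_u (D.u.symm i) (x := D.w i - ζ.im) (by nlinarith)
      (by rw [w_r_u_symm]; nlinarith)
    rw [Equiv.apply_symm_apply] at hg
    change q (pt i ⟨D.w i - ζ.im, ζ.re⟩) = q (pt (D.u.symm i) ⟨D.w (D.u.symm i) - (ζ.im : ℂ).re,
      D.h (D.u.symm i) - (ζ.im : ℂ).im⟩)
    rw [h0, ← hg, w_r_u_symm]
    simp
  · replace h := part_two_iff.1 h
    have hg := hS.glue_r i (y := D.h i - ζ.im) (by nlinarith) (by linarith)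
    change q (pt i ⟨D.w i - ζ.re, D.h i - ζ.im⟩) = q (pt (D.r i) ⟨(ζ.im : ℂ).im,
      D.h (D.r i) - (ζ.im : ℂ).re⟩)
    rw [h0, sub_zero, hg, D.h_r]
    simp
  · replace h := part_three_iff.1 h
    have hg := hS.glue_u i h.1.2 (by nlinarith)
    change q (pt i ⟨ζ.im, D.h i - ζ.re⟩) = q (pt (D.u i) (ζ.im : ℂ))
    rw [h0, sub_zero, hg]
    rfl

theorem IsSurface.q_around_zero (i : D.I) (s : ℤ) :
    q (pt (around i s).1 (loc (around i s) 0)) = q (pt i 0) := by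
  have h0 : ∀ κ : D.Corner, Part c d κ 0 :=
    fun κ => ⟨⟨le_rfl, le_rfl⟩, cut_pos hc hd _, cut_pos hc hd _⟩
  have hr : ∀ κ : D.Corner,
      q (pt κ.1 (loc κ 0)) = q (pt (D.rot κ).1 (loc (D.rot κ) 0)) := by
    intro κ
    have := hS.q_rot hc hd (h0 κ) rfl
    simpa using this
  induction s using Int.induction_on with
  | zero => rfl
  | succ s ih => rw [around_succ, ← hr, ih]
  | pred s ih =>
    rw [hr, ← around_succ, sub_add_cancel, ih]

/-- Points identified in the surface have the same chart values; conversely, sectors meet only at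
the centre and along common rays, where the corresponding sides are glued. -/
theorem IsSurface.q_emb_eq_iff {i : D.I} (x y : VStar c d i) :
    q x.emb = q y.emb ↔ x.toPlane (D.mult i) = y.toPlane (D.mult i) := by
  constructor
  · intro h
    have h1 : x.toPlane (D.mult i) ∈ chartVal c d i x.emb := ⟨x, rfl, rfl⟩
    rw [hS.chartVal_eq hc hd i h] at h1
    obtain ⟨x', h2, h3⟩ := h1
    rw [← h3]
    exact VStar.toPlane_eq_of_emb_eq hc hd h2
  · intro h
    have hdvd : ∀ {s s' : ℤ} (ζ : ℂ), (4 * D.mult i : ℤ) ∣ s' - s →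
        pt (around i s).1 (loc (around i s) ζ) = pt (around i s').1 (loc (around i s') ζ) := by
      intro s s' ζ h
      rw [(around_eq_iff i s s').2 h]
    rcases sec_eq_cases (mult_pos i) x.2.1 y.2.1 h with h | h | h | h
    · unfold VStar.emb
      rw [h.1, h.2, hS.q_around_zero hc hd, hS.q_around_zero hc hd]
    · unfold VStar.emb
      rw [h.2, hdvd _ h.1]
    · obtain ⟨h1, h2, h3⟩ := h
      unfold VStar.emb
      rw [hS.q_rot hc hd (vstar_part x) h2, ← around_succ, h3, hdvd _ h1]
    · obtain ⟨h1, h2, h3⟩ := h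
      unfold VStar.emb
      rw [hS.q_rot hc hd (vstar_part y) h2, ← around_succ, h3, hdvd _ h1]

theorem IsSurface.exists_emb_of_q_eq {i : D.I} {x : VStar c d i} {p : D.Pt} (h : q p = q x.emb) :
    ∃ y : VStar c d i, y.emb = p ∧ q y.emb = q x.emb := by
  have h1 : x.toPlane (D.mult i) ∈ chartVal c d i x.emb := ⟨x, rfl, rfl⟩
  rw [← hS.chartVal_eq hc hd i h] at h1
  obtain ⟨y, h2, h3⟩ := h1
  exact ⟨y, h2, (hS.q_emb_eq_iff hc hd y x).2 h3⟩

theorem IsSurface.exists_chart (i : D.I) : ∃ φ : OpenPartialHomeomorph S ℂ,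
    φ.source = Set.range (fun x : VStar c d i => q x.emb) ∧
    ∀ x : VStar c d i, φ (q x.emb) = x.toPlane (D.mult i) := by
  have h0 : Part c d (around i 0) 0 := ⟨⟨le_rfl, le_rfl⟩, cut_pos hc hd _, cut_pos hc hd _⟩
  have : Nonempty (VStar c d i) := ⟨VStar.mk 0 0 h0⟩
  refine exists_openPartialHomeomorph _ _ (hS.quot.continuous.comp VStar.continuous_emb)
    (Star.continuous_toPlane (mult_pos i)) (hS.q_emb_eq_iff hc hd) ?_ ?_
  · intro V hV hsat
    rw [← hS.quot.isOpen_preimage]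
    -- For a saturated set the full preimage in the rectangles is its image under `emb`, since every
    -- point glued to a point of the chart belongs to the chart.
    have : q ⁻¹' ((fun x : VStar c d i => q x.emb) '' V) = VStar.emb '' V := by
      ext p
      constructor
      · rintro ⟨x, hx, hxp⟩
        obtain ⟨y, h1, h2⟩ := hS.exists_emb_of_q_eq hc hd hxp.symm
        exact ⟨y, hsat x y h2.symm hx, h1⟩
      · rintro ⟨x, hx, rfl⟩
        exact ⟨x, hx, rfl⟩
    rw [this]
    exact VStar.isOpenMap_emb hc hd V hV
  · intro V hV hsat
    refine Star.isOpen_toPlane_image (mult_pos i) (fun s => cut_pos hc hd _) ?_ hV ?_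
    · intro s s' h
      simp only [(around_eq_iff i s s').2 h]
    · intro x y h
      exact hsat x y ((hS.q_emb_eq_iff hc hd x y).2 h)

/-- The chart of a vertex: its power is a primitive of the one-form. -/
theorem IsSurface.exists_chart_primitive (i : D.I) : ∃ φ : OpenPartialHomeomorph S ℂ,
    φ.source = Set.range (fun x : VStar c d i => q x.emb) ∧
    (∀ y, φ y = 0 → y ∈ φ.source → y = q (pt i 0)) ∧ q (pt i 0) ∈ φ.source ∧ φ (q (pt i 0)) = 0 ∧
    ∀ p : D.Pt, q p ∈ φ.source → ∀ᶠ p' in 𝓝 p,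
      φ (q p') ^ D.mult i - crd p' = φ (q p) ^ D.mult i - crd p := by
  obtain ⟨φ, hφ, hφx⟩ := hS.exists_chart hc hd i
  have h0 : Part c d (around i 0) 0 := ⟨⟨le_rfl, le_rfl⟩, cut_pos hc hd _, cut_pos hc hd _⟩
  -- The power of the chart differs from the coordinate by the position of the corner, which is
  -- constant as long as the sector does not change.
  have hval : ∀ x : VStar c d i, φ (q x.emb) ^ D.mult i - crd x.emb = - cpos (around i x.1.1) := by
    intro x
    rw [hφx, VStar.crd_emb hc hd, loc_eq, I_pow_around]
    unfold Star.toPlane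
    rw [sec_pow (mult_pos i)]
    ring
  refine ⟨φ, hφ, ?_, ?_, ?_, ?_⟩
  · intro y hy hy'
    rw [hφ] at hy'
    obtain ⟨x, rfl⟩ := hy'
    simp only at hy ⊢
    rw [hφx] at hy
    have := sec_eq_zero (mult_pos i) hy
    unfold VStar.emb
    rw [this]
    exact hS.q_around_zero hc hd i _
  · rw [hφ]
    exact ⟨VStar.mk 0 0 h0, rfl⟩
  · have := hφx (VStar.mk 0 0 h0)
    exact this.trans (sec_zero (mult_pos i) _)
  · intro p hp
    rw [hφ] at hp
    obtain ⟨x, hx⟩ := hp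
    obtain ⟨y, hy, -⟩ := hS.exists_emb_of_q_eq hc hd hx.symm
    subst hy
    have hfst : Continuous fun z : VStar c d i => z.1.1 :=
      continuous_fst.comp continuous_subtype_val
    have h1 : ∀ᶠ z : VStar c d i in 𝓝 y, z.1.1 = y.1.1 :=
      hfst.continuousAt.eventually ((isOpen_discrete {y.1.1}).mem_nhds rfl)
    have h2 := (VStar.isOpenMap_emb hc hd).image_mem_nhds h1
    filter_upwards [h2] with p' hp'
    obtain ⟨z, hz, rfl⟩ := hp'
    have hz' : z.1.1 = y.1.1 := hz
    rw [hval, hval, hz']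

end Chart

/-- Every point belongs to a chart of a vertex. -/
theorem exists_part (p : D.Pt) : ∃ c d : ℝ, (0 < c ∧ c < 1) ∧ (0 < d ∧ d < 1) ∧
    ∃ (i : D.I) (x : VStar c d i), x.emb = p := by
  have h := mem_rect.1 (crd_mem p)
  have h1 := D.w_pos p.1
  have h2 := D.h_pos p.1
  -- The open parts leave out the cutting lines, so the ratio is `1/2` or `1/3` according to the
  -- position of the point, keeping it off the cut.
  have hc : ∃ c : ℝ, (0 < c ∧ c < 1) ∧
      ((crd p).re < c * D.w p.1 ∨ D.w p.1 - (crd p).re < (1 - c) * D.w p.1) := by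
    by_cases hlt : (crd p).re < 2⁻¹ * D.w p.1
    · exact ⟨2⁻¹, by norm_num, Or.inl hlt⟩
    · exact ⟨3⁻¹, by norm_num, Or.inr (by linarith)⟩
  have hd : ∃ d : ℝ, (0 < d ∧ d < 1) ∧
      ((crd p).im < d * D.h p.1 ∨ D.h p.1 - (crd p).im < (1 - d) * D.h p.1) := by
    by_cases hlt : (crd p).im < 2⁻¹ * D.h p.1
    · exact ⟨2⁻¹, by norm_num, Or.inl hlt⟩
    · exact ⟨3⁻¹, by norm_num, Or.inr (by linarith)⟩
  obtain ⟨c, hc, hc'⟩ := hc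
  obtain ⟨d, hd, hd'⟩ := hd
  refine ⟨c, d, hc, hd, ?_⟩
  have hmain : ∃ t : Fin 4, Part c d (p.1, t) (locInv (p.1, t) (crd p)) := by
    rcases hc' with hc' | hc' <;> rcases hd' with hd' | hd'
    · exact ⟨0, part_zero_iff.2 ⟨⟨h.1.1, h.2.1⟩, hc', hd'⟩⟩
    · exact ⟨3, part_three_iff.2 ⟨⟨sub_nonneg.2 h.2.2, h.1.1⟩, hd', hc'⟩⟩
    · exact ⟨1, part_one_iff.2 ⟨⟨h.2.1, sub_nonneg.2 h.1.2⟩, hd', hc'⟩⟩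
    · exact ⟨2, part_two_iff.2 ⟨⟨sub_nonneg.2 h.1.2, sub_nonneg.2 h.2.2⟩, hc', hd'⟩⟩
  obtain ⟨t, ht⟩ := hmain
  obtain ⟨i, s, hs⟩ := exists_around (p.1, t)
  rw [← hs] at ht
  refine ⟨i, VStar.mk s _ ht, ?_⟩
  rw [VStar.emb_eq_iff hc hd]
  refine ⟨?_, rfl⟩
  change p.1 = (around i s).1
  rw [hs]

end RectSystem

end GridSurface
end

noncomputable section

namespace GridSurface

/-! ### The cell structure -/

/-- A closed `t` pulls back under the inverse to the trace on `f '' U` of the compact image of `t ∩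
K`: by `hbd`, no point of `K` outside `U` has its image in `f '' U`. -/
theorem continuousOn_invFunOn_image {E S : Type*} [TopologicalSpace E] [T2Space E]
    [TopologicalSpace S] [T2Space S] [Nonempty E] {f : E → S} (hf : Continuous f) {U K : Set E}
    (hK : IsCompact K) (hUK : U ⊆ K) (hinj : Set.InjOn f U)
    (hbd : ∀ x ∈ K, ∀ y ∈ U, f x = f y → x ∈ U) :
    ContinuousOn (hinj.toPartialEquiv f U).symm (f '' U) := by
  rw [continuousOn_iff_isClosed]
  intro t ht
  refine ⟨f '' (t ∩ K), ((hK.inter_left ht).image hf).isClosed, ?_⟩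
  have hsymm : ∀ x ∈ U, (hinj.toPartialEquiv f U).symm (f x) = x :=
    fun x hx => (hinj.toPartialEquiv f U).left_inv hx
  ext s
  constructor
  · rintro ⟨h1, x, hx, rfl⟩
    rw [Set.mem_preimage, hsymm x hx] at h1
    exact ⟨⟨x, ⟨h1, hUK hx⟩, rfl⟩, x, hx, rfl⟩
  · rintro ⟨⟨x, ⟨hx1, hx2⟩, rfl⟩, y, hy, hxy⟩
    have hxU := hbd x hx2 y hy hxy.symm
    refine ⟨?_, x, hxU, rfl⟩
    rw [Set.mem_preimage, hsymm x hxU]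
    exact hx1

namespace RectSystem

variable {D : RectSystem}

variable (D) in
/-- The cells: the vertices, the bottom and left sides of the rectangles, and the rectangles. -/
inductive Cell : ℕ → Type
  | vert (v : D.Orb) : Cell 0
  | bottom (i : D.I) : Cell 1
  | left (i : D.I) : Cell 1
  | face (i : D.I) : Cell 2

/-- The characteristic maps of the cells to the rectangles. -/
def cellPt : (k : ℕ) → D.Cell k → (Fin k → ℝ) → D.Pt
  | _, .vert v, _ => pt (Quotient.out (s := Equiv.Perm.SameCycle.setoid D.C) v) 0
  | _, .bottom i, x => pt i ⟨D.w i * ((1 + x 0) / 2), 0⟩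
  | _, .left i, x => pt i ⟨0, D.h i * ((1 + x 0) / 2)⟩
  | _, .face i, x => pt i ⟨D.w i * ((1 + x 0) / 2), D.h i * ((1 + x 1) / 2)⟩

theorem continuous_cellPt : ∀ (k : ℕ) (c : D.Cell k), Continuous (cellPt k c)
  | _, .vert _ => continuous_const
  | _, .bottom i => (continuous_pt i).comp (continuous_mk (by fun_prop) continuous_const)
  | _, .left i => (continuous_pt i).comp (continuous_mk continuous_const (by fun_prop))
  | _, .face i => (continuous_pt i).comp (continuous_mk (by fun_prop) (by fun_prop))

/-- The norm is the maximum norm, so the balls are cubes and affine characteristic maps suffice. -/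
theorem mem_unitBall {k : ℕ} {x : Fin k → ℝ} :
    x ∈ Metric.ball (0 : Fin k → ℝ) 1 ↔ ∀ l, -1 < x l ∧ x l < 1 := by
  rw [mem_ball_zero_iff, pi_norm_lt_iff one_pos]
  simp only [Real.norm_eq_abs, abs_lt]

theorem mul_half_mem {a x : ℝ} (ha : 0 < a) (hx : -1 < x ∧ x < 1) :
    0 < a * ((1 + x) / 2) ∧ a * ((1 + x) / 2) < a :=
  ⟨mul_pos ha (by linarith), by nlinarith⟩

theorem nf_cell_zero (v : D.Orb) (x : Fin 0 → ℝ) : nf (cellPt 0 (.vert v) x) = Sum.inl v := by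
  refine (nf_pt_zero _).trans (congrArg Sum.inl ?_)
  exact Quotient.out_eq (s := Equiv.Perm.SameCycle.setoid D.C) v

theorem nf_cell_bottom (i : D.I) {x : Fin 1 → ℝ} (hx : x ∈ Metric.ball (0 : Fin 1 → ℝ) 1) :
    nf (cellPt 1 (.bottom i) x) = Sum.inr (i, ⟨D.w i * ((1 + x 0) / 2), 0⟩) := by
  have h := mul_half_mem (D.w_pos i) (mem_unitBall.1 hx 0)
  refine nf_pt h.1.le h.2 le_rfl (D.h_pos i) fun h0 => ?_
  exact h.1.ne' (congrArg Complex.re h0)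

theorem nf_cell_left (i : D.I) {x : Fin 1 → ℝ} (hx : x ∈ Metric.ball (0 : Fin 1 → ℝ) 1) :
    nf (cellPt 1 (.left i) x) = Sum.inr (i, ⟨0, D.h i * ((1 + x 0) / 2)⟩) := by
  have h := mul_half_mem (D.h_pos i) (mem_unitBall.1 hx 0)
  refine nf_pt le_rfl (D.w_pos i) h.1.le h.2 fun h0 => ?_
  exact h.1.ne' (congrArg Complex.im h0)

theorem nf_cell_two (i : D.I) {x : Fin 2 → ℝ} (hx : x ∈ Metric.ball (0 : Fin 2 → ℝ) 1) :
    nf (cellPt 2 (.face i) x) =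
      Sum.inr (i, ⟨D.w i * ((1 + x 0) / 2), D.h i * ((1 + x 1) / 2)⟩) := by
  have h := mul_half_mem (D.w_pos i) (mem_unitBall.1 hx 0)
  have h' := mul_half_mem (D.h_pos i) (mem_unitBall.1 hx 1)
  refine nf_pt h.1.le h.2 h'.1.le h'.2 fun h0 => ?_
  exact h.1.ne' (congrArg Complex.re h0)

theorem half_inj {a x y : ℝ} (ha : 0 < a) (h : a * ((1 + x) / 2) = a * ((1 + y) / 2)) : x = y := by
  have := mul_left_cancel₀ ha.ne' h
  linarith

/-- The open cells are disjoint, and their characteristic maps are injective. -/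
theorem cell_inj : ∀ {k l : ℕ} {c : D.Cell k} {c' : D.Cell l} {x : Fin k → ℝ} {y : Fin l → ℝ},
    x ∈ Metric.ball (0 : Fin k → ℝ) 1 → y ∈ Metric.ball (0 : Fin l → ℝ) 1 →
    nf (cellPt k c x) = nf (cellPt l c' y) →
    (⟨k, c, x⟩ : Σ k, D.Cell k × (Fin k → ℝ)) = ⟨l, c', y⟩ := by
  intro k l c c' x y hx hy h
  have hpos : ∀ {i : D.I} {k : ℕ} {x : Fin k → ℝ} (_ : x ∈ Metric.ball (0 : Fin k → ℝ) 1) (t : Fin k),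
      D.w i * ((1 + x t) / 2) ≠ 0 ∧ D.h i * ((1 + x t) / 2) ≠ 0 := fun hx t =>
    ⟨(mul_half_mem (D.w_pos _) (mem_unitBall.1 hx t)).1.ne',
      (mul_half_mem (D.h_pos _) (mem_unitBall.1 hx t)).1.ne'⟩
  match k, c, l, c', x, y, hx, hy, h with
  | _, .vert v, _, .vert v', x, y, hx, hy, h =>
    rw [nf_cell_zero, nf_cell_zero] at h
    rw [Sum.inl.inj h, Subsingleton.elim x y]
  | _, .vert v, _, .bottom i, x, y, hx, hy, h => rw [nf_cell_zero, nf_cell_bottom i hy] at h; cases h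
  | _, .vert v, _, .left i, x, y, hx, hy, h => rw [nf_cell_zero, nf_cell_left i hy] at h; cases h
  | _, .vert v, _, .face i, x, y, hx, hy, h => rw [nf_cell_zero, nf_cell_two i hy] at h; cases h
  | _, .bottom i, _, .vert v, x, y, hx, hy, h => rw [nf_cell_zero, nf_cell_bottom i hx] at h; cases h
  | _, .left i, _, .vert v, x, y, hx, hy, h => rw [nf_cell_zero, nf_cell_left i hx] at h; cases h
  | _, .face i, _, .vert v, x, y, hx, hy, h => rw [nf_cell_zero, nf_cell_two i hx] at h; cases h
  | _, .bottom i, _, .bottom j, x, y, hx, hy, h =>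
    rw [nf_cell_bottom i hx, nf_cell_bottom j hy] at h
    obtain ⟨h1, h2⟩ := Prod.mk.inj (Sum.inr.inj h)
    subst h1
    have h3 := half_inj (D.w_pos i) (congrArg Complex.re h2)
    have : x = y := by
      funext t
      rw [Subsingleton.elim t 0, h3]
    rw [this]
  | _, .bottom i, _, .left j, x, y, hx, hy, h =>
    rw [nf_cell_bottom i hx, nf_cell_left j hy] at h
    obtain ⟨h1, h2⟩ := Prod.mk.inj (Sum.inr.inj h)
    exact ((hpos hx 0).1 (congrArg Complex.re h2)).elim
  | _, .left i, _, .bottom j, x, y, hx, hy, h =>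
    rw [nf_cell_left i hx, nf_cell_bottom j hy] at h
    obtain ⟨h1, h2⟩ := Prod.mk.inj (Sum.inr.inj h)
    exact ((hpos hx 0).2 (congrArg Complex.im h2)).elim
  | _, .left i, _, .left j, x, y, hx, hy, h =>
    rw [nf_cell_left i hx, nf_cell_left j hy] at h
    obtain ⟨h1, h2⟩ := Prod.mk.inj (Sum.inr.inj h)
    subst h1
    have h3 := half_inj (D.h_pos i) (congrArg Complex.im h2)
    have : x = y := by
      funext t
      rw [Subsingleton.elim t 0, h3]
    rw [this]
  | _, .bottom i, _, .face j, x, y, hx, hy, h =>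
    rw [nf_cell_bottom i hx, nf_cell_two j hy] at h
    obtain ⟨h1, h2⟩ := Prod.mk.inj (Sum.inr.inj h)
    exact ((hpos hy 1).2 (congrArg Complex.im h2).symm).elim
  | _, .left i, _, .face j, x, y, hx, hy, h =>
    rw [nf_cell_left i hx, nf_cell_two j hy] at h
    obtain ⟨h1, h2⟩ := Prod.mk.inj (Sum.inr.inj h)
    exact ((hpos hy 0).1 (congrArg Complex.re h2).symm).elim
  | _, .face j, _, .bottom i, x, y, hx, hy, h =>
    rw [nf_cell_bottom i hy, nf_cell_two j hx] at h
    obtain ⟨h1, h2⟩ := Prod.mk.inj (Sum.inr.inj h)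
    exact ((hpos hx 1).2 (congrArg Complex.im h2)).elim
  | _, .face j, _, .left i, x, y, hx, hy, h =>
    rw [nf_cell_left i hy, nf_cell_two j hx] at h
    obtain ⟨h1, h2⟩ := Prod.mk.inj (Sum.inr.inj h)
    exact ((hpos hx 0).1 (congrArg Complex.re h2)).elim
  | _, .face i, _, .face j, x, y, hx, hy, h =>
    rw [nf_cell_two i hx, nf_cell_two j hy] at h
    obtain ⟨h1, h2⟩ := Prod.mk.inj (Sum.inr.inj h)
    subst h1
    have h3 := half_inj (D.w_pos i) (congrArg Complex.re h2)
    have h4 := half_inj (D.h_pos i) (congrArg Complex.im h2)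
    have : x = y := by
      funext t
      fin_cases t
      · exact h3
      · exact h4
    rw [this]

theorem half_param {a x : ℝ} (hx : 0 < x) (hx' : x < a) :
    (-1 < 2 * x / a - 1 ∧ 2 * x / a - 1 < 1) ∧ a * ((1 + (2 * x / a - 1)) / 2) = x := by
  have ha : 0 < a := hx.trans hx'
  refine ⟨⟨?_, ?_⟩, ?_⟩
  · have : 0 < 2 * x / a := by positivity
    linarith
  · have : 2 * x / a < 2 := by rw [div_lt_iff₀ ha]; linarith
    linarith
  · field_simp
    ring

section Surface

variable {S : Type} [TopologicalSpace S] {q : D.Pt → S} (hS : IsSurface q)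
include hS

/-- The last two clauses bound the dimension of the open cell by the vanishing coordinates of the
normal form, as needed for boundaries of cells. -/
theorem IsSurface.exists_cell (p : D.Pt) : ∃ (k : ℕ) (c : D.Cell k) (x : Fin k → ℝ),
    x ∈ Metric.ball (0 : Fin k → ℝ) 1 ∧ q p = q (cellPt k c x) ∧
    ((nfZ p).re = 0 ∨ (nfZ p).im = 0 → k < 2) ∧ (nfZ p = 0 → k < 1) := by
  have hb := nfZ_bounds p
  have hq := hS.q_nf p
  rcases hb.1.1.eq_or_lt with hx | hx <;> rcases hb.2.1.eq_or_lt with hy | hy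
  · have h0 : nfZ p = 0 := Complex.ext hx.symm hy.symm
    refine ⟨0, .vert (D.orb (nfI p)), 0, mem_unitBall.2 fun l => l.elim0, ?_, fun _ => by norm_num,
      fun _ => by norm_num⟩
    rw [hq, h0, hS.q_eq_iff, nf_pt_zero, nf_cell_zero]
  · have hpar := half_param hy hb.2.2
    refine ⟨1, .left (nfI p), fun _ => 2 * (nfZ p).im / D.h (nfI p) - 1,
      mem_unitBall.2 fun _ => hpar.1, ?_, fun _ => by norm_num, fun h => ?_⟩
    · rw [hq]
      change _ = q (pt _ ⟨0, _⟩)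
      rw [hpar.2]
      congr 2
      exact Complex.ext hx.symm rfl
    · rw [h] at hy
      exact absurd hy (lt_irrefl 0)
  · have hpar := half_param hx hb.1.2
    refine ⟨1, .bottom (nfI p), fun _ => 2 * (nfZ p).re / D.w (nfI p) - 1,
      mem_unitBall.2 fun _ => hpar.1, ?_, fun _ => by norm_num, fun h => ?_⟩
    · rw [hq]
      change _ = q (pt _ ⟨_, 0⟩)
      rw [hpar.2]
      congr 2
      exact Complex.ext rfl hy.symm
    · rw [h] at hx
      exact absurd hx (lt_irrefl 0)
  · have hpar := half_param hx hb.1.2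
    have hpar' := half_param hy hb.2.2
    refine ⟨2, .face (nfI p), ![2 * (nfZ p).re / D.w (nfI p) - 1, 2 * (nfZ p).im / D.h (nfI p) - 1],
      mem_unitBall.2 fun l => ?_, ?_, fun h => ?_, fun h => ?_⟩
    · fin_cases l
      · exact hpar.1
      · exact hpar'.1
    · rw [hq]
      change _ = q (pt _ ⟨D.w (nfI p) * ((1 + (2 * (nfZ p).re / D.w (nfI p) - 1)) / 2),
        D.h (nfI p) * ((1 + (2 * (nfZ p).im / D.h (nfI p) - 1)) / 2)⟩)
      rw [hpar.2, hpar'.2]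
    · rcases h with h | h
      · exact absurd h hx.ne'
      · exact absurd h hy.ne'
    · rw [h] at hx
      exact absurd hx (lt_irrefl 0)

omit hS in
theorem nfZ_side {i : D.I} {x y : ℝ} (hx : 0 ≤ x ∧ x ≤ D.w i) (hy : 0 ≤ y ∧ y ≤ D.h i) :
    (x = 0 ∨ x = D.w i → (nfZ (pt i ⟨x, y⟩)).re = 0) ∧
    (y = 0 ∨ y = D.h i → (nfZ (pt i ⟨x, y⟩)).im = 0) := by
  have h : crd (pt i ⟨x, y⟩) = ⟨x, y⟩ := crd_pt ⟨hx, hy⟩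
  unfold nfZ
  rw [h]
  constructor <;> intro h' <;> rcases h' with h' | h' <;> simp [h']

omit hS in
theorem half_side {a x : ℝ} (hx : x = -1 ∨ x = 1) :
    a * ((1 + x) / 2) = 0 ∨ a * ((1 + x) / 2) = a := by
  rcases hx with rfl | rfl
  · left; ring
  · right; ring

omit hS in
theorem half_mem_closed {a x : ℝ} (ha : 0 < a) (hx : |x| ≤ 1) :
    0 ≤ a * ((1 + x) / 2) ∧ a * ((1 + x) / 2) ≤ a := by
  rw [abs_le] at hx
  constructor <;> nlinarith

/-- A boundary point of the cube has a coordinate `±1`; the matching coordinate of the normal form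
vanishes, so the point lies in an open cell of smaller dimension. -/
theorem IsSurface.cell_boundary : ∀ (k : ℕ) (c : D.Cell k) (x : Fin k → ℝ),
    x ∈ Metric.sphere (0 : Fin k → ℝ) 1 → ∃ (l : ℕ) (c' : D.Cell l) (y : Fin l → ℝ), l < k ∧
    y ∈ Metric.ball (0 : Fin l → ℝ) 1 ∧ q (cellPt k c x) = q (cellPt l c' y) := by
  intro k c x hx
  have hle : ∀ t, |x t| ≤ 1 := fun t => by
    rw [← mem_sphere_zero_iff_norm.1 hx]
    exact norm_le_pi_norm x t
  have hex : ∃ t, x t = -1 ∨ x t = 1 := by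
    by_contra hcon
    push Not at hcon
    have : x ∈ Metric.ball (0 : Fin k → ℝ) 1 := by
      rw [mem_unitBall]
      intro l
      have := abs_le.1 (hle l)
      exact ⟨lt_of_le_of_ne this.1 (hcon l).1.symm, lt_of_le_of_ne this.2 (hcon l).2⟩
    rw [mem_ball_zero_iff, mem_sphere_zero_iff_norm.1 hx] at this
    exact lt_irrefl _ this
  obtain ⟨t, ht⟩ := hex
  obtain ⟨l, c', y, h1, h2, h3, h4⟩ := hS.exists_cell (cellPt k c x)
  refine ⟨l, c', y, ?_, h1, h2⟩
  match k, c, x, t, ht, hle, h3, h4 with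
  | _, .vert _, x, t, ht, hle, h3, h4 => exact t.elim0
  | _, .bottom i, x, t, ht, hle, h3, h4 =>
    rw [Subsingleton.elim t 0] at ht
    have := nfZ_side (i := i) (half_mem_closed (D.w_pos i) (hle 0)) ⟨le_rfl, (D.h_pos i).le⟩
    exact h4 (Complex.ext (this.1 (half_side ht)) (this.2 (Or.inl rfl)))
  | _, .left i, x, t, ht, hle, h3, h4 =>
    rw [Subsingleton.elim t 0] at ht
    have := nfZ_side (i := i) ⟨le_rfl, (D.w_pos i).le⟩ (half_mem_closed (D.h_pos i) (hle 0))
    exact h4 (Complex.ext (this.1 (Or.inl rfl)) (this.2 (half_side ht)))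
  | _, .face i, x, t, ht, hle, h3, h4 =>
    have := nfZ_side (i := i) (half_mem_closed (D.w_pos i) (hle 0))
      (half_mem_closed (D.h_pos i) (hle 1))
    apply h3
    fin_cases t
    · exact Or.inl (this.1 (half_side ht))
    · exact Or.inr (this.2 (half_side ht))

theorem IsSurface.cell_injOn (k : ℕ) (c : D.Cell k) :
    Set.InjOn (fun x => q (cellPt k c x)) (Metric.ball (0 : Fin k → ℝ) 1) := by
  intro x hx y hy h
  have := cell_inj hx hy (hS.nf_eq h)
  simpa using this

theorem IsSurface.cell_eq {k l : ℕ} {c : D.Cell k} {c' : D.Cell l} {x : Fin k → ℝ} {y : Fin l → ℝ}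
    (hx : x ∈ Metric.ball (0 : Fin k → ℝ) 1) (hy : y ∈ Metric.ball (0 : Fin l → ℝ) 1)
    (h : q (cellPt k c x) = q (cellPt l c' y)) : (⟨k, c⟩ : Σ k, D.Cell k) = ⟨l, c'⟩ := by
  have := cell_inj hx hy (hS.nf_eq h)
  exact congrArg (fun s : Σ k, D.Cell k × (Fin k → ℝ) => (⟨s.1, s.2.1⟩ : Σ k, D.Cell k)) this

omit hS in
variable (D) in
/-- The zero-dimensional cells are the vertices. -/
def cellZero : D.Cell 0 ≃ D.Orb where
  toFun | .vert v => v
  invFun := .vert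
  left_inv | .vert _ => rfl
  right_inv _ := rfl

omit hS in
variable (D) in
/-- The one-dimensional cells are the bottom and left sides. -/
def cellOne : D.Cell 1 ≃ D.I ⊕ D.I where
  toFun | .bottom i => .inl i | .left i => .inr i
  invFun | .inl i => .bottom i | .inr i => .left i
  left_inv | .bottom _ => rfl | .left _ => rfl
  right_inv | .inl _ => rfl | .inr _ => rfl

omit hS in
variable (D) in
/-- The two-dimensional cells are the rectangles. -/
def cellTwo : D.Cell 2 ≃ D.I where
  toFun | .face i => i
  invFun := .face
  left_inv | .face _ => rfl
  right_inv _ := rfl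

omit hS in
theorem isEmpty_cell (k : ℕ) (hk : 2 < k) : IsEmpty (D.Cell k) :=
  ⟨fun c => by cases c <;> omega⟩

omit hS in
theorem finite_cell (k : ℕ) : Finite (D.Cell k) := by
  rcases lt_or_ge 2 k with hk | hk
  · have := isEmpty_cell (D := D) k hk
    infer_instance
  · interval_cases k
    · exact Finite.of_equiv _ D.cellZero.symm
    · exact Finite.of_equiv _ D.cellOne.symm
    · exact Finite.of_equiv _ D.cellTwo.symm

theorem IsSurface.hasEulerChar : HasEulerChar S ((Nat.card D.Orb : ℤ) - Nat.card D.I) := by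
  have := hS.t2Space
  have := hS.compactSpace
  -- A boundary point lies in an open cell of smaller dimension, and open cells are disjoint.
  have hbd : ∀ (k : ℕ) (c : D.Cell k), ∀ x ∈ Metric.closedBall (0 : Fin k → ℝ) 1,
      ∀ y ∈ Metric.ball (0 : Fin k → ℝ) 1, q (cellPt k c x) = q (cellPt k c y) →
      x ∈ Metric.ball (0 : Fin k → ℝ) 1 := by
    intro k c x hx y hy h
    by_contra hx'
    have hxs : x ∈ Metric.sphere (0 : Fin k → ℝ) 1 := by
      rw [Metric.mem_closedBall] at hx
      rw [Metric.mem_ball, not_lt] at hx'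
      exact le_antisymm hx hx'
    obtain ⟨l, c', z, hl, hz, hz'⟩ := hS.cell_boundary k c x hxs
    have := congrArg Sigma.fst (hS.cell_eq hy hz (h.symm.trans hz'))
    exact hl.ne' this
  let C : Topology.CWComplex (Set.univ : Set S) := Topology.CWComplex.mkFinite Set.univ D.Cell
    (fun k c => (hS.cell_injOn k c).toPartialEquiv _ _)
    (Filter.eventually_atTop.2 ⟨3, fun k hk => isEmpty_cell k hk⟩)
    finite_cell
    (fun k c => rfl)
    (fun k c => (hS.quot.continuous.comp (continuous_cellPt k c)).continuousOn)
    (fun k c => continuousOn_invFunOn_image (hS.quot.continuous.comp (continuous_cellPt k c))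
      (isCompact_closedBall _ _) Metric.ball_subset_closedBall (hS.cell_injOn k c) (hbd k c))
    (by
      rintro ⟨k, c⟩ - ⟨l, c'⟩ - hne
      rw [Function.onFun, Set.disjoint_left]
      rintro _ ⟨x, hx, rfl⟩ ⟨y, hy, hxy⟩
      exact hne (hS.cell_eq hx hy hxy.symm))
    (by
      intro k c x hx
      obtain ⟨l, c', y, hl, hy, h⟩ := hS.cell_boundary k c x hx
      exact Set.mem_iUnion₂.2 ⟨l, hl, Set.mem_iUnion.2
        ⟨c', y, Metric.ball_subset_closedBall hy, h.symm⟩⟩)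
    (by
      refine Set.eq_univ_of_forall fun s => ?_
      obtain ⟨p, rfl⟩ := hS.quot.surjective s
      obtain ⟨k, c, x, hx, h, -⟩ := hS.exists_cell p
      exact Set.mem_iUnion₂.2 ⟨k, c, x, Metric.ball_subset_closedBall hx, h.symm⟩)
  refine ⟨C, finite_cell, isEmpty_cell, ?_⟩
  change (Nat.card (D.Cell 0) : ℤ) - Nat.card (D.Cell 1) + Nat.card (D.Cell 2) = _
  rw [Nat.card_congr D.cellZero, Nat.card_congr D.cellOne, Nat.card_congr D.cellTwo, Nat.card_sum]
  push_cast
  ring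

end Surface

end RectSystem

end GridSurface
end

noncomputable section

namespace GridSurface

namespace RectSystem

variable {D : RectSystem}

/-! ### Tori -/

/-- The rectangles, placed at `(x₀ i, y₀ i)`, tile a fundamental domain, and the gluings hold modulo
the periods. The resulting continuous bijection from a compact space to a Hausdorff one is a
homeomorphism. -/
theorem IsSurface.isTorus {S : Type} [TopologicalSpace S] {q : D.Pt → S} (hS : IsSurface q)
    {W H : ℝ} (hW : 0 < W) (hH : 0 < H) (x₀ y₀ : D.I → ℝ)
    (hxr : ∀ i, ∃ k : ℤ, x₀ (D.r i) = x₀ i + D.w i + k * W) (hyr : ∀ i, y₀ (D.r i) = y₀ i)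
    (hyu : ∀ i, ∃ k : ℤ, y₀ (D.u i) = y₀ i + D.h i + k * H) (hxu : ∀ i, x₀ (D.u i) = x₀ i)
    (hx0 : ∀ i, 0 ≤ x₀ i ∧ x₀ i + D.w i ≤ W) (hy0 : ∀ i, 0 ≤ y₀ i ∧ y₀ i + D.h i ≤ H)
    (hcover : ∀ x y, 0 ≤ x → x < W → 0 ≤ y → y < H → ∃ i, (x₀ i ≤ x ∧ x < x₀ i + D.w i) ∧
      (y₀ i ≤ y ∧ y < y₀ i + D.h i))
    (hinj : ∀ i j x y, (x₀ i ≤ x ∧ x < x₀ i + D.w i) ∧ (y₀ i ≤ y ∧ y < y₀ i + D.h i) →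
      (x₀ j ≤ x ∧ x < x₀ j + D.w j) ∧ (y₀ j ≤ y ∧ y < y₀ j + D.h j) → i = j) : IsTorus S := by
  have : Fact (0 < W) := ⟨hW⟩
  have : Fact (0 < H) := ⟨hH⟩
  have := hS.compactSpace
  let f : D.Pt → AddCircle W × AddCircle H := fun p =>
    (((x₀ p.1 + (crd p).re : ℝ) : AddCircle W), ((y₀ p.1 + (crd p).im : ℝ) : AddCircle H))
  have hf : Continuous f := by
    refine continuous_sigma fun i => ?_
    refine Continuous.prodMk ?_ ?_
    · have h : Continuous fun a : D.rect i => x₀ i + (a : ℂ).re := by fun_prop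
      exact (AddCircle.continuous_mk' W).comp h
    · have h : Continuous fun a : D.rect i => y₀ i + (a : ℂ).im := by fun_prop
      exact (AddCircle.continuous_mk' H).comp h
  have hcoe : ∀ (T x : ℝ) (k : ℤ), ((x + k * T : ℝ) : AddCircle T) = (x : AddCircle T) := by
    intro T x k
    rw [AddCircle.coe_add, ← zsmul_eq_mul, AddCircle.coe_zsmul, AddCircle.coe_period, smul_zero,
      add_zero]
  have hglue : ∀ p p', D.Glue p p' → f p = f p' := by
    intro p p' h
    cases h with
    | horizontal h1 h2 h3 h4 =>
      obtain ⟨k, hk⟩ := hxr p.1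
      refine Prod.ext ?_ ?_
      · simp only [f]
        rw [h1, h2, h3, hk, add_zero, hcoe]
      · simp only [f]
        rw [h1, h4, hyr]
    | vertical h1 h2 h3 h4 =>
      obtain ⟨k, hk⟩ := hyu p.1
      refine Prod.ext ?_ ?_
      · simp only [f]
        rw [h1, h4, hxu]
      · simp only [f]
        rw [h1, h2, h3, hk, add_zero, hcoe]
  have hker : ∀ p p', q p = q p' → f p = f p' := by
    intro p p' h
    have := (hS.ker p p').1 h
    clear h
    induction this with
    | rel _ _ h' => exact hglue _ _ h'
    | refl _ => rfl
    | symm x y _ ih => exact ih.symm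
    | trans x y z _ _ ih1 ih2 => exact ih1.trans ih2
  let F : S → AddCircle W × AddCircle H := fun s => f (Function.surjInv hS.quot.surjective s)
  have hFq : ∀ p, F (q p) = f p := fun p =>
    hker _ _ (Function.surjInv_eq hS.quot.surjective (q p))
  have hFc : Continuous F := by
    rw [hS.quot.continuous_iff]
    exact hf.congr fun p => (hFq p).symm
  have hnf : ∀ p : D.Pt, F (q p) = (((x₀ (nfI p) + (nfZ p).re : ℝ) : AddCircle W),
      ((y₀ (nfI p) + (nfZ p).im : ℝ) : AddCircle H)) := by
    intro p
    have hb := nfZ_bounds p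
    rw [hS.q_nf p, hFq]
    simp only [f, pt_fst]
    rw [crd_pt ⟨⟨hb.1.1, hb.1.2.le⟩, ⟨hb.2.1, hb.2.2.le⟩⟩]
  have hbij : Function.Bijective F := by
    constructor
    · intro s s' h
      obtain ⟨p, rfl⟩ := hS.quot.surjective s
      obtain ⟨p', rfl⟩ := hS.quot.surjective s'
      rw [hnf, hnf, Prod.mk.injEq] at h
      have hb := nfZ_bounds p
      have hb' := nfZ_bounds p'
      have bx := hx0 (nfI p)
      have bx' := hx0 (nfI p')
      have by_ := hy0 (nfI p)
      have by' := hy0 (nfI p')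
      have e1 := (AddCircle.coe_eq_coe_iff_of_mem_Ico (a := 0)
        (x := x₀ (nfI p) + (nfZ p).re) (y := x₀ (nfI p') + (nfZ p').re)
        ⟨by linarith, by linarith⟩ ⟨by linarith, by linarith⟩).1 h.1
      have e2 := (AddCircle.coe_eq_coe_iff_of_mem_Ico (a := 0)
        (x := y₀ (nfI p) + (nfZ p).im) (y := y₀ (nfI p') + (nfZ p').im)
        ⟨by linarith, by linarith⟩ ⟨by linarith, by linarith⟩).1 h.2
      have hI : nfI p = nfI p' := hinj _ _ (x₀ (nfI p) + (nfZ p).re) (y₀ (nfI p) + (nfZ p).im)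
        ⟨⟨by linarith, by linarith⟩, ⟨by linarith, by linarith⟩⟩
        ⟨⟨by linarith, by linarith⟩, ⟨by linarith, by linarith⟩⟩
      rw [hI] at e1 e2
      rw [hS.q_nf p, hS.q_nf p', hI]
      congr 2
      exact Complex.ext (by linarith) (by linarith)
    · rintro ⟨a, b⟩
      obtain ⟨x, hx, rfl⟩ : ∃ x ∈ Set.Ico (0 : ℝ) (0 + W), (x : AddCircle W) = a :=
        ⟨_, (AddCircle.equivIco W 0 a).2, (AddCircle.equivIco W 0).symm_apply_apply a⟩
      obtain ⟨y, hy, rfl⟩ : ∃ y ∈ Set.Ico (0 : ℝ) (0 + H), (y : AddCircle H) = b :=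
        ⟨_, (AddCircle.equivIco H 0 b).2, (AddCircle.equivIco H 0).symm_apply_apply b⟩
      rw [zero_add] at hx hy
      obtain ⟨i, h1, h2⟩ := hcover x y hx.1 hx.2 hy.1 hy.2
      refine ⟨q (pt i ⟨x - x₀ i, y - y₀ i⟩), ?_⟩
      rw [hFq]
      simp only [f, pt_fst]
      rw [crd_pt ⟨⟨by simp only; linarith, by simp only; linarith⟩,
        ⟨by simp only; linarith, by simp only; linarith⟩⟩]
      simp
  have e : S ≃ₜ AddCircle W × AddCircle H :=
    Continuous.homeoOfEquivCompactToT2 (f := Equiv.ofBijective F hbij) hFc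
  exact ⟨e.trans ((AddCircle.homeomorphAddCircle W 1 hW.ne' one_ne_zero).prodCongr
    (AddCircle.homeomorphAddCircle H 1 hH.ne' one_ne_zero))⟩

/-! ### Counting vertices -/

theorem mult_eq_of_orb_eq {i j : D.I} (h : D.orb i = D.orb j) : D.mult i = D.mult j := by
  have key : ∀ k : ℤ, (D.C ^ k) i = i ↔ (D.C ^ k) j = j := by
    obtain ⟨l, rfl⟩ := orb_eq.1 h
    intro k
    rw [← Equiv.Perm.mul_apply, ← zpow_add, add_comm, zpow_add, Equiv.Perm.mul_apply,
      EmbeddingLike.apply_eq_iff_eq]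
  simp only [zpow_C_eq_iff] at key
  exact Nat.dvd_antisymm (by exact_mod_cast (key _).2 dvd_rfl) (by exact_mod_cast (key _).1 dvd_rfl)

theorem ncard_orb (i : D.I) : {j | D.orb j = D.orb i}.ncard = D.mult i := by
  have h : {j | D.orb j = D.orb i} = MulAction.orbit (Subgroup.zpowers D.C) i := by
    ext j
    rw [Set.mem_ofPred_eq, eq_comm, orb_eq]
    constructor
    · rintro ⟨k, hk⟩
      exact ⟨⟨D.C ^ k, k, rfl⟩, hk⟩
    · rintro ⟨⟨_, k, rfl⟩, hk⟩
      exact ⟨k, hk⟩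
  have : Fintype (MulAction.orbit (Subgroup.zpowers D.C) i) := Fintype.ofFinite _
  rw [h, ← Nat.card_coe_set_eq, Nat.card_eq_fintype_card, ← MulAction.minimalPeriod_eq_card]
  rfl

/-- A vertex of multiplicity `k` is the lower left corner of exactly `k` rectangles. -/
theorem ncard_mult_eq (k : ℕ) :
    {i | D.mult i = k}.ncard = (D.orb '' {i | D.mult i = k}).ncard * k := by
  classical
  have : Fintype D.I := Fintype.ofFinite _
  have : Fintype D.Orb := Fintype.ofFinite _
  have h1 : {i | D.mult i = k} =
      ((Finset.univ.filter fun i => D.mult i = k : Finset D.I) : Set D.I) := by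
    ext; simp
  rw [h1, Set.ncard_coe_finset, ← Finset.coe_image, Set.ncard_coe_finset,
    Finset.card_eq_sum_card_image D.orb]
  refine Finset.sum_const_nat fun v hv => ?_
  obtain ⟨i, hi, rfl⟩ := Finset.mem_image.1 hv
  have hi' : D.mult i = k := (Finset.mem_filter.1 hi).2
  rw [← Set.ncard_coe_finset]
  refine Eq.trans (congrArg Set.ncard ?_) ((ncard_orb i).trans hi')
  ext j
  simp only [Finset.coe_filter, Finset.mem_filter, Finset.mem_univ, true_and, Set.mem_ofPred_eq]
  constructor
  · exact fun h => h.2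
  · exact fun h => ⟨(mult_eq_of_orb_eq h).trans hi', h⟩

/-- The number of vertices, if the vertices that meet `M` have the multiplicity `N` and the other
ones the multiplicity one. -/
theorem card_orb_sub {M : Set D.I} {N : ℕ} (hM : ∀ i ∈ M, D.mult i = N)
    (hM' : ∀ i, i ∉ M → D.mult i = 1) {Z : ℕ} (hZ : M.ncard = Z * N) (hN : 0 < N) :
    (Nat.card D.Orb : ℤ) - Nat.card D.I = Z - M.ncard := by
  have hone := ncard_mult_eq (D := D) 1
  rcases Nat.lt_or_ge 1 N with h1 | h1
  · have e1 : {i | D.mult i = 1} = Mᶜ := by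
      ext i
      by_cases hi : i ∈ M
      · simp [hi, hM i hi, h1.ne']
      · simp [hi, hM' i hi]
    have e2 : {i | D.mult i = N} = M := by
      ext i
      by_cases hi : i ∈ M
      · simp [hi, hM i hi]
      · simp [hi, hM' i hi, h1.ne]
    have hN' := ncard_mult_eq (D := D) N
    rw [e2, hZ] at hN'
    have hZ' : Z = (D.orb '' M).ncard := Nat.eq_of_mul_eq_mul_right hN hN'
    have hO : (D.orb '' M) ∪ (D.orb '' Mᶜ) = Set.univ := by
      rw [← Set.image_union, Set.union_compl_self, Set.image_univ]
      exact Set.range_eq_univ.2 Quotient.mk_surjective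
    have hdisj : Disjoint (D.orb '' M) (D.orb '' Mᶜ) := by
      rw [Set.disjoint_left]
      rintro _ ⟨i, hi, rfl⟩ ⟨j, hj, hij⟩
      have := mult_eq_of_orb_eq hij
      rw [hM i hi, hM' j hj] at this
      omega
    have c1 : Nat.card D.Orb = (D.orb '' M).ncard + (D.orb '' Mᶜ).ncard := by
      rw [← Set.ncard_univ, ← hO, Set.ncard_union_eq hdisj (Set.toFinite _) (Set.toFinite _)]
    have c2 := Set.ncard_add_ncard_compl M (Set.toFinite _) (Set.toFinite _)
    rw [e1] at hone
    rw [c1, ← c2, ← hZ']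
    push_cast
    omega
  -- Here the multiplicity does not separate `M` from its complement, but then every rectangle has
  -- its own vertex.
  · have hN1 : N = 1 := by omega
    subst hN1
    have e1 : {i | D.mult i = 1} = Set.univ := by
      ext i
      by_cases hi : i ∈ M
      · simp [hM i hi]
      · simp [hM' i hi]
    have hO : (D.orb '' Set.univ) = Set.univ := by
      rw [Set.image_univ]
      exact Set.range_eq_univ.2 Quotient.mk_surjective
    rw [e1, hO, Set.ncard_univ, Set.ncard_univ] at hone
    rw [hZ, hone]
    push_cast
    ring

end RectSystem

end GridSurface
end

noncomputable section

namespace GridSurface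

variable {m n : ℕ}

/-! ### The rectangles of the quotient surface -/

theorem flipV_flipV (v : ℤ × ℤ) : flipV m n (flipV m n v) = v := by
  unfold flipV
  ext <;> simp

theorem iota_iota (hm : Even m) (hn : Even n) (e : Edge m n) : iota hm hn (iota hm hn e) = e :=
  Edge.ext (flipV_flipV _) (flipV_flipV _)

theorem weight_pos {v : ℤ × ℤ} (h : InGrid m n v) : 0 < weight m n v := by
  obtain ⟨h1, h2, h3, h4⟩ := h
  have key : ∀ (k : ℕ) (i : ℤ), 0 < i → i < k → 0 < Real.sin (i * Real.pi / k) := by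
    intro k i hi hik
    have hi' : (0 : ℝ) < i := by exact_mod_cast hi
    have hik' : (i : ℝ) < k := by exact_mod_cast hik
    have hk : (0 : ℝ) < k := hi'.trans hik'
    refine Real.sin_pos_of_pos_of_lt_pi (by positivity) ?_
    rw [div_lt_iff₀ hk, mul_comm]
    exact mul_lt_mul_of_pos_left hik' Real.pi_pos
  exact mul_pos (key m v.1 h1 h2) (key n v.2 h3 h4)

instance : Finite (Edge m n) := by
  have hf : (Set.Icc (0 : ℤ × ℤ) (m, n) ×ˢ Set.Icc (0 : ℤ × ℤ) (m, n)).Finite :=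
    (Set.finite_Icc _ _).prod (Set.finite_Icc _ _)
  have := hf.to_subtype
  refine Finite.of_injective (β := (Set.Icc (0 : ℤ × ℤ) (m, n) ×ˢ Set.Icc (0 : ℤ × ℤ) (m, n) :))
    (fun e => ⟨(e.a, e.b), ?_⟩) ?_
  · obtain ⟨h1, h2, h3, h4⟩ := e.a_mem
    obtain ⟨h5, h6, h7, h8⟩ := e.b_mem
    exact ⟨⟨⟨h1.le, h3.le⟩, ⟨h2.le, h4.le⟩⟩, ⟨⟨h5.le, h7.le⟩, ⟨h6.le, h8.le⟩⟩⟩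
  · intro e e' h
    simp only [Subtype.mk.injEq, Prod.mk.injEq] at h
    exact Edge.ext h.1 h.2

variable (hm : Even m) (hn : Even n)

/-- The orbits of `ι` on the edges. -/
def iotaSetoid : Setoid (Edge m n) where
  r e e' := e' = e ∨ e' = iota hm hn e
  iseqv :=
    { refl := fun _ => Or.inl rfl
      symm := by
        rintro e e' (rfl | rfl)
        · exact Or.inl rfl
        · exact Or.inr (iota_iota hm hn e).symm
      trans := by
        rintro e e' e'' (rfl | rfl) (rfl | rfl)
        · exact Or.inl rfl
        · exact Or.inr rfl
        · exact Or.inr rfl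
        · exact Or.inl (iota_iota hm hn e) }

/-- The orbit of an edge. -/
def cls (e : Edge m n) : Quotient (iotaSetoid hm hn) := Quotient.mk _ e

theorem cls_eq {e e' : Edge m n} : cls hm hn e = cls hm hn e' ↔ e' = e ∨ e' = iota hm hn e :=
  Quotient.eq

theorem cls_iota (e : Edge m n) : cls hm hn (iota hm hn e) = cls hm hn e :=
  ((cls_eq hm hn).2 (Or.inr rfl)).symm

/-- A permutation that commutes with `ι`, on the orbits. -/
def permCls (f : Equiv.Perm (Edge m n)) (hf : ∀ e, iota hm hn (f e) = f (iota hm hn e)) :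
    Equiv.Perm (Quotient (iotaSetoid hm hn)) :=
  Quotient.congr f fun e e' => by
    change e' = e ∨ e' = iota hm hn e ↔ f e' = f e ∨ f e' = iota hm hn (f e)
    rw [hf, f.injective.eq_iff, f.injective.eq_iff]

theorem permCls_cls (f : Equiv.Perm (Edge m n)) (hf : ∀ e, iota hm hn (f e) = f (iota hm hn e))
    (e : Edge m n) : permCls hm hn f hf (cls hm hn e) = cls hm hn (f e) := rfl

/-- The rectangles of `X^e`, one for each orbit of `ι`. -/
def gridSys : RectSystem where
  I := Quotient (iotaSetoid hm hn)
  fin := inferInstance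
  r := permCls hm hn east (iota_east hm hn)
  u := permCls hm hn north (iota_north hm hn)
  w := Quotient.lift width (by
    rintro e e' (rfl | rfl)
    · rfl
    · exact (width_iota hm hn e).symm)
  h := Quotient.lift height (by
    rintro e e' (rfl | rfl)
    · rfl
    · exact (height_iota hm hn e).symm)
  w_pos i := by
    induction i using Quotient.ind with | _ e => exact weight_pos e.b_mem
  h_pos i := by
    induction i using Quotient.ind with | _ e => exact weight_pos e.a_mem
  w_u i := by
    induction i using Quotient.ind with | _ e => rfl
  h_r i := by
    induction i using Quotient.ind with | _ e => rfl

open RectSystem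

/-- A point of the rectangle of an edge as a point of the rectangle of its orbit. -/
def toPt (p : RectUnion m n) : (gridSys hm hn).Pt := ⟨cls hm hn p.1, ⟨coord p, p.2.2⟩⟩

theorem continuous_toPt : Continuous (toPt hm hn) := by
  refine continuous_sigma fun e => ?_
  have h : Continuous fun x : rect e => (⟨(x : ℂ), x.2⟩ : (gridSys hm hn).rect (cls hm hn e)) :=
    Continuous.subtype_mk continuous_subtype_val _
  exact (continuous_sigmaMk (σ := fun i => (gridSys hm hn).rect i)).comp h

theorem exists_toPt_eq (e : Edge m n) (p : (gridSys hm hn).Pt) (h : cls hm hn e = p.1) :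
    ∃ P : RectUnion m n, P.1 = e ∧ coord P = crd p ∧ toPt hm hn P = p := by
  obtain ⟨i, z, hz⟩ := p
  subst h
  exact ⟨⟨e, z, hz⟩, rfl, rfl, rfl⟩

theorem projXe_iotaRect (p : RectUnion m n) :
    projXe hm hn (iotaRect hm hn p) = projXe hm hn p :=
  (Quot.sound (r := fun x y : X m n => y = iotaStar hm hn x) (a := Quot.mk _ p)
    (b := iotaStar hm hn (Quot.mk _ p)) rfl).symm

theorem projXe_eq_of_toPt_eq {p p' : RectUnion m n} (h : toPt hm hn p = toPt hm hn p') :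
    projXe hm hn p = projXe hm hn p' := by
  have h1 : coord p' = coord p := congrArg crd h.symm
  rcases (cls_eq hm hn).1 (congrArg Sigma.fst h) with h2 | h2
  · obtain ⟨e, z, hz⟩ := p
    obtain ⟨e', z', hz'⟩ := p'
    obtain rfl : e' = e := h2
    obtain rfl : z' = z := h1
    rfl
  · rw [← projXe_iotaRect hm hn p]
    obtain ⟨e, z, hz⟩ := p
    obtain ⟨e', z', hz'⟩ := p'
    obtain rfl : e' = iota hm hn e := h2
    obtain rfl : z' = z := h1
    rfl

/-- A point in the rectangle of an edge in a given orbit. -/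
def liftPt (p : (gridSys hm hn).Pt) : RectUnion m n :=
  (exists_toPt_eq hm hn (Quotient.out p.1) p (Quotient.out_eq p.1)).choose

theorem toPt_liftPt (p : (gridSys hm hn).Pt) : toPt hm hn (liftPt hm hn p) = p :=
  (exists_toPt_eq hm hn (Quotient.out p.1) p (Quotient.out_eq p.1)).choose_spec.2.2

/-- The projection of the rectangles of the orbits of `ι` onto `X^e`. -/
def qXe (p : (gridSys hm hn).Pt) : Xe m n hm hn := projXe hm hn (liftPt hm hn p)

theorem qXe_toPt (p : RectUnion m n) : qXe hm hn (toPt hm hn p) = projXe hm hn p :=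
  projXe_eq_of_toPt_eq hm hn (toPt_liftPt hm hn _)

theorem isQuotientMap_projXe : IsQuotientMap (projXe hm hn) :=
  isQuotientMap_quot_mk.comp isQuotientMap_quot_mk

theorem glue_toPt {p p' : RectUnion m n} (h : Glue p p') :
    (gridSys hm hn).Glue (toPt hm hn p) (toPt hm hn p') := by
  cases h with
  | horizontal h1 h2 h3 h4 =>
    exact RectSystem.Glue.horizontal _ _ (congrArg (cls hm hn) h1) h2 h3 h4
  | vertical h1 h2 h3 h4 =>
    exact RectSystem.Glue.vertical _ _ (congrArg (cls hm hn) h1) h2 h3 h4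

theorem qXe_eq_of_glue {p p' : (gridSys hm hn).Pt} (h : (gridSys hm hn).Glue p p') :
    qXe hm hn p = qXe hm hn p' := by
  obtain ⟨e, he⟩ := Quotient.exists_rep p.1
  obtain ⟨P, hP1, hP2, hP⟩ := exists_toPt_eq hm hn e p he
  have hw : (gridSys hm hn).w p.1 = width e := by rw [← he]; rfl
  have hh : (gridSys hm hn).h p.1 = height e := by rw [← he]; rfl
  cases h with
  | horizontal h1 h2 h3 h4 =>
    obtain ⟨P', hP'1, hP'2, hP'⟩ := exists_toPt_eq hm hn (east e) p' (by rw [h1, ← he]; rfl)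
    rw [← hP, ← hP', qXe_toPt, qXe_toPt]
    refine congrArg (Quot.mk _) (Quot.sound (Glue.horizontal P P' ?_ ?_ ?_ ?_))
    · rw [hP'1, hP1]
    · rw [hP2, h2, hw, hP1]
    · rw [hP'2, h3]
    · rw [hP2, hP'2, h4]
  | vertical h1 h2 h3 h4 =>
    obtain ⟨P', hP'1, hP'2, hP'⟩ := exists_toPt_eq hm hn (north e) p' (by rw [h1, ← he]; rfl)
    rw [← hP, ← hP', qXe_toPt, qXe_toPt]
    refine congrArg (Quot.mk _) (Quot.sound (Glue.vertical P P' ?_ ?_ ?_ ?_))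
    · rw [hP'1, hP1]
    · rw [hP2, h2, hh, hP1]
    · rw [hP'2, h3]
    · rw [hP2, hP'2, h4]

/-- The class of a point of `X^e` in the surface glued from the rectangles of the orbits. -/
def toQuot : Xe m n hm hn → Quot (gridSys hm hn).Glue :=
  Quot.lift (Quot.map (toPt hm hn) fun _ _ => glue_toPt hm hn) (by
    rintro x _ rfl
    obtain ⟨p, rfl⟩ := Quot.exists_rep x
    refine congrArg (Quot.mk _) ?_
    exact ext_pt (cls_iota hm hn p.1).symm rfl)

/-- Passing to the orbits of `ι` before gluing gives the same quotient. The structure of `X^e` thus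
needs no discussion of the fixed points of `ι_*`. -/
theorem isSurface_qXe : IsSurface (qXe hm hn) where
  quot := by
    refine IsQuotientMap.of_comp (continuous_toPt hm hn) ?_
      (g := qXe hm hn) (by
        rw [show qXe hm hn ∘ toPt hm hn = projXe hm hn from funext (qXe_toPt hm hn)]
        exact isQuotientMap_projXe hm hn)
    refine continuous_sigma fun i => ?_
    obtain ⟨e, rfl⟩ := Quotient.exists_rep i
    have h : Continuous fun x : rect e => projXe hm hn ⟨e, x⟩ :=
      (isQuotientMap_projXe hm hn).continuous.comp continuous_sigmaMk
    exact h.congr fun x => (qXe_toPt hm hn ⟨e, x⟩).symm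
  ker p p' := by
    constructor
    · intro h
      have h1 := congrArg (toQuot hm hn) h
      change Quot.mk _ (toPt hm hn (liftPt hm hn p)) = Quot.mk _ (toPt hm hn (liftPt hm hn p'))
        at h1
      rw [toPt_liftPt, toPt_liftPt] at h1
      exact Quot.eqvGen_exact h1
    · intro h
      induction h with
      | rel _ _ h' => exact qXe_eq_of_glue hm hn h'
      | refl _ => rfl
      | symm x y _ ih => exact ih.symm
      | trans x y z _ _ ih1 ih2 => exact ih1.trans ih2

/-! ### The order of the one-form at the vertices -/

theorem exists_chart_projXe {c d : ℝ} (hc : 0 < c ∧ c < 1) (hd : 0 < d ∧ d < 1)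
    (i : (gridSys hm hn).I) : ∃ φ : OpenPartialHomeomorph (Xe m n hm hn) ℂ,
      φ.source = Set.range (fun x : VStar c d i => qXe hm hn x.emb) ∧
      (∀ y, φ y = 0 → y ∈ φ.source → y = qXe hm hn (pt i 0)) ∧ qXe hm hn (pt i 0) ∈ φ.source ∧
      φ (qXe hm hn (pt i 0)) = 0 ∧
      IsPrimitive (projXe hm hn) φ.source
        (fun y => φ y ^ ((gridSys hm hn).mult i - 1 + 1)) := by
  obtain ⟨φ, h1, h2, h3, h4, h5⟩ := (isSurface_qXe hm hn).exists_chart_primitive hc hd i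
  refine ⟨φ, h1, h2, h3, h4, ?_⟩
  intro p hp
  rw [Nat.sub_add_cancel (mult_pos i)]
  rw [← qXe_toPt] at hp
  have h := (continuous_toPt hm hn).continuousAt.eventually (h5 _ hp)
  filter_upwards [h] with p' hp'
  rwa [qXe_toPt, qXe_toPt] at hp'

theorem hasOrder_vertex (i : (gridSys hm hn).I) :
    HasOrder (projXe hm hn) (qXe hm hn (pt i 0)) ((gridSys hm hn).mult i - 1) := by
  have h2 : (0 : ℝ) < 2⁻¹ ∧ (2⁻¹ : ℝ) < 1 := by norm_num
  obtain ⟨φ, -, -, h3, h4, h5⟩ := exists_chart_projXe hm hn h2 h2 i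
  exact ⟨φ, h3, h4, h5⟩

theorem eq_vertex_or_hasOrder_zero (x : Xe m n hm hn) :
    (∃ i, x = qXe hm hn (pt i 0)) ∨ HasOrder (projXe hm hn) x 0 := by
  obtain ⟨p, rfl⟩ := (isSurface_qXe hm hn).quot.surjective x
  obtain ⟨c, d, hc, hd, i, y, rfl⟩ := exists_part p
  obtain ⟨φ, h1, h2, -, -, h5⟩ := exists_chart_projXe hm hn hc hd i
  have hy : qXe hm hn y.emb ∈ φ.source := h1 ▸ Set.mem_range_self y
  by_cases h0 : φ (qXe hm hn y.emb) = 0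
  · exact Or.inl ⟨i, h2 _ h0 hy⟩
  · exact Or.inr (hasOrder_zero_of_chart h5 hy h0)

/-- The charts give an order at every point; uniqueness of the order shows that the points of order
zero and the vertices of multiplicity one are not zeros. -/
theorem zeros_projXe : zeros (projXe hm hn) =
    (fun i => qXe hm hn (pt i 0)) '' {i | 2 ≤ (gridSys hm hn).mult i} := by
  have hq := isQuotientMap_projXe hm hn
  ext x
  constructor
  · rintro ⟨k, hk, hx⟩
    rcases eq_vertex_or_hasOrder_zero hm hn x with ⟨i, rfl⟩ | h
    · refine ⟨i, ?_, rfl⟩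
      have := (hasOrder_vertex hm hn i).unique hq hx
      change 2 ≤ _
      omega
    · have := h.unique hq hx
      omega
  · rintro ⟨i, hi, rfl⟩
    change 2 ≤ _ at hi
    exact ⟨_, by omega, hasOrder_vertex hm hn i⟩

theorem ncard_zeros : (zeros (projXe hm hn)).ncard =
    ((gridSys hm hn).orb '' {i | 2 ≤ (gridSys hm hn).mult i}).ncard := by
  rw [zeros_projXe]
  have h : ∀ i j : (gridSys hm hn).I, qXe hm hn (pt i 0) = qXe hm hn (pt j 0) ↔
      (gridSys hm hn).orb i = (gridSys hm hn).orb j := by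
    intro i j
    rw [(isSurface_qXe hm hn).q_eq_iff, nf_pt_zero, nf_pt_zero, Sum.inl.injEq]
  obtain ⟨G, hG⟩ : ∃ G : (gridSys hm hn).Orb → Xe m n hm hn,
      ∀ i, G ((gridSys hm hn).orb i) = qXe hm hn (pt i 0) :=
    ⟨Quotient.lift (fun i => qXe hm hn (pt i 0)) fun i j hij => (h i j).2 (Quotient.sound hij),
      fun _ => rfl⟩
  simp_rw [← hG] at h ⊢
  rw [← Set.image_image]
  refine Set.InjOn.ncard_image ?_
  rintro _ ⟨i, -, rfl⟩ _ ⟨j, -, rfl⟩ hij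
  exact (h i j).1 hij

section Count

variable {M : Set (gridSys hm hn).I} {N : ℕ} (hM : ∀ i ∈ M, (gridSys hm hn).mult i = N)
  (hM' : ∀ i, i ∉ M → (gridSys hm hn).mult i = 1)
include hM hM'

theorem zeros_eq_empty (hN : N = 1) : zeros (projXe hm hn) = ∅ := by
  rw [zeros_projXe, Set.image_eq_empty]
  ext i
  by_cases hi : i ∈ M
  · simp [hM i hi, hN]
  · simp [hM' i hi]

theorem hasOrder_of_mem_zeros {x : Xe m n hm hn} (hx : x ∈ zeros (projXe hm hn)) :
    HasOrder (projXe hm hn) x (N - 1) := by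
  rw [zeros_projXe] at hx
  obtain ⟨i, hi, rfl⟩ := hx
  change 2 ≤ _ at hi
  by_cases h : i ∈ M
  · rw [← hM i h]
    exact hasOrder_vertex hm hn i
  · have := hM' i h
    omega

theorem ncard_zeros_eq {Z : ℕ} (hZ : M.ncard = Z * N) (hN : 2 ≤ N) :
    (zeros (projXe hm hn)).ncard = Z := by
  have h1 : {i | 2 ≤ (gridSys hm hn).mult i} = {i | (gridSys hm hn).mult i = N} := by
    ext i
    by_cases hi : i ∈ M
    · simp [hM i hi, hN]
    · have := hM' i hi
      simp only [Set.mem_ofPred_eq]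
      omega
  have h2 : {i | (gridSys hm hn).mult i = N} = M := by
    ext i
    by_cases hi : i ∈ M
    · simp [hM i hi, hi]
    · have := hM' i hi
      simp only [Set.mem_ofPred_eq, hi, iff_false]
      omega
  have h3 := ncard_mult_eq (D := gridSys hm hn) N
  rw [ncard_zeros, h1]
  rw [h2, hZ] at h3
  rw [h2]
  exact (Nat.eq_of_mul_eq_mul_right (by omega) h3).symm

end Count

end GridSurface
end

noncomputable section

namespace GridSurface

variable {m n : ℕ}

/-! ### Turning in the grid -/

/-- `(p', q')` is the grid point that follows the neighbour `(p, q)` of the grid point `(i, j)` in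
clockwise order. -/
def CW (m n : ℕ) (i j p q p' q' : ℤ) : Prop :=
  (p = i → q = j + 1 →
    i + 1 < m ∧ p' = i + 1 ∧ q' = j ∨ i + 1 = m ∧ (1 < j ∧ p' = i ∧ q' = j - 1 ∨
      j = 1 ∧ (1 < i ∧ p' = i - 1 ∧ q' = j ∨ i = 1 ∧ p' = i ∧ q' = j + 1))) ∧
  (p = i + 1 → q = j →
    1 < j ∧ p' = i ∧ q' = j - 1 ∨ j = 1 ∧ (1 < i ∧ p' = i - 1 ∧ q' = j ∨
      i = 1 ∧ (j + 1 < n ∧ p' = i ∧ q' = j + 1 ∨ j + 1 = n ∧ p' = i + 1 ∧ q' = j))) ∧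
  (p = i → q = j - 1 →
    1 < i ∧ p' = i - 1 ∧ q' = j ∨ i = 1 ∧ (j + 1 < n ∧ p' = i ∧ q' = j + 1 ∨
      j + 1 = n ∧ (i + 1 < m ∧ p' = i + 1 ∧ q' = j ∨ i + 1 = m ∧ p' = i ∧ q' = j - 1))) ∧
  (p = i - 1 → q = j →
    j + 1 < n ∧ p' = i ∧ q' = j + 1 ∨ j + 1 = n ∧ (i + 1 < m ∧ p' = i + 1 ∧ q' = j ∨
      i + 1 = m ∧ (1 < j ∧ p' = i ∧ q' = j - 1 ∨ j = 1 ∧ p' = i - 1 ∧ q' = j)))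

/-- `(p', q')` is the grid point that follows the neighbour `(p, q)` of the grid point `(i, j)` in
counter-clockwise order. -/
def CCW (m n : ℕ) (i j p q p' q' : ℤ) : Prop :=
  (p = i → q = j + 1 →
    1 < i ∧ p' = i - 1 ∧ q' = j ∨ i = 1 ∧ (1 < j ∧ p' = i ∧ q' = j - 1 ∨
      j = 1 ∧ (i + 1 < m ∧ p' = i + 1 ∧ q' = j ∨ i + 1 = m ∧ p' = i ∧ q' = j + 1))) ∧
  (p = i - 1 → q = j →
    1 < j ∧ p' = i ∧ q' = j - 1 ∨ j = 1 ∧ (i + 1 < m ∧ p' = i + 1 ∧ q' = j ∨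
      i + 1 = m ∧ (j + 1 < n ∧ p' = i ∧ q' = j + 1 ∨ j + 1 = n ∧ p' = i - 1 ∧ q' = j))) ∧
  (p = i → q = j - 1 →
    i + 1 < m ∧ p' = i + 1 ∧ q' = j ∨ i + 1 = m ∧ (j + 1 < n ∧ p' = i ∧ q' = j + 1 ∨
      j + 1 = n ∧ (1 < i ∧ p' = i - 1 ∧ q' = j ∨ i = 1 ∧ p' = i ∧ q' = j - 1))) ∧
  (p = i + 1 → q = j →
    j + 1 < n ∧ p' = i ∧ q' = j + 1 ∨ j + 1 = n ∧ (1 < i ∧ p' = i - 1 ∧ q' = j ∨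
      i = 1 ∧ (1 < j ∧ p' = i ∧ q' = j - 1 ∨ j = 1 ∧ p' = i + 1 ∧ q' = j)))

/-- The cyclic order, with the directions that leave the grid skipped, becomes a list of linear
conditions, so that later case distinctions are linear arithmetic. -/
theorem cw_of_firstIn {t : ℤ × ℤ → ℤ × ℤ} {v u w : ℤ × ℤ} (hv : InGrid m n v) (hu : InGrid m n u)
    (ht : ∀ x, t x = (v.1 + (x.2 - v.2), v.2 - (x.1 - v.1)))
    (hw : w = firstIn (InGrid m n) t u) : CW m n v.1 v.2 u.1 u.2 w.1 w.2 := by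
  obtain ⟨i, j⟩ := v
  obtain ⟨p, q⟩ := u
  obtain rfl := funext ht
  unfold firstIn InGrid at hw
  unfold InGrid at hv hu
  simp only at hv hu hw
  subst hw
  refine ⟨?_, ?_, ?_, ?_⟩ <;>
    (simp only; rintro rfl rfl; split_ifs <;> simp only [true_and, and_true] <;> omega)

theorem ccw_of_firstIn {t : ℤ × ℤ → ℤ × ℤ} {v u w : ℤ × ℤ} (hv : InGrid m n v)
    (hu : InGrid m n u) (ht : ∀ x, t x = (v.1 - (x.2 - v.2), v.2 + (x.1 - v.1)))
    (hw : w = firstIn (InGrid m n) t u) : CCW m n v.1 v.2 u.1 u.2 w.1 w.2 := by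
  obtain ⟨i, j⟩ := v
  obtain ⟨p, q⟩ := u
  obtain rfl := funext ht
  unfold firstIn InGrid at hw
  unfold InGrid at hv hu
  simp only at hv hu hw
  subst hw
  refine ⟨?_, ?_, ?_, ?_⟩ <;>
    (simp only; rintro rfl rfl; split_ifs <;> simp only [true_and, and_true] <;> omega)

/-- The grid point `(p', q')` follows `(p, q)` in the cyclic order at `(i, j)`. -/
def NextStep (m n : ℕ) (i j p q p' q' : ℤ) : Prop :=
  (i % 2 = 0 → CW m n i j p q p' q') ∧ (i % 2 = 1 → CCW m n i j p q p' q')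

/-- The grid point `(p', q')` precedes `(p, q)` in the cyclic order at `(i, j)`. -/
def PrevStep (m n : ℕ) (i j p q p' q' : ℤ) : Prop :=
  (i % 2 = 1 → CW m n i j p q p' q') ∧ (i % 2 = 0 → CCW m n i j p q p' q')

theorem nextStep {v u : ℤ × ℤ} (hv : InGrid m n v) (hu : InGrid m n u) :
    NextStep m n v.1 v.2 u.1 u.2 (next m n v u).1 (next m n v u).2 := by
  constructor <;> intro h
  · exact cw_of_firstIn hv hu (fun x => if_pos (Int.even_iff.2 h)) rfl
  · exact ccw_of_firstIn hv hu (fun x => if_neg (by rw [Int.even_iff]; omega)) rfl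

theorem prevStep {v u : ℤ × ℤ} (hv : InGrid m n v) (hu : InGrid m n u) :
    PrevStep m n v.1 v.2 u.1 u.2 (prev m n v u).1 (prev m n v u).2 := by
  constructor <;> intro h
  · exact cw_of_firstIn hv hu (fun x => if_neg (by rw [Int.even_iff]; omega)) rfl
  · exact ccw_of_firstIn hv hu (fun x => if_pos (Int.even_iff.2 h)) rfl

end GridSurface
end

noncomputable section

namespace GridSurface

variable {m n : ℕ}

/-! ### Going around a vertex of the surface -/

/-- The lattice point `(x, y)` in the cell `(X, Y)` of the lattice `mℤ × nℤ` that unfolds the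
edge with the endpoints `(ai, aj)` and `(bi, bj)`. It exists if the edge is vertical, and for every
second edge of the top and of the bottom row. -/
inductive Unfolds (m n : ℕ) (ai aj bi bj : ℤ) : ℤ → ℤ → ℤ → ℤ → Prop
  -- For even `m` and `n`, all these points have `x ≡ y` modulo `2` and `x - X - Y` even, and none
  -- lies in the upper right position of its cell. Vertical edges in even columns go to the cells
  -- `(0, 0)` and `(-1, -1)`, those in odd columns to the other two, since the cyclic order is
  -- reversed there.
  | evenA (h : ai = bi) (h' : bj = aj + 1) (h2 : ai % 2 = 0) : Unfolds m n ai aj bi bj ai aj 0 0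
  | evenB (h : ai = bi) (h' : aj = bj + 1) (h2 : ai % 2 = 0) :
      Unfolds m n ai aj bi bj (-ai) (-bj - 1) (-1) (-1)
  | oddA (h : ai = bi) (h' : bj = aj + 1) (h2 : ai % 2 = 1) :
      Unfolds m n ai aj bi bj (-ai) aj (-1) 0
  | oddB (h : ai = bi) (h' : aj = bj + 1) (h2 : ai % 2 = 1) :
      Unfolds m n ai aj bi bj ai (-bj - 1) 0 (-1)
  | top (h : aj = n - 1) (h' : bj = n - 1) (h1 : ai = bi + 1) (h2 : bi % 2 = 0) :
      Unfolds m n ai aj bi bj (-ai) (n - 1) (-1) 0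
  | bot (h : aj = 1) (h' : bj = 1) (h1 : bi = ai + 1) (h2 : ai % 2 = 1) :
      Unfolds m n ai aj bi bj ai (-1) 0 (-1)

/-- The points `(x, y)` and `(x', y')` in the cells `(X, Y)` and `(X', Y')` agree, after a
translation by an element of the lattice `{(αm, βn) : α ≡ β mod 2}`, in the values of `y - x`, and
of `x - X - Y` up to the summand `k`. -/
def LatEq (m n : ℕ) (x y X Y x' y' X' Y' k : ℤ) : Prop :=
  ∃ α β : ℤ, (α - β) % 2 = 0 ∧ y' - x' = y - x + β * n - α * m ∧
    x' - X' - Y' = x - X - Y + k + α * m - α - β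

set_option maxHeartbeats 2000000 in
theorem unfolds_step {ai aj bi bj ci cj di dj fi fj gi gj x y X Y : ℤ} (hm : m % 2 = 0)
    (hn : n % 2 = 0) (ha : (0 < ai ∧ ai < m ∧ 0 < aj ∧ aj < n) ∧ (ai + aj) % 2 = 0)
    (hb : (0 < bi ∧ bi < m ∧ 0 < bj ∧ bj < n))
    (hc : (0 < ci ∧ ci < m ∧ 0 < cj ∧ cj < n))
    (hd : (0 < di ∧ di < m ∧ 0 < dj ∧ dj < n))
    (hf : (0 < fi ∧ fi < m ∧ 0 < fj ∧ fj < n))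
    (s1 : PrevStep m n bi bj ai aj ci cj) (s2 : PrevStep m n ci cj bi bj di dj)
    (s3 : NextStep m n di dj ci cj fi fj) (s4 : NextStep m n fi fj di dj gi gj)
    (h : Unfolds m n ai aj bi bj x y X Y) :
    ∃ x' y' X' Y', Unfolds m n fi fj gi gj x' y' X' Y' ∧ LatEq m n x y X Y x' y' X' Y' 2 := by
  -- For each kind of edge, the four moves down, left, up and right are evaluated; most branches
  -- contradict parity or the bounds of the grid.
  cases h
  all_goals
    first
      | replace s1 := s1.1 (by omega)
      | replace s1 := s1.2 (by omega)
    first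
      | replace s1 := s1.1 (by omega) (by omega)
      | replace s1 := s1.2.1 (by omega) (by omega)
      | replace s1 := s1.2.2.1 (by omega) (by omega)
      | replace s1 := s1.2.2.2 (by omega) (by omega)
    rcases s1 with ⟨_, rfl, rfl⟩ | ⟨_, ⟨_, rfl, rfl⟩ | ⟨_, ⟨_, rfl, rfl⟩ | ⟨_, rfl, rfl⟩⟩⟩ <;>
      try (exfalso; omega)
  all_goals
    first
      | replace s2 := s2.1 (by omega)
      | replace s2 := s2.2 (by omega)
    first
      | replace s2 := s2.1 (by omega) (by omega)
      | replace s2 := s2.2.1 (by omega) (by omega)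
      | replace s2 := s2.2.2.1 (by omega) (by omega)
      | replace s2 := s2.2.2.2 (by omega) (by omega)
    rcases s2 with ⟨_, rfl, rfl⟩ | ⟨_, ⟨_, rfl, rfl⟩ | ⟨_, ⟨_, rfl, rfl⟩ | ⟨_, rfl, rfl⟩⟩⟩ <;>
      try (exfalso; omega)
  all_goals
    first
      | replace s3 := s3.1 (by omega)
      | replace s3 := s3.2 (by omega)
    first
      | replace s3 := s3.1 (by omega) (by omega)
      | replace s3 := s3.2.1 (by omega) (by omega)
      | replace s3 := s3.2.2.1 (by omega) (by omega)
      | replace s3 := s3.2.2.2 (by omega) (by omega)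
    rcases s3 with ⟨_, rfl, rfl⟩ | ⟨_, ⟨_, rfl, rfl⟩ | ⟨_, ⟨_, rfl, rfl⟩ | ⟨_, rfl, rfl⟩⟩⟩ <;>
      try (exfalso; omega)
  all_goals
    first
      | replace s4 := s4.1 (by omega)
      | replace s4 := s4.2 (by omega)
    first
      | replace s4 := s4.1 (by omega) (by omega)
      | replace s4 := s4.2.1 (by omega) (by omega)
      | replace s4 := s4.2.2.1 (by omega) (by omega)
      | replace s4 := s4.2.2.2 (by omega) (by omega)
    rcases s4 with ⟨_, rfl, rfl⟩ | ⟨_, ⟨_, rfl, rfl⟩ | ⟨_, ⟨_, rfl, rfl⟩ | ⟨_, rfl, rfl⟩⟩⟩ <;>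
      try (exfalso; omega)
  all_goals
    first
      | refine ⟨_, _, _, _, .evenA (by omega) (by omega) (by omega), ?_⟩
      | refine ⟨_, _, _, _, .evenB (by omega) (by omega) (by omega), ?_⟩
      | refine ⟨_, _, _, _, .oddA (by omega) (by omega) (by omega), ?_⟩
      | refine ⟨_, _, _, _, .oddB (by omega) (by omega) (by omega), ?_⟩
      | refine ⟨_, _, _, _, .top (by omega) (by omega) (by omega) (by omega), ?_⟩
      | refine ⟨_, _, _, _, .bot (by omega) (by omega) (by omega) (by omega), ?_⟩
    -- The translations that bring the point back to the four cells around the origin; their entries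
    -- are even since `ι` is not involved.
    first
      | exact ⟨0, 0, by omega, by omega, by omega⟩
      | exact ⟨-2, 0, by omega, by omega, by omega⟩
      | exact ⟨0, -2, by omega, by omega, by omega⟩
      | exact ⟨-2, -2, by omega, by omega, by omega⟩
      | exact ⟨-4, 0, by omega, by omega, by omega⟩
      | exact ⟨0, -4, by omega, by omega, by omega⟩
      | exact ⟨4, 2, by omega, by omega, by omega⟩
      | exact ⟨-4, -2, by omega, by omega, by omega⟩
      | exact ⟨2, 4, by omega, by omega, by omega⟩
      | exact ⟨-2, -4, by omega, by omega, by omega⟩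

end GridSurface
end

/-! ### Fixed edges, and injectivity of the unfolding up to translations -/

noncomputable section

namespace GridSurface

variable {m n : ℕ}

theorem Edge.coords (e : Edge m n) : (0 < e.a.1 ∧ e.a.1 < m ∧ 0 < e.a.2 ∧ e.a.2 < n) ∧
    (0 < e.b.1 ∧ e.b.1 < m ∧ 0 < e.b.2 ∧ e.b.2 < n) ∧ (e.a.1 + e.a.2) % 2 = 0 ∧
    (e.b.1 + e.b.2) % 2 = 1 ∧
    (e.b.1 = e.a.1 ∧ (e.b.2 = e.a.2 + 1 ∨ e.b.2 = e.a.2 - 1) ∨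
      e.b.2 = e.a.2 ∧ (e.b.1 = e.a.1 + 1 ∨ e.b.1 = e.a.1 - 1)) := by
  refine ⟨e.a_mem, e.b_mem, Int.even_iff.1 e.a_isA, Int.odd_iff.1 e.b_isB, ?_⟩
  have h := e.adj
  unfold Adj at h
  have h1 : e.a.1 - e.b.1 ≤ 1 ∧ -1 ≤ e.a.1 - e.b.1 := abs_le_one_iff_mul_self_le_one.2
    (by nlinarith [sq_nonneg (e.a.2 - e.b.2)]) |> abs_le.1 |>.symm
  have h2 : e.a.2 - e.b.2 ≤ 1 ∧ -1 ≤ e.a.2 - e.b.2 := abs_le_one_iff_mul_self_le_one.2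
    (by nlinarith [sq_nonneg (e.a.1 - e.b.1)]) |> abs_le.1 |>.symm
  obtain ⟨x, hx⟩ : ∃ x, x = e.a.1 - e.b.1 := ⟨_, rfl⟩
  obtain ⟨y, hy⟩ : ∃ y, y = e.a.2 - e.b.2 := ⟨_, rfl⟩
  rw [← hx] at h h1
  rw [← hy] at h h2
  have hx' : x = -1 ∨ x = 0 ∨ x = 1 := by omega
  have hy' : y = -1 ∨ y = 0 ∨ y = 1 := by omega
  rcases hx' with rfl | rfl | rfl <;> rcases hy' with rfl | rfl | rfl <;> omega

/-- The turn around the lower left corner, on edges. -/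
def vtx : Equiv.Perm (Edge m n) := east * north * east⁻¹ * north⁻¹

/-- The unfolding of an edge. -/
def Edge.Unfolds (e : Edge m n) (x y X Y : ℤ) : Prop :=
  GridSurface.Unfolds m n e.a.1 e.a.2 e.b.1 e.b.2 x y X Y

theorem Edge.Unfolds.vtx (hm : Even m) (hn : Even n) {e : Edge m n} {x y X Y : ℤ}
    (h : e.Unfolds x y X Y) : ∃ x' y' X' Y', (GridSurface.vtx e).Unfolds x' y' X' Y' ∧
      LatEq m n x y X Y x' y' X' Y' 2 :=
  let e₁ := north⁻¹ e
  let e₂ := east⁻¹ e₁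
  let e₃ := north e₂
  unfolds_step (Nat.even_iff.1 hm) (Nat.even_iff.1 hn) ⟨e.coords.1, e.coords.2.2.1⟩ e.b_mem
    e₁.a_mem e₂.b_mem e₃.a_mem (prevStep e.b_mem e.a_mem) (prevStep e₁.a_mem e₁.b_mem)
    (nextStep e₂.b_mem e₂.a_mem) (nextStep e₃.a_mem e₃.b_mem) h

/-- The edges that do not unfold are left fixed: their lower left corner is the midpoint of a
square of the grid. -/
theorem unfolds_or_fixed {ai aj bi bj ci cj di dj fi fj gi gj : ℤ} (hm : m % 2 = 0)
    (hn : n % 2 = 0) (ha : (0 < ai ∧ ai < m ∧ 0 < aj ∧ aj < n) ∧ (ai + aj) % 2 = 0)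
    (hb : (0 < bi ∧ bi < m ∧ 0 < bj ∧ bj < n))
    (s1 : PrevStep m n bi bj ai aj ci cj) (s2 : PrevStep m n ci cj bi bj di dj)
    (s3 : NextStep m n di dj ci cj fi fj) (s4 : NextStep m n fi fj di dj gi gj)
    (hadj : bi = ai ∧ (bj = aj + 1 ∨ bj = aj - 1) ∨ bj = aj ∧ (bi = ai + 1 ∨ bi = ai - 1)) :
    (∃ x y X Y, Unfolds m n ai aj bi bj x y X Y) ∨
      (fi = ai ∧ fj = aj ∧ gi = bi ∧ gj = bj) := by
  by_cases hM : bi = ai ∨ (aj = n - 1 ∧ ai = bi + 1 ∧ bi % 2 = 0) ∨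
      (aj = 1 ∧ bi = ai + 1 ∧ ai % 2 = 1)
  · left
    rcases hM with h | h | h
    · rcases Int.emod_two_eq_zero_or_one ai with h2 | h2
      · rcases hadj with ⟨-, h' | h'⟩ | h'
        · exact ⟨_, _, _, _, .evenA h.symm h' h2⟩
        · exact ⟨_, _, _, _, .evenB h.symm (by omega) h2⟩
        · omega
      · rcases hadj with ⟨-, h' | h'⟩ | h'
        · exact ⟨_, _, _, _, .oddA h.symm h' h2⟩
        · exact ⟨_, _, _, _, .oddB h.symm (by omega) h2⟩
        · omega
    · exact ⟨_, _, _, _, .top h.1 (by omega) h.2.1 h.2.2⟩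
    · exact ⟨_, _, _, _, .bot h.1 (by omega) h.2.1 h.2.2⟩
  -- For the remaining horizontal edges, the four moves run around one unit square of the grid.
  · right
    rcases Int.emod_two_eq_zero_or_one ai with h2 | h2 <;>
      rcases hadj with h' | ⟨h', h3 | h3⟩ <;> try (exfalso; omega)
    all_goals
      first
        | replace s1 := s1.1 (by omega)
        | replace s1 := s1.2 (by omega)
      first
        | replace s1 := s1.2.1 (by omega) (by omega)
        | replace s1 := s1.2.2.2 (by omega) (by omega)
      rcases s1 with ⟨_, rfl, rfl⟩ | ⟨_, ⟨_, rfl, rfl⟩ | ⟨_, ⟨_, rfl, rfl⟩ | ⟨_, rfl, rfl⟩⟩⟩ <;>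
      try (exfalso; omega)
    all_goals
      first
        | replace s2 := s2.1 (by omega)
        | replace s2 := s2.2 (by omega)
      first
        | replace s2 := s2.1 (by omega) (by omega)
        | replace s2 := s2.2.2.1 (by omega) (by omega)
      rcases s2 with ⟨_, rfl, rfl⟩ | ⟨_, ⟨_, rfl, rfl⟩ | ⟨_, ⟨_, rfl, rfl⟩ | ⟨_, rfl, rfl⟩⟩⟩ <;>
      try (exfalso; omega)
    all_goals
      first
        | replace s3 := s3.1 (by omega)
        | replace s3 := s3.2 (by omega)
      first
        | replace s3 := s3.2.1 (by omega) (by omega)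
        | replace s3 := s3.2.2.2 (by omega) (by omega)
      rcases s3 with ⟨_, rfl, rfl⟩ | ⟨_, ⟨_, rfl, rfl⟩ | ⟨_, ⟨_, rfl, rfl⟩ | ⟨_, rfl, rfl⟩⟩⟩ <;>
      try (exfalso; omega)
    all_goals
      first
        | replace s4 := s4.1 (by omega)
        | replace s4 := s4.2 (by omega)
      first
        | replace s4 := s4.1 (by omega) (by omega)
        | replace s4 := s4.2.2.1 (by omega) (by omega)
      rcases s4 with ⟨_, rfl, rfl⟩ | ⟨_, ⟨_, rfl, rfl⟩ | ⟨_, ⟨_, rfl, rfl⟩ | ⟨_, rfl, rfl⟩⟩⟩ <;>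
      try (exfalso; omega)
    all_goals omega

theorem Edge.unfolds_or_vtx_eq (hm : Even m) (hn : Even n) (e : Edge m n) :
    (∃ x y X Y, e.Unfolds x y X Y) ∨ GridSurface.vtx e = e := by
  let e₁ := north⁻¹ e
  let e₂ := east⁻¹ e₁
  let e₃ := north e₂
  refine (unfolds_or_fixed (Nat.even_iff.1 hm) (Nat.even_iff.1 hn) ⟨e.coords.1, e.coords.2.2.1⟩
    e.b_mem (prevStep e.b_mem e.a_mem) (prevStep e₁.a_mem e₁.b_mem)
    (nextStep e₂.b_mem e₂.a_mem) (nextStep e₃.a_mem e₃.b_mem) e.coords.2.2.2.2).imp id ?_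
  rintro ⟨h1, h2, h3, h4⟩
  exact Edge.ext (Prod.ext h1 h2) (Prod.ext h3 h4)

/-- Lattice points outside the grid lines are determined by `y - x` and `x - X - Y`, up to the
corners. -/
theorem eq_of_unfold {m n x y X Y x' y' X' Y' : ℤ} (hm : 2 ≤ m) (hn : 2 ≤ n) (hmn : 4 < m + n)
    (hx : 0 < x - m * X ∧ x - m * X < m) (hy : 0 < y - n * Y ∧ y - n * Y < n)
    (hx' : 0 < x' - m * X' ∧ x' - m * X' < m) (hy' : 0 < y' - n * Y' ∧ y' - n * Y' < n)
    (hc : ¬ (x - m * X = m - 1 ∧ y - n * Y = n - 1)) (hle : x ≤ x')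
    (hD : y' - x' = y - x) (hG : x' - X' - Y' = x - X - Y) : x' = x ∧ y' = y := by
  obtain ⟨δ, rfl⟩ : ∃ δ, x' = x + δ := ⟨x' - x, by ring⟩
  obtain ⟨A, rfl⟩ : ∃ A, X' = X + A := ⟨X' - X, by ring⟩
  obtain ⟨B, rfl⟩ : ∃ B, Y' = Y + B := ⟨Y' - Y, by ring⟩
  obtain rfl : y' = y + δ := by linarith
  have hAB : A + B = δ := by linarith
  by_contra hne
  have hδ : 0 < δ := by
    by_contra h
    exact hne ⟨by linarith, by linarith⟩
  -- Two interior positions of cells that are `A` columns apart have distance at least `(A - 1)m +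
  -- 2`.
  have hA : 2 * A ≤ δ ∧ (0 < A → (A - 1) * m ≤ δ - 2) := by
    have h1 : (A - 1) * m ≤ δ - 2 := by nlinarith
    refine ⟨?_, fun _ => h1⟩
    rcases le_or_gt A 0 with h | h
    · linarith
    · nlinarith
  have hB : 2 * B ≤ δ ∧ (0 < B → (B - 1) * n ≤ δ - 2) := by
    have h1 : (B - 1) * n ≤ δ - 2 := by nlinarith
    refine ⟨?_, fun _ => h1⟩
    rcases le_or_gt B 0 with h | h
    · linarith
    · nlinarith
  -- Since `A + B = δ`, both bounds by `δ/2` are attained: the path crosses as many vertical as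
  -- horizontal lines.
  obtain rfl : A = B := by linarith
  have hA0 : 0 < A := by linarith
  have h1 := hA.2 hA0
  have h2 := hB.2 hA0
  have hA1 : A = 1 := by nlinarith
  subst hA1
  -- With `A = B = 1` and `δ = 2` the two points lie on both sides of a lattice corner, which `hc`
  -- excludes.
  exact hc ⟨by linarith, by linarith⟩

theorem Edge.Unfolds.bounds (hm : Even m) (hn : Even n) {e : Edge m n} {x y X Y : ℤ}
    (h : e.Unfolds x y X Y) : (0 < x - m * X ∧ x - m * X < m) ∧ (0 < y - n * Y ∧ y - n * Y < n) ∧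
      ¬ (x - m * X = m - 1 ∧ y - n * Y = n - 1) := by
  have hm' := Nat.even_iff.1 hm
  have hn' := Nat.even_iff.1 hn
  obtain ⟨h1, h2, -, -, -⟩ := e.coords
  cases h <;> refine ⟨?_, ?_, ?_⟩ <;> omega

theorem Edge.Unfolds.lt {e : Edge m n} {x y X Y : ℤ} (h : e.Unfolds x y X Y) :
    (-m < x ∧ x < m) ∧ -n < y ∧ y < n := by
  obtain ⟨h1, h2, -, -, -⟩ := e.coords
  cases h <;> refine ⟨?_, ?_⟩ <;> omega

/-- The point alone determines the edge. This reduces comparing two unfoldings to linear conditions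
instead of pairs of constructors. -/
theorem Edge.Unfolds.coords_eq {e : Edge m n} {x y X Y : ℤ} (h : e.Unfolds x y X Y) :
    (0 < x ∧ e.a.1 = x ∨ x < 0 ∧ e.a.1 = -x) ∧
    (0 < y ∧ y < n - 1 ∧ e.a.2 = y ∧ e.b.1 = e.a.1 ∧ e.b.2 = y + 1 ∨
      y = n - 1 ∧ e.a.2 = y ∧ e.b.1 = e.a.1 - 1 ∧ e.b.2 = y ∨
      y < -1 ∧ e.a.2 = -y ∧ e.b.1 = e.a.1 ∧ e.b.2 = -y - 1 ∨
      y = -1 ∧ e.a.2 = 1 ∧ e.b.1 = e.a.1 + 1 ∧ e.b.2 = 1) := by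
  obtain ⟨h1, h2, -, -, -⟩ := e.coords
  cases h <;> refine ⟨?_, ?_⟩ <;> omega

/-- Edges whose unfoldings differ by a translation agree up to `ι`. -/
theorem Edge.Unfolds.eq_or_eq_iota (hm : Even m) (hn : Even n) {e e' : Edge m n}
    {x y X Y x' y' X' Y' α β : ℤ} (h : e.Unfolds x y X Y) (h' : e'.Unfolds x' y' X' Y')
    (hx : x' = x + α * m) (hy : y' = y + β * n) (hαβ : (α - β) % 2 = 0) :
    e' = e ∨ e' = iota hm hn e := by
  -- Both points have coordinates of absolute value below `m` and `n`, so the translation has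
  -- entries `0` or `±1`; equal parity leaves the identity or `ι`.
  have key : ∀ (k : ℕ) (z z' α : ℤ), -k < z ∧ z < k → -k < z' ∧ z' < k → z' = z + α * k →
      α = 0 ∧ z' = z ∨ α = 1 ∧ z' = z + k ∨ α = -1 ∧ z' = z - k := by
    intro k z z' α hz hz' h
    have h1 : α < 2 := by
      by_contra hc
      nlinarith
    have h2 : -2 < α := by
      by_contra hc
      nlinarith
    have h3 : α = 0 ∨ α = 1 ∨ α = -1 := by omega
    rcases h3 with rfl | rfl | rfl <;> omega
  have hα := key m x x' α h.lt.1 h'.lt.1 hx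
  have hβ := key n y y' β h.lt.2 h'.lt.2 hy
  have bx := h.lt.1
  have bx' := h'.lt.1
  have by_ := h.lt.2
  have by' := h'.lt.2
  obtain ⟨c1, c2⟩ := h.coords_eq
  obtain ⟨c1', c2'⟩ := h'.coords_eq
  clear key hx hy h h'
  have k1 : α = 0 ∧ e'.a.1 = e.a.1 ∨ (α = 1 ∨ α = -1) ∧ e'.a.1 = m - e.a.1 := by
    clear hβ hαβ c2 c2' by_ by'
    rcases c1 with c1 | c1 <;> rcases c1' with c1' | c1' <;> omega
  have k2 : β = 0 ∧ e'.a.2 = e.a.2 ∧ e'.b.2 = e.b.2 ∧ e'.b.1 - e'.a.1 = e.b.1 - e.a.1 ∨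
      (β = 1 ∨ β = -1) ∧ e'.a.2 = n - e.a.2 ∧ e'.b.2 = n - e.b.2 ∧
        e'.b.1 - e'.a.1 = -(e.b.1 - e.a.1) := by
    clear hα hαβ c1 c1' bx bx' k1
    rcases hβ with ⟨rfl, rfl⟩ | ⟨rfl, rfl⟩ | ⟨rfl, rfl⟩
    · left
      rcases c2 with c2 | c2 | c2 | c2 <;> omega
    all_goals
      right
      rcases c2 with c2 | c2 | c2 | c2 <;> omega
  clear hα hβ c1 c1' c2 c2'
  rcases k1 with k1 | k1 <;> rcases k2 with k2 | k2
  · exact Or.inl (Edge.ext (Prod.ext k1.2 k2.2.1) (Prod.ext (by omega) k2.2.2.1))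
  · omega
  · omega
  · exact Or.inr (Edge.ext (Prod.ext k1.2 k2.2.1)
      (Prod.ext (by simp only [iota, flipV]; omega) k2.2.2.1))

end GridSurface
end

noncomputable section

namespace GridSurface

variable {m n : ℕ}

/-! ### The multiplicities of the vertices -/

theorem LatEq.trans {x y X Y x' y' X' Y' x'' y'' X'' Y'' k l : ℤ}
    (h : LatEq m n x y X Y x' y' X' Y' k) (h' : LatEq m n x' y' X' Y' x'' y'' X'' Y'' l) :
    LatEq m n x y X Y x'' y'' X'' Y'' (k + l) := by
  obtain ⟨α, β, h1, h2, h3⟩ := h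
  obtain ⟨α', β', h1', h2', h3'⟩ := h'
  exact ⟨α + α', β + β', by omega, by linarith, by linarith⟩

theorem LatEq.symm {x y X Y x' y' X' Y' k : ℤ} (h : LatEq m n x y X Y x' y' X' Y' k) :
    LatEq m n x' y' X' Y' x y X Y (-k) := by
  obtain ⟨α, β, h1, h2, h3⟩ := h
  exact ⟨-α, -β, by omega, by linarith, by linarith⟩

theorem Edge.Unfolds.latEq_of_eq (hm : Even m) (hn : Even n) {e : Edge m n}
    {x y X Y x' y' X' Y' : ℤ} (h : e.Unfolds x y X Y) (h' : e.Unfolds x' y' X' Y') :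
    LatEq m n x y X Y x' y' X' Y' 0 := by
  have hm' := Nat.even_iff.1 hm
  have hn' := Nat.even_iff.1 hn
  obtain ⟨h1, h2, h3, h4, -⟩ := e.coords
  refine ⟨0, 0, by omega, ?_, ?_⟩ <;> cases h <;> cases h' <;> omega

/-- The involution unfolds to a translation with odd entries, which is why the lattice is `α ≡ β`
modulo `2` rather than both even. -/
theorem Edge.Unfolds.latEq_iota (hm : Even m) (hn : Even n) {e e' : Edge m n}
    (he : e' = iota hm hn e)
    {x y X Y x' y' X' Y' : ℤ} (h : e.Unfolds x y X Y) (h' : e'.Unfolds x' y' X' Y') :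
    LatEq m n x y X Y x' y' X' Y' 0 := by
  have hm' := Nat.even_iff.1 hm
  have hn' := Nat.even_iff.1 hn
  obtain ⟨h1, h2, h3, h4, -⟩ := e.coords
  have k1 : e'.a.1 = m - e.a.1 := congrArg (fun e : Edge m n => e.a.1) he
  have k2 : e'.a.2 = n - e.a.2 := congrArg (fun e : Edge m n => e.a.2) he
  have k3 : e'.b.1 = m - e.b.1 := congrArg (fun e : Edge m n => e.b.1) he
  have k4 : e'.b.2 = n - e.b.2 := congrArg (fun e : Edge m n => e.b.2) he
  clear he
  cases h <;> cases h' <;> first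
    | (exfalso; omega)
    | exact ⟨1, 1, by omega, by omega, by omega⟩
    | exact ⟨-1, -1, by omega, by omega, by omega⟩
    | exact ⟨1, -1, by omega, by omega, by omega⟩
    | exact ⟨-1, 1, by omega, by omega, by omega⟩

theorem Edge.Unfolds.cls_eq_iff (hm : Even m) (hn : Even n) (hmn : 6 ≤ m * n) {e e' : Edge m n}
    {x y X Y x' y' X' Y' : ℤ} (h : e.Unfolds x y X Y) (h' : e'.Unfolds x' y' X' Y') :
    cls hm hn e = cls hm hn e' ↔ LatEq m n x y X Y x' y' X' Y' 0 := by
  rw [cls_eq]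
  constructor
  · rintro (rfl | he)
    · exact h.latEq_of_eq hm hn h'
    · exact h.latEq_iota hm hn he h'
  · rintro ⟨α, β, h1, h2, h3⟩
    have hm2 : 2 ≤ m := by
      obtain ⟨k, rfl⟩ := hm
      rcases Nat.eq_zero_or_pos k with rfl | hk
      · omega
      · omega
    have hn2 : 2 ≤ n := by
      obtain ⟨k, rfl⟩ := hn
      rcases Nat.eq_zero_or_pos k with rfl | hk
      · omega
      · omega
    have hs : 4 < m + n := by
      by_contra hc
      obtain rfl : m = 2 := by omega
      omega
    have hm2' : (2 : ℤ) ≤ m := by exact_mod_cast hm2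
    have hn2' : (2 : ℤ) ≤ n := by exact_mod_cast hn2
    have hs' : (4 : ℤ) < m + n := by exact_mod_cast hs
    obtain ⟨b1, b2, b3⟩ := h.bounds hm hn
    obtain ⟨b1', b2', b3'⟩ := h'.bounds hm hn
    have e1 : x + α * m - m * (X + α) = x - m * X := by ring
    have e2 : y + β * n - n * (Y + β) = y - n * Y := by ring
    -- The translation also shifts the cell by `(α, β)`. After it both points have the same
    -- invariants; the earlier one on the diagonal must be the one known to avoid the corner.
    have key : x' = x + α * m ∧ y' = y + β * n := by
      rcases le_total (x + α * m) x' with hle | hle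
      · exact eq_of_unfold (X := X + α) (Y := Y + β) hm2' hn2' hs' (by rwa [e1]) (by rwa [e2])
          b1' b2' (by rwa [e1, e2]) hle (by linarith) (by linarith)
      · have := eq_of_unfold (X' := X + α) (Y' := Y + β) (x' := x + α * m) (y' := y + β * n)
          hm2' hn2' hs' b1' b2' (by rwa [e1]) (by rwa [e2]) b3' hle (by linarith) (by linarith)
        exact ⟨this.1.symm, this.2.symm⟩
    exact h.eq_or_eq_iota hm hn h' key.1 key.2 h1

theorem Edge.Unfolds.vtx_pow (hm : Even m) (hn : Even n) {e : Edge m n} {x y X Y : ℤ}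
    (h : e.Unfolds x y X Y) (k : ℕ) : ∃ x' y' X' Y',
      ((GridSurface.vtx ^ k) e).Unfolds x' y' X' Y' ∧ LatEq m n x y X Y x' y' X' Y' (2 * k) := by
  induction k with
  | zero => exact ⟨x, y, X, Y, h, 0, 0, by simp⟩
  | succ k ih =>
    obtain ⟨x', y', X', Y', h1, h2⟩ := ih
    obtain ⟨x'', y'', X'', Y'', h3, h4⟩ := h1.vtx hm hn
    refine ⟨x'', y'', X'', Y'', ?_, ?_⟩
    · rw [pow_succ', Equiv.Perm.mul_apply]
      exact h3
    · have := h2.trans h4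
      rwa [show (2 : ℤ) * (k : ℤ) + 2 = 2 * ((k + 1 : ℕ) : ℤ) by push_cast; ring] at this

theorem permCls_inv_cls (hm : Even m) (hn : Even n) (f : Equiv.Perm (Edge m n))
    (hf : ∀ e, iota hm hn (f e) = f (iota hm hn e)) (e : Edge m n) :
    (permCls hm hn f hf)⁻¹ (cls hm hn e) = cls hm hn (f⁻¹ e) := by
  rw [Equiv.Perm.inv_eq_iff_eq, permCls_cls]
  simp

/-- The orbit of an edge, as a rectangle of the quotient surface. -/
def gcls (hm : Even m) (hn : Even n) (e : Edge m n) : (gridSys hm hn).I := cls hm hn e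

/-- On orbits `vtx` is the inverse of `C`: it turns clockwise. The cycle lengths are the same. -/
theorem C_gcls_vtx (hm : Even m) (hn : Even n) (e : Edge m n) :
    (gridSys hm hn).C (gcls hm hn (vtx e)) = gcls hm hn e := by
  change permCls hm hn north (iota_north hm hn) (permCls hm hn east (iota_east hm hn)
    ((permCls hm hn north (iota_north hm hn))⁻¹ ((permCls hm hn east (iota_east hm hn))⁻¹
      (cls hm hn (vtx e))))) = cls hm hn e
  rw [permCls_inv_cls, permCls_inv_cls, permCls_cls, permCls_cls]
  simp [vtx]

theorem C_pow_gcls (hm : Even m) (hn : Even n) (e : Edge m n) (k : ℕ) :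
    ((gridSys hm hn).C ^ k) (gcls hm hn ((vtx ^ k) e)) = gcls hm hn e := by
  induction k generalizing e with
  | zero => rfl
  | succ k ih =>
    rw [pow_succ (gridSys hm hn).C, pow_succ' vtx, Equiv.Perm.mul_apply, Equiv.Perm.mul_apply,
      C_gcls_vtx, ih]

open RectSystem

theorem mult_gcls_of_vtx {hm : Even m} {hn : Even n} {e : Edge m n} {N : ℕ}
    (h : ∀ k : ℕ, gcls hm hn ((vtx ^ k) e) = gcls hm hn e ↔ N ∣ k) :
    (gridSys hm hn).mult (gcls hm hn e) = N := by
  have key : ∀ k : ℕ, (gridSys hm hn).mult (gcls hm hn e) ∣ k ↔ N ∣ k := by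
    intro k
    rw [← h, ← Int.natCast_dvd_natCast, ← zpow_C_eq_iff, zpow_natCast]
    have := C_pow_gcls hm hn e k
    constructor
    · intro h1
      exact ((gridSys hm hn).C ^ k).injective (this.trans h1.symm)
    · intro h1
      rwa [h1] at this
  exact Nat.dvd_antisymm ((key N).2 dvd_rfl) ((key _).1 dvd_rfl)

/-- Closing up on the same diagonal forces `α = bt` and `β = at`, and then `2k = t(2gab - a - b)`.
If `a` and `b` are odd, every `t` satisfies the parity condition; otherwise exactly one of them is
even and `t` must be even. -/
theorem lattice_iff {g a b N : ℤ} (hg : 0 < g) (ha : 0 < a) (hab : IsCoprime a b)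
    (hN : (a % 2 = 1 ∧ b % 2 = 1) ∧ 2 * N = 2 * g * a * b - a - b ∨
      ¬ (a % 2 = 1 ∧ b % 2 = 1) ∧ N = 2 * g * a * b - a - b) (k : ℤ) :
    (∃ α β : ℤ, (α - β) % 2 = 0 ∧ β * (2 * g * b) = α * (2 * g * a) ∧
      α * (2 * g * a) - α - β = 2 * k) ↔ N ∣ k := by
  have hodd : ¬ (a % 2 = 0 ∧ b % 2 = 0) := by
    rintro ⟨h1, h2⟩
    have := hab.isUnit_of_dvd' (Int.dvd_of_emod_eq_zero h1) (Int.dvd_of_emod_eq_zero h2)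
    rw [Int.isUnit_iff] at this
    omega
  constructor
  · rintro ⟨α, β, h1, h2, h3⟩
    have h4 : β * b = α * a := by
      have : 2 * g * (β * b) = 2 * g * (α * a) := by linarith
      exact mul_left_cancel₀ (by positivity) this
    obtain ⟨t, rfl⟩ : a ∣ β := hab.dvd_of_dvd_mul_right ⟨α, by linarith⟩
    have h5 : α = b * t := by
      have : a * (b * t) = a * α := by linarith
      exact (mul_left_cancel₀ ha.ne' this).symm
    subst h5
    rcases hN with ⟨_, hN⟩ | ⟨hp, hN⟩
    · have : 2 * k = 2 * (N * t) := by linear_combination -h3 - t * hN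
      exact ⟨t, by linarith⟩
    · have hbt : Even ((b - a) * t) := Int.even_iff.2 (by rw [← h1]; congr 1; ring)
      obtain ⟨s, rfl⟩ := (Int.even_mul.1 hbt).resolve_left (by rw [Int.even_iff]; omega)
      have : 2 * k = 2 * (N * s) := by rw [← h3, hN]; ring
      exact ⟨s, by linarith⟩
  · rintro ⟨c, rfl⟩
    rcases hN with ⟨hp, hN⟩ | ⟨hp, hN⟩
    · refine ⟨b * c, a * c, ?_, by ring, by linear_combination (-c) * hN⟩
      obtain ⟨w, hw⟩ : ∃ w, b - a = 2 * w := ⟨(b - a) / 2, by omega⟩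
      rw [← sub_mul, hw, mul_assoc]
      exact Int.mul_emod_right _ _
    · refine ⟨b * (2 * c), a * (2 * c), ?_, by ring, by rw [hN]; ring⟩
      rw [← sub_mul, mul_left_comm]
      exact Int.mul_emod_right _ _

/-- The multiplicity of the vertices of the edges that unfold. -/
theorem Edge.Unfolds.mult_gcls (hm : Even m) (hn : Even n) (hmn : 6 ≤ m * n) {g a b N : ℕ}
    (hg : 0 < g) (ha : 0 < a) (hab : a.Coprime b) (hma : m = 2 * g * a)
    (hnb : n = 2 * g * b) (hN : (a % 2 = 1 ∧ b % 2 = 1) ∧ 2 * N + a + b = 2 * g * a * b ∨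
      ¬ (a % 2 = 1 ∧ b % 2 = 1) ∧ N + a + b = 2 * g * a * b) {e : Edge m n} {x y X Y : ℤ}
    (h : e.Unfolds x y X Y) : (gridSys hm hn).mult (gcls hm hn e) = N := by
  refine mult_gcls_of_vtx fun k => ?_
  obtain ⟨x', y', X', Y', h1, h2⟩ := h.vtx_pow hm hn k
  have hN' : ((a : ℤ) % 2 = 1 ∧ (b : ℤ) % 2 = 1) ∧ 2 * (N : ℤ) = 2 * g * a * b - a - b ∨
      ¬ ((a : ℤ) % 2 = 1 ∧ (b : ℤ) % 2 = 1) ∧ (N : ℤ) = 2 * g * a * b - a - b := by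
    refine hN.imp (fun h => ⟨by omega, ?_⟩) (fun h => ⟨by omega, ?_⟩)
    · have : (2 * N + a + b : ℤ) = 2 * g * a * b := by exact_mod_cast h.2
      linarith
    · have : (N + a + b : ℤ) = 2 * g * a * b := by exact_mod_cast h.2
      linarith
  rw [← Int.natCast_dvd_natCast, ← lattice_iff (g := g) (by exact_mod_cast hg)
    (by exact_mod_cast ha) (Nat.isCoprime_iff_coprime.2 hab) hN']
  have hma' : (m : ℤ) = 2 * g * a := by exact_mod_cast hma
  have hnb' : (n : ℤ) = 2 * g * b := by exact_mod_cast hnb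
  rw [← hma', ← hnb']
  -- The orbit recurs exactly if a lattice translation cancels the advance by `2k` along the
  -- diagonal.
  refine (h1.cls_eq_iff hm hn hmn h).trans ⟨fun h3 => ?_, ?_⟩
  · obtain ⟨α, β, k1, k2, k3⟩ := h2.trans h3
    exact ⟨-α, -β, by omega, by linarith, by linarith⟩
  · rintro ⟨α, β, k1, k2, k3⟩
    have h3 : LatEq m n x y X Y x y X Y (-(2 * k)) := ⟨α, β, k1, by linarith, by linarith⟩
    have h4 := h2.symm.trans h3.symm
    rwa [show -(2 * (k : ℤ)) + -(-(2 * (k : ℤ))) = 0 by ring] at h4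

theorem mult_gcls_eq_one (hm : Even m) (hn : Even n) {e : Edge m n}
    (h : ¬ ∃ x y X Y, e.Unfolds x y X Y) : (gridSys hm hn).mult (gcls hm hn e) = 1 := by
  refine mult_gcls_of_vtx fun k => ?_
  have h1 : (vtx ^ k) e = e :=
    Equiv.Perm.pow_apply_eq_self_of_apply_eq_self ((e.unfolds_or_vtx_eq hm hn).resolve_left h) k
  simp [h1]

end GridSurface
end

noncomputable section

namespace GridSurface

variable {m n : ℕ}

/-! ### Connectedness -/

/-- Turning a neighbour into another neighbour amounts to one or several applications of `next`,
since `next` skips only directions without a neighbour. -/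
theorem next_transitive {Q : ℤ × ℤ → Prop} {v u u' : ℤ × ℤ}
    (hQ : ∀ u, InGrid m n u → Q u → Q (next m n v u)) (hu : InGrid m n u) (hu' : InGrid m n u')
    (h : Q u) (h' : u' = u ∨ u' = turn v u ∨ u' = turn v (turn v u) ∨
      u' = turn v (turn v (turn v u))) : Q u' := by
  have h1 : ∀ u, InGrid m n u → InGrid m n (turn v u) → Q u → Q (turn v u) := by
    intro u k1 k2 k3
    have := hQ u k1 k3
    rwa [next, firstIn, if_pos k2] at this
  have h2 : ∀ u, InGrid m n u → InGrid m n (turn v (turn v u)) → Q u → Q (turn v (turn v u)) := by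
    intro u k1 k2 k3
    by_cases k4 : InGrid m n (turn v u)
    · exact h1 _ k4 k2 (h1 u k1 k4 k3)
    · have := hQ u k1 k3
      rwa [next, firstIn, if_neg k4, if_pos k2] at this
  rcases h' with rfl | rfl | rfl | rfl
  · exact h
  · exact h1 u hu hu' h
  · exact h2 u hu hu' h
  · by_cases k4 : InGrid m n (turn v u)
    · exact h2 _ k4 hu' (h1 u hu k4 h)
    · by_cases k5 : InGrid m n (turn v (turn v u))
      · exact h1 _ k5 hu' (h2 u hu k5 h)
      · have := hQ u hu h
        rwa [next, firstIn, if_neg k4, if_neg k5, if_pos hu'] at this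

theorem eq_turn_of_adj {v u u' : ℤ × ℤ}
    (h : u.1 = v.1 ∧ (u.2 = v.2 + 1 ∨ u.2 = v.2 - 1) ∨
      u.2 = v.2 ∧ (u.1 = v.1 + 1 ∨ u.1 = v.1 - 1))
    (h' : u'.1 = v.1 ∧ (u'.2 = v.2 + 1 ∨ u'.2 = v.2 - 1) ∨
      u'.2 = v.2 ∧ (u'.1 = v.1 + 1 ∨ u'.1 = v.1 - 1)) :
    u' = u ∨ u' = turn v u ∨ u' = turn v (turn v u) ∨ u' = turn v (turn v (turn v u)) := by
  unfold turn
  simp only [Prod.ext_iff]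
  split_ifs <;> simp only <;> omega

theorem of_east {Q : Edge m n → Prop} (hQ : ∀ e, Q e ↔ Q (east e)) {e e' : Edge m n}
    (h : e.a = e'.a) (he : Q e) : Q e' := by
  refine next_transitive (m := m) (n := n) (v := e.a)
    (Q := fun w => ∀ f : Edge m n, f.a = e.a → f.b = w → Q f) (u := e.b) (u' := e'.b)
    ?_ e.b_mem e'.b_mem ?_ ?_ e' h.symm rfl
  · intro u hu hQu f hfa hfb
    have h2 : Q (east.symm f) := by
      refine hQu _ hfa ?_
      change prev m n f.a f.b = u
      rw [hfa, hfb]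
      exact firstIn_firstIn _ _ _ (turnBack_turn e.a) (turn_four e.a) _ hu
    rwa [hQ, Equiv.apply_symm_apply] at h2
  · intro f h1 h2
    rwa [Edge.ext h1 h2]
  · have h1 := e.coords.2.2.2.2
    have h2 := e'.coords.2.2.2.2
    rw [← h] at h2
    exact eq_turn_of_adj h1 h2

theorem of_north {Q : Edge m n → Prop} (hQ : ∀ e, Q e ↔ Q (north e)) {e e' : Edge m n}
    (h : e.b = e'.b) (he : Q e) : Q e' := by
  refine next_transitive (m := m) (n := n) (v := e.b)
    (Q := fun w => ∀ f : Edge m n, f.b = e.b → f.a = w → Q f) (u := e.a) (u' := e'.a)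
    ?_ e.a_mem e'.a_mem ?_ ?_ e' h.symm rfl
  · intro u hu hQu f hfa hfb
    have h2 : Q (north.symm f) := by
      refine hQu _ hfa ?_
      change prev m n f.b f.a = u
      rw [hfa, hfb]
      exact firstIn_firstIn _ _ _ (turnBack_turn e.b) (turn_four e.b) _ hu
    rwa [hQ, Equiv.apply_symm_apply] at h2
  · intro f h1 h2
    rwa [Edge.ext h2 h1]
  · have h1 := e.coords.2.2.2.2
    have h2 := e'.coords.2.2.2.2
    rw [← h] at h2
    exact eq_turn_of_adj (by omega) (by omega)

theorem exists_edge {v w : ℤ × ℤ} (hv : InGrid m n v) (hw : InGrid m n w) (h : Adj v w) :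
    ∃ e : Edge m n, (e.a = v ∧ e.b = w) ∨ (e.a = w ∧ e.b = v) := by
  by_cases hA : IsA v
  · exact ⟨⟨v, w, hv, hw, hA, hA.isB_of_adj h, h⟩, Or.inl ⟨rfl, rfl⟩⟩
  · have hB : IsB v := Int.not_even_iff_odd.1 hA
    exact ⟨⟨w, v, hw, hv, hB.isA_of_adj h, hB, h.symm⟩, Or.inr ⟨rfl, rfl⟩⟩

/-- Stability under `east` and `north` spreads `Q` to all edges at a vertex, hence along the edges
of the grid. Every vertex is joined to `(1, 1)` by decreasing coordinates. -/
theorem edge_transitive {Q : Edge m n → Prop} (hr : ∀ e, Q e ↔ Q (east e))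
    (hu : ∀ e, Q e ↔ Q (north e)) (e e' : Edge m n) (he : Q e) : Q e' := by
  let R : ℤ × ℤ → Prop := fun v => ∀ e : Edge m n, (e.a = v ∨ e.b = v) → Q e
  have hRa : ∀ e : Edge m n, Q e → R e.a := by
    rintro e he f (hf | hf)
    · exact of_east hr hf.symm he
    · have h1 := f.b_isB
      rw [hf] at h1
      exact absurd e.a_isA (Int.not_even_iff_odd.2 h1)
  have hRb : ∀ e : Edge m n, Q e → R e.b := by
    rintro e he f (hf | hf)
    · have h1 := f.a_isA
      rw [hf] at h1
      exact absurd h1 (Int.not_even_iff_odd.2 e.b_isB)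
    · exact of_north hu hf.symm he
  have hadj : ∀ v w, InGrid m n v → InGrid m n w → Adj v w → R v → R w := by
    intro v w hv hw h hR
    obtain ⟨f, ⟨h1, h2⟩ | ⟨h1, h2⟩⟩ := exists_edge hv hw h
    · exact h2 ▸ hRb f (hR f (Or.inl h1))
    · exact h1 ▸ hRa f (hR f (Or.inr h2))
  have key : ∀ (k : ℕ) (i j : ℤ), i + j = k + 2 → InGrid m n (i, j) → (R (i, j) ↔ R (1, 1)) := by
    intro k
    induction k with
    | zero =>
      rintro i j h ⟨h1, -, h2, -⟩
      simp only at h1 h2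
      obtain rfl : i = 1 := by omega
      obtain rfl : j = 1 := by omega
      rfl
    | succ k ih =>
      rintro i j h ⟨h1, h2, h3, h4⟩
      simp only at h1 h2 h3 h4
      by_cases hi : 1 < i
      · have hg : InGrid m n (i - 1, j) := ⟨by simp only; omega, by simp only; omega, h3, h4⟩
        have ha : Adj (i, j) (i - 1, j) := by simp [Adj]
        rw [← ih (i - 1) j (by push_cast at h; omega) hg]
        exact ⟨hadj _ _ ⟨h1, h2, h3, h4⟩ hg ha, hadj _ _ hg ⟨h1, h2, h3, h4⟩ ha.symm⟩
      · have hg : InGrid m n (i, j - 1) :=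
          ⟨h1, h2, by simp only; push_cast at h; omega, by simp only; omega⟩
        have ha : Adj (i, j) (i, j - 1) := by simp [Adj]
        rw [← ih i (j - 1) (by push_cast at h; omega) hg]
        exact ⟨hadj _ _ ⟨h1, h2, h3, h4⟩ hg ha, hadj _ _ hg ⟨h1, h2, h3, h4⟩ ha.symm⟩
  have hall : ∀ e : Edge m n, R e.a ↔ R (1, 1) := by
    intro e
    obtain ⟨h1, -, h2, -⟩ := e.a_mem
    exact key (e.a.1 + e.a.2 - 2).toNat e.a.1 e.a.2 (by omega) e.a_mem
  exact (hall e').2 ((hall e).1 (hRa e he)) e' (Or.inl rfl)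

theorem two_le_of_even (hm : Even m) (hn : Even n) (hmn : 6 ≤ m * n) :
    2 ≤ m ∧ 2 ≤ n ∧ (4 ≤ m ∨ 4 ≤ n) := by
  obtain ⟨p, rfl⟩ := hm
  obtain ⟨q, rfl⟩ := hn
  have hp : p ≠ 0 := by rintro rfl; omega
  have hq : q ≠ 0 := by rintro rfl; omega
  refine ⟨by omega, by omega, ?_⟩
  by_contra h
  obtain rfl : p = 1 := by omega
  obtain rfl : q = 1 := by omega
  omega

theorem isTranslationSurface_projXe (hm : Even m) (hn : Even n) (hmn : 6 ≤ m * n) :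
    IsTranslationSurface (projXe hm hn) := by
  have hS := isSurface_qXe hm hn
  obtain ⟨h2m, h2n, h4⟩ := two_le_of_even hm hn hmn
  have hne : Nonempty (gridSys hm hn).I := by
    have : Nonempty (Edge m n) := by
      rcases h4 with h4 | h4
      · obtain ⟨e, -⟩ := exists_edge (m := m) (n := n) (v := (1, 1)) (w := (2, 1))
          (by refine ⟨?_, ?_, ?_, ?_⟩ <;> simp only <;> omega)
          (by refine ⟨?_, ?_, ?_, ?_⟩ <;> simp only <;> omega) (by simp [Adj])
        exact ⟨e⟩
      · obtain ⟨e, -⟩ := exists_edge (m := m) (n := n) (v := (1, 1)) (w := (1, 2))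
          (by refine ⟨?_, ?_, ?_, ?_⟩ <;> simp only <;> omega)
          (by refine ⟨?_, ?_, ?_, ?_⟩ <;> simp only <;> omega) (by simp [Adj])
        exact ⟨e⟩
    exact this.map (gcls hm hn)
  refine ⟨hS.compactSpace, hS.connectedSpace ?_, hS.t2Space, fun x => ?_⟩
  · intro P hr hu i j hi
    obtain ⟨e, rfl⟩ := Quotient.exists_rep i
    obtain ⟨e', rfl⟩ := Quotient.exists_rep j
    exact edge_transitive (Q := fun e => P (gcls hm hn e)) (fun e => hr _) (fun e => hu _) e e' hi
  · rcases eq_vertex_or_hasOrder_zero hm hn x with ⟨i, rfl⟩ | h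
    · exact ⟨_, hasOrder_vertex hm hn i⟩
    · exact ⟨0, h⟩

end GridSurface
end

noncomputable section

namespace GridSurface

variable {m n : ℕ}

/-! ### Counting the edges that unfold -/

theorem Edge.exists_unfolds_iff (e : Edge m n) : (∃ x y X Y, e.Unfolds x y X Y) ↔
    e.a.1 = e.b.1 ∨ (e.a.2 = n - 1 ∧ e.b.2 = n - 1 ∧ e.a.1 = e.b.1 + 1 ∧ e.b.1 % 2 = 0) ∨
      (e.a.2 = 1 ∧ e.b.2 = 1 ∧ e.b.1 = e.a.1 + 1 ∧ e.a.1 % 2 = 1) := by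
  constructor
  · rintro ⟨x, y, X, Y, h⟩
    cases h <;> omega
  · obtain ⟨-, -, -, -, h⟩ := e.coords
    rintro (h1 | ⟨h1, h2, h3, h4⟩ | ⟨h1, h2, h3, h4⟩)
    · rcases Int.emod_two_eq_zero_or_one e.a.1 with h2 | h2
      · rcases h with ⟨-, h' | h'⟩ | h'
        · exact ⟨_, _, _, _, .evenA h1 h' h2⟩
        · exact ⟨_, _, _, _, .evenB h1 (by omega) h2⟩
        · omega
      · rcases h with ⟨-, h' | h'⟩ | h'
        · exact ⟨_, _, _, _, .oddA h1 h' h2⟩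
        · exact ⟨_, _, _, _, .oddB h1 (by omega) h2⟩
        · omega
    · exact ⟨_, _, _, _, .top h1 h2 h3 h4⟩
    · exact ⟨_, _, _, _, .bot h1 h2 h3 h4⟩

/-- The orbits of the edges that unfold. -/
def active (hm : Even m) (hn : Even n) : Set (gridSys hm hn).I :=
  gcls hm hn '' {e | ∃ x y X Y, e.Unfolds x y X Y}

theorem mult_of_notMem_active (hm : Even m) (hn : Even n) (i : (gridSys hm hn).I)
    (hi : i ∉ active hm hn) : (gridSys hm hn).mult i = 1 := by
  obtain ⟨e, rfl⟩ := Quotient.exists_rep i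
  exact mult_gcls_eq_one hm hn fun h => hi ⟨e, h, rfl⟩

/-- The edges that unfold, one from each orbit: the vertical ones of the lower half, and those of
the bottom row. -/
def lowerHalf (m n : ℕ) : Set (Edge m n) :=
  {e | e.a.1 = e.b.1 ∧ e.a.2 + e.b.2 < n ∨
    e.a.2 = 1 ∧ e.b.2 = 1 ∧ e.b.1 = e.a.1 + 1 ∧ e.a.1 % 2 = 1}

/-- The involution exchanges the lower and the upper half of the vertical edges, and the selected
edges of the bottom row with those of the top row. -/
theorem active_eq (hm : Even m) (hn : Even n) : active hm hn = gcls hm hn '' lowerHalf m n := by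
  have hm' := Nat.even_iff.1 hm
  have hn' := Nat.even_iff.1 hn
  apply Set.Subset.antisymm
  · rintro _ ⟨e, he, rfl⟩
    rw [Set.mem_ofPred_eq, Edge.exists_unfolds_iff] at he
    by_cases h : e ∈ lowerHalf m n
    · exact ⟨e, h, rfl⟩
    · refine ⟨iota hm hn e, ?_, cls_iota hm hn e⟩
      obtain ⟨-, -, -, -, h5⟩ := e.coords
      change ¬ (_ ∧ _ ∨ _) at h
      change (m : ℤ) - e.a.1 = m - e.b.1 ∧ (n : ℤ) - e.a.2 + (n - e.b.2) < n ∨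
        (n : ℤ) - e.a.2 = 1 ∧ (n : ℤ) - e.b.2 = 1 ∧ (m : ℤ) - e.b.1 = m - e.a.1 + 1 ∧
          ((m : ℤ) - e.a.1) % 2 = 1
      omega
  · rintro _ ⟨e, he, rfl⟩
    refine ⟨e, ?_, rfl⟩
    rw [Set.mem_ofPred_eq, Edge.exists_unfolds_iff]
    change _ ∧ _ ∨ _ at he
    omega

theorem injOn_gcls (hm : Even m) (hn : Even n) : Set.InjOn (gcls hm hn) (lowerHalf m n) := by
  intro e he e' he' h
  rcases (cls_eq hm hn).1 h with h | h
  · exact h.symm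
  · exfalso
    have k1 : e'.a.1 = m - e.a.1 := congrArg (fun e : Edge m n => e.a.1) h
    have k2 : e'.a.2 = n - e.a.2 := congrArg (fun e : Edge m n => e.a.2) h
    have k3 : e'.b.1 = m - e.b.1 := congrArg (fun e : Edge m n => e.b.1) h
    have k4 : e'.b.2 = n - e.b.2 := congrArg (fun e : Edge m n => e.b.2) h
    clear h
    change _ ∧ _ ∨ _ at he he'
    omega

/-- Twice the midpoint of an edge. -/
def Edge.mid (e : Edge m n) : ℤ × ℤ := (e.a.1 + e.b.1, e.a.2 + e.b.2)

/-- The midpoint gives the two endpoints, and their parities tell which one belongs to `𝒜`. -/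
theorem Edge.mid_injective : Function.Injective (Edge.mid : Edge m n → ℤ × ℤ) := by
  intro e e' h
  have h1 : e.a.1 + e.b.1 = e'.a.1 + e'.b.1 := congrArg Prod.fst h
  have h2 : e.a.2 + e.b.2 = e'.a.2 + e'.b.2 := congrArg Prod.snd h
  clear h
  obtain ⟨-, -, h3, h4, h5⟩ := e.coords
  obtain ⟨-, -, h3', h4', h5'⟩ := e'.coords
  refine Edge.ext (Prod.ext ?_ ?_) (Prod.ext ?_ ?_) <;> omega

theorem mid_image_lowerHalf {p q : ℕ} (hm : m = 2 * p) (hn : n = 2 * q) (hq : 0 < q) :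
    Edge.mid '' lowerHalf m n =
      (((Finset.Ioo (0 : ℤ) m ×ˢ Finset.Ioo (0 : ℤ) q).image fun v => (2 * v.1, 2 * v.2 + 1)) ∪
        (Finset.Ioo (0 : ℤ) p).image fun s => (4 * s - 1, 2) : Finset (ℤ × ℤ)) := by
  ext ⟨x, y⟩
  simp only [Set.mem_image, Finset.coe_union, Finset.coe_image, Set.mem_union, Finset.mem_coe,
    Finset.mem_product, Finset.mem_Ioo, Prod.mk.injEq, Prod.exists]
  constructor
  · rintro ⟨e, he, h⟩
    have hx : e.a.1 + e.b.1 = x := congrArg Prod.fst h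
    have hy : e.a.2 + e.b.2 = y := congrArg Prod.snd h
    clear h
    obtain ⟨h1, h2, h3, h4, h5⟩ := e.coords
    change _ ∧ _ ∨ _ at he
    rcases he with he | he
    · exact Or.inl ⟨e.a.1, (y - 1) / 2, by omega, by omega, by omega⟩
    · exact Or.inr ⟨(e.a.1 + 1) / 2, by omega, by omega, by omega⟩
  · rintro (⟨i, j, ⟨⟨h1, h2⟩, h3, h4⟩, rfl, rfl⟩ | ⟨s, ⟨h1, h2⟩, rfl, rfl⟩)
    · obtain ⟨e, he⟩ := exists_edge (m := m) (n := n) (v := (i, j)) (w := (i, j + 1))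
        (by refine ⟨?_, ?_, ?_, ?_⟩ <;> simp only <;> omega)
        (by refine ⟨?_, ?_, ?_, ?_⟩ <;> simp only <;> omega) (by simp [Adj])
      refine ⟨e, Or.inl ?_, ?_⟩
      · rcases he with ⟨e1, e2⟩ | ⟨e1, e2⟩ <;> rw [e1, e2] <;>
          exact ⟨rfl, by simp only; omega⟩
      · unfold Edge.mid
        rcases he with ⟨e1, e2⟩ | ⟨e1, e2⟩ <;> rw [e1, e2] <;> simp only [Prod.mk.injEq] <;> omega
    · have hA : IsA (2 * s - 1, 1) := ⟨s, by simp only; ring⟩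
      have hadj : Adj (2 * s - 1, 1) (2 * s, 1) := by simp [Adj]
      refine ⟨⟨(2 * s - 1, 1), (2 * s, 1), ?_, ?_, hA, hA.isB_of_adj hadj, hadj⟩, Or.inr ?_, ?_⟩
      · refine ⟨?_, ?_, ?_, ?_⟩ <;> simp only <;> omega
      · refine ⟨?_, ?_, ?_, ?_⟩ <;> simp only <;> omega
      · exact ⟨rfl, rfl, by simp only; omega, by simp only; omega⟩
      · simp only [Edge.mid, Prod.mk.injEq]
        omega

/-- There are `(2p - 1)(q - 1)` vertical edges in the lower half and `p - 1` selected edges in the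
bottom row. -/
theorem ncard_active (hm : Even m) (hn : Even n) {p q : ℕ} (hp : m = 2 * p) (hq : n = 2 * q)
    (hp0 : 0 < p) (hq0 : 0 < q) : (active hm hn).ncard + p + q = 2 * p * q := by
  rw [active_eq, (injOn_gcls hm hn).ncard_image,
    ← Set.ncard_image_of_injective _ Edge.mid_injective, mid_image_lowerHalf hp hq hq0, Set.ncard_coe_finset, Finset.card_union_of_disjoint,
    Finset.card_image_of_injective, Finset.card_image_of_injective, Finset.card_product,
    Int.card_Ioo, Int.card_Ioo, Int.card_Ioo]
  · obtain ⟨p, rfl⟩ : ∃ p', p = p' + 1 := ⟨p - 1, by omega⟩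
    obtain ⟨q, rfl⟩ : ∃ q', q = q' + 1 := ⟨q - 1, by omega⟩
    have e1 : ((m : ℤ) - 0 - 1).toNat = 2 * p + 1 := by omega
    have e2 : (((q + 1 : ℕ) : ℤ) - 0 - 1).toNat = q := by omega
    have e3 : (((p + 1 : ℕ) : ℤ) - 0 - 1).toNat = p := by omega
    rw [e1, e2, e3]
    ring
  · intro s t h
    simp only [Prod.mk.injEq] at h
    omega
  · rintro ⟨a, b⟩ ⟨c, d⟩ h
    simp only [Prod.mk.injEq] at h ⊢
    omega
  · rw [Finset.disjoint_left]
    rintro ⟨x, y⟩ h1 h2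
    simp only [Finset.mem_image, Prod.mk.injEq, Prod.exists] at h1 h2
    obtain ⟨i, j, -, -, h1⟩ := h1
    obtain ⟨s, -, -, h2⟩ := h2
    omega

end GridSurface
end

noncomputable section

namespace GridSurface

variable {m n : ℕ}

/-! ### The tori -/

open RectSystem

theorem isTorus_of_subsingleton {D : RectSystem} {S : Type} [TopologicalSpace S] {q : D.Pt → S}
    (hS : IsSurface q) (i₀ : D.I) (h : ∀ i, i = i₀) : IsTorus S := by
  refine hS.isTorus (D.w_pos i₀) (D.h_pos i₀) (fun _ => 0) (fun _ => 0) (fun i => ⟨-1, ?_⟩)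
    (fun _ => rfl) (fun i => ⟨-1, ?_⟩) (fun _ => rfl) (fun i => ?_) (fun i => ?_) ?_ ?_
  · rw [h i]; push_cast; ring
  · rw [h i]; push_cast; ring
  · rw [h i, zero_add]; exact ⟨le_rfl, le_rfl⟩
  · rw [h i, zero_add]; exact ⟨le_rfl, le_rfl⟩
  · intro x y h1 h2 h3 h4
    exact ⟨i₀, by simp [*], by simp [*]⟩
  · intro i j _ _ _ _
    rw [h i, h j]

/-- The grid has two edges, exchanged by `ι`, so the surface is one rectangle with opposite sides
glued. -/
theorem isTorus_two_four (hm : Even m) (hn : Even n) (h : m = 2 ∧ n = 4 ∨ m = 4 ∧ n = 2) :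
    IsTorus (Xe m n hm hn) := by
  obtain ⟨e₀⟩ : Nonempty (Edge m n) := by
    rcases h with ⟨rfl, rfl⟩ | ⟨rfl, rfl⟩
    · obtain ⟨e, -⟩ := exists_edge (m := 2) (n := 4) (v := (1, 1)) (w := (1, 2))
        (by simp [InGrid]) (by simp [InGrid]) (by simp [Adj])
      exact ⟨e⟩
    · obtain ⟨e, -⟩ := exists_edge (m := 4) (n := 2) (v := (1, 1)) (w := (2, 1))
        (by simp [InGrid]) (by simp [InGrid]) (by simp [Adj])
      exact ⟨e⟩
  refine isTorus_of_subsingleton (isSurface_qXe hm hn) (gcls hm hn e₀) fun i => ?_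
  obtain ⟨e, rfl⟩ := Quotient.exists_rep i
  refine (cls_eq hm hn).2 ?_
  obtain ⟨h1, h2, h3, h4, h5⟩ := e.coords
  obtain ⟨h1', h2', h3', h4', h5'⟩ := e₀.coords
  by_cases hc : e₀.a.1 = e.a.1 ∧ e₀.a.2 = e.a.2
  · refine Or.inl (Edge.ext (Prod.ext hc.1 hc.2) (Prod.ext ?_ ?_)) <;> omega
  · refine Or.inr (Edge.ext (Prod.ext ?_ ?_) (Prod.ext ?_ ?_)) <;> simp only [iota, flipV] <;> omega

theorem sin_four {i : ℤ} (h : 0 < i ∧ i < 4) :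
    Real.sin (i * Real.pi / (4 : ℕ)) = if i = 2 then 1 else √2 / 2 := by
  have h' : i = 1 ∨ i = 2 ∨ i = 3 := by omega
  rcases h' with rfl | rfl | rfl
  · norm_num
  · norm_num
    rw [show 2 * Real.pi / 4 = Real.pi / 2 by ring, Real.sin_pi_div_two]
  · norm_num
    rw [show 3 * Real.pi / 4 = Real.pi - Real.pi / 4 by ring, Real.sin_pi_sub, Real.sin_pi_div_four]

/-- A `ℬ`-vertex has exactly one coordinate `2`, an `𝒜`-vertex both or none. So the six rectangles
tile a torus of size `√2 × 2` in two equal columns and in rows of heights `1/2`, `1`, `1/2`. -/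
theorem width_four (e : Edge 4 4) : width e = √2 / 2 := by
  obtain ⟨h1, h2, h3, h4, h5⟩ := e.coords
  unfold width weight
  rw [sin_four ⟨h2.1, h2.2.1⟩, sin_four ⟨h2.2.2.1, h2.2.2.2⟩]
  by_cases h : e.b.1 = 2
  · rw [if_pos h, if_neg (by omega), one_mul]
  · rw [if_neg h, if_pos (by omega), mul_one]

theorem height_four (e : Edge 4 4) : height e = if e.a.1 = 2 then 1 else 1 / 2 := by
  obtain ⟨h1, h2, h3, h4, h5⟩ := e.coords
  unfold height weight
  rw [sin_four ⟨h1.1, h1.2.1⟩, sin_four ⟨h1.2.2.1, h1.2.2.2⟩]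
  by_cases h : e.a.1 = 2
  · rw [if_pos h, if_pos (by omega), if_pos h, one_mul]
  · rw [if_neg h, if_neg (by omega), if_neg h, div_mul_div_comm, Real.mul_self_sqrt (by norm_num)]
    norm_num

/-- The left side of a rectangle in the torus. -/
def left₄ (e : Edge 4 4) : ℝ := if e.b.1 = 2 then √2 / 2 else 0

/-- The bottom side of a rectangle in the torus. -/
def bottom₄ (e : Edge 4 4) : ℝ := if e.a.1 = 2 then 1 / 2 else if e.a.1 = e.a.2 then 0 else 3 / 2

theorem east_four (e : Edge 4 4) : (east e).b.1 = 2 ↔ ¬ e.b.1 = 2 := by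
  obtain ⟨h1, h2, h3, h4, h5⟩ := e.coords
  obtain ⟨h1', h2', h3', h4', h5'⟩ := (east e).coords
  have h : NextStep 4 4 e.a.1 e.a.2 e.b.1 e.b.2 (east e).b.1 (east e).b.2 :=
    nextStep e.a_mem e.b_mem
  rcases Int.emod_two_eq_zero_or_one e.a.1 with hp | hp
  · replace h := h.1 hp
    rcases h5 with ⟨_, h5 | h5⟩ | ⟨_, h5 | h5⟩
    all_goals
      first
        | replace h := h.1 (by omega) (by omega)
        | replace h := h.2.1 (by omega) (by omega)
        | replace h := h.2.2.1 (by omega) (by omega)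
        | replace h := h.2.2.2 (by omega) (by omega)
      omega
  · replace h := h.2 hp
    rcases h5 with ⟨_, h5 | h5⟩ | ⟨_, h5 | h5⟩
    all_goals
      first
        | replace h := h.1 (by omega) (by omega)
        | replace h := h.2.1 (by omega) (by omega)
        | replace h := h.2.2.1 (by omega) (by omega)
        | replace h := h.2.2.2 (by omega) (by omega)
      omega

/-- The rows are permuted cyclically: bottom, middle, top. -/
theorem north_four (e : Edge 4 4) :
    (e.a.1 = 2 → ¬ (north e).a.1 = 2 ∧ ¬ (north e).a.1 = (north e).a.2) ∧
    (¬ e.a.1 = 2 → e.a.1 = e.a.2 → (north e).a.1 = 2) ∧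
    (¬ e.a.1 = 2 → ¬ e.a.1 = e.a.2 → ¬ (north e).a.1 = 2 ∧ (north e).a.1 = (north e).a.2) := by
  obtain ⟨h1, h2, h3, h4, h5⟩ := e.coords
  obtain ⟨h1', h2', h3', h4', h5'⟩ := (north e).coords
  have h : NextStep 4 4 e.b.1 e.b.2 e.a.1 e.a.2 (north e).a.1 (north e).a.2 :=
    nextStep e.b_mem e.a_mem
  have hb : (north e).b = e.b := rfl
  rw [hb] at h2' h4' h5'
  rcases Int.emod_two_eq_zero_or_one e.b.1 with hp | hp
  · replace h := h.1 hp
    rcases h5 with ⟨_, h5 | h5⟩ | ⟨_, h5 | h5⟩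
    all_goals
      first
        | replace h := h.1 (by omega) (by omega)
        | replace h := h.2.1 (by omega) (by omega)
        | replace h := h.2.2.1 (by omega) (by omega)
        | replace h := h.2.2.2 (by omega) (by omega)
      refine ⟨?_, ?_, ?_⟩ <;> omega
  · replace h := h.2 hp
    rcases h5 with ⟨_, h5 | h5⟩ | ⟨_, h5 | h5⟩
    all_goals
      first
        | replace h := h.1 (by omega) (by omega)
        | replace h := h.2.1 (by omega) (by omega)
        | replace h := h.2.2.1 (by omega) (by omega)
        | replace h := h.2.2.2 (by omega) (by omega)
      refine ⟨?_, ?_, ?_⟩ <;> omega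

theorem left₄_east (e : Edge 4 4) : ∃ k : ℤ, left₄ (east e) = left₄ e + width e + k * √2 := by
  rw [width_four]
  unfold left₄
  by_cases h : e.b.1 = 2
  · rw [if_pos h, if_neg (fun h' => (east_four e).1 h' h)]
    exact ⟨-1, by push_cast; ring⟩
  · rw [if_neg h, if_pos ((east_four e).2 h)]
    exact ⟨0, by push_cast; ring⟩

theorem bottom₄_north (e : Edge 4 4) :
    ∃ k : ℤ, bottom₄ (north e) = bottom₄ e + height e + k * 2 := by
  rw [height_four]
  obtain ⟨h1, h2, h3⟩ := north_four e
  unfold bottom₄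
  by_cases ha : e.a.1 = 2
  · rw [if_pos ha, if_pos ha, if_neg (h1 ha).1, if_neg (h1 ha).2]
    exact ⟨0, by norm_num⟩
  · by_cases hb : e.a.1 = e.a.2
    · rw [if_neg ha, if_neg ha, if_pos hb, if_pos (h2 ha hb)]
      exact ⟨0, by norm_num⟩
    · rw [if_neg ha, if_neg ha, if_neg hb, if_neg (h3 ha hb).1, if_pos (h3 ha hb).2]
      exact ⟨-1, by norm_num⟩

theorem exists_edge_four (x y : ℝ) (hx : 0 ≤ x) (hx' : x < √2) (hy : 0 ≤ y) (hy' : y < 2) :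
    ∃ e : Edge 4 4, (left₄ e ≤ x ∧ x < left₄ e + width e) ∧
      (bottom₄ e ≤ y ∧ y < bottom₄ e + height e) := by
  have hB : ∀ (v w : ℤ × ℤ) (hv : InGrid 4 4 v) (hw : InGrid 4 4 w) (hA : IsA v) (h : Adj v w)
      (hx : (if w.1 = 2 then √2 / 2 else 0) ≤ x ∧ x < (if w.1 = 2 then √2 / 2 else 0) + √2 / 2)
      (hy : (if v.1 = 2 then 1 / 2 else if v.1 = v.2 then 0 else 3 / 2) ≤ y ∧
        y < (if v.1 = 2 then 1 / 2 else if v.1 = v.2 then 0 else 3 / 2) +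
          if v.1 = 2 then 1 else 1 / 2),
      ∃ e : Edge 4 4, (left₄ e ≤ x ∧ x < left₄ e + width e) ∧
      (bottom₄ e ≤ y ∧ y < bottom₄ e + height e) := by
    intro v w hv hw hA h hx hy
    refine ⟨⟨v, w, hv, hw, hA, hA.isB_of_adj h, h⟩, ?_, ?_⟩
    · rwa [width_four]
    · rwa [height_four]
  have hA1 : IsA (1, 1) := ⟨1, rfl⟩
  have hA2 : IsA (2, 2) := ⟨2, rfl⟩
  have hA3 : IsA (1, 3) := ⟨2, rfl⟩
  rcases lt_or_ge x (√2 / 2) with h1 | h1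
  · rcases lt_or_ge y (1 / 2) with h2 | h2
    · exact hB (1, 1) (1, 2) (by simp [InGrid]) (by simp [InGrid]) hA1 (by simp [Adj])
        (by norm_num; exact ⟨hx, h1⟩) (by norm_num; exact ⟨hy, by linarith⟩)
    · rcases lt_or_ge y (3 / 2) with h3 | h3
      · exact hB (2, 2) (1, 2) (by simp [InGrid]) (by simp [InGrid]) hA2 (by simp [Adj])
          (by norm_num; exact ⟨hx, h1⟩) (by norm_num; exact ⟨by linarith, by linarith⟩)
      · exact hB (1, 3) (1, 2) (by simp [InGrid]) (by simp [InGrid]) hA3 (by simp [Adj])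
          (by norm_num; exact ⟨hx, h1⟩) (by norm_num; exact ⟨by linarith, by linarith⟩)
  · rcases lt_or_ge y (1 / 2) with h2 | h2
    · exact hB (1, 1) (2, 1) (by simp [InGrid]) (by simp [InGrid]) hA1 (by simp [Adj])
        (by norm_num; exact ⟨h1, hx'⟩) (by norm_num; exact ⟨hy, by linarith⟩)
    · rcases lt_or_ge y (3 / 2) with h3 | h3
      · exact hB (2, 2) (2, 1) (by simp [InGrid]) (by simp [InGrid]) hA2 (by simp [Adj])
          (by norm_num; exact ⟨h1, hx'⟩) (by norm_num; exact ⟨by linarith, by linarith⟩)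
      · exact hB (1, 3) (2, 3) (by simp [InGrid]) (by simp [InGrid]) hA3 (by simp [Adj])
          (by norm_num; exact ⟨h1, hx'⟩) (by norm_num; exact ⟨by linarith, by linarith⟩)

/-- The row and the column of a rectangle determine both endpoints up to the involution, and
adjacency makes the two choices agree. -/
theorem eq_or_eq_iota_of_four (h4 : Even 4) {e e' : Edge 4 4} {x y : ℝ}
    (h : (left₄ e ≤ x ∧ x < left₄ e + width e) ∧ (bottom₄ e ≤ y ∧ y < bottom₄ e + height e))
    (h' : (left₄ e' ≤ x ∧ x < left₄ e' + width e') ∧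
      (bottom₄ e' ≤ y ∧ y < bottom₄ e' + height e')) : e' = e ∨ e' = iota h4 h4 e := by
  have hs : 0 < √2 := by positivity
  rw [width_four, height_four] at h h'
  unfold left₄ bottom₄ at h h'
  have k1 : e.b.1 = 2 ↔ e'.b.1 = 2 := by
    by_cases c1 : e.b.1 = 2 <;> by_cases c2 : e'.b.1 = 2 <;>
      simp only [c1, c2, if_true, if_false] at h h' ⊢ <;> linarith
  have k2 : (e.a.1 = 2 ↔ e'.a.1 = 2) ∧ (¬ e.a.1 = 2 → (e.a.1 = e.a.2 ↔ e'.a.1 = e'.a.2)) := by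
    by_cases c1 : e.a.1 = 2 <;> by_cases c2 : e'.a.1 = 2 <;>
      simp only [c1, c2, if_true, if_false] at h h' ⊢
    · simp
    · exfalso
      split_ifs at h' <;> linarith
    · exfalso
      split_ifs at h <;> linarith
    · refine ⟨trivial, fun _ => ?_⟩
      by_cases c3 : e.a.1 = e.a.2 <;> by_cases c4 : e'.a.1 = e'.a.2 <;>
        simp only [c3, c4, if_true, if_false] at h h' ⊢ <;> linarith
  clear h h'
  obtain ⟨h1, h2, h3, h4, h5⟩ := e.coords
  obtain ⟨h1', h2', h3', h4', h5'⟩ := e'.coords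
  have ha : e'.a.1 = e.a.1 ∧ e'.a.2 = e.a.2 ∨ e'.a.1 = 4 - e.a.1 ∧ e'.a.2 = 4 - e.a.2 := by
    clear h5 h5' h4 h4' h2 h2' k1
    by_cases c : e.a.1 = 2
    · have := k2.1.1 c
      omega
    · have := mt k2.1.2 c
      have := k2.2 c
      by_cases c' : e.a.1 = e.a.2 <;> omega
  have hb : e'.b.1 = e.b.1 ∧ e'.b.2 = e.b.2 ∨ e'.b.1 = 4 - e.b.1 ∧ e'.b.2 = 4 - e.b.2 := by
    clear h5 h5' h3 h3' h1 h1' k2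
    by_cases c : e.b.1 = 2
    · have := k1.1 c
      omega
    · have := mt k1.2 c
      omega
  clear k1 k2
  by_cases hc : e'.a.1 = e.a.1 ∧ e'.a.2 = e.a.2 ∧ e'.b.1 = e.b.1 ∧ e'.b.2 = e.b.2
  · exact Or.inl (Edge.ext (Prod.ext hc.1 hc.2.1) (Prod.ext hc.2.2.1 hc.2.2.2))
  · refine Or.inr (Edge.ext (Prod.ext ?_ ?_) (Prod.ext ?_ ?_)) <;> simp only [iota, flipV] <;>
      rcases ha with ha | ha <;> rcases hb with hb | hb <;> omega

theorem isTorus_four_four (h4 : Even 4) : IsTorus (Xe 4 4 h4 h4) := by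
  have hinv : ∀ e : Edge 4 4, left₄ (iota h4 h4 e) = left₄ e ∧
      bottom₄ (iota h4 h4 e) = bottom₄ e := by
    intro e
    unfold left₄ bottom₄ iota flipV
    have e1 : ((4 : ℕ) : ℤ) - e.b.1 = 2 ↔ e.b.1 = 2 := by omega
    have e2 : ((4 : ℕ) : ℤ) - e.a.1 = 2 ↔ e.a.1 = 2 := by omega
    have e3 : ((4 : ℕ) : ℤ) - e.a.1 = ((4 : ℕ) : ℤ) - e.a.2 ↔ e.a.1 = e.a.2 := by omega
    simp only [e1, e2, e3, and_self]
  let x₀ : (gridSys h4 h4).I → ℝ := Quotient.lift left₄ (by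
    rintro e e' (rfl | rfl)
    · rfl
    · exact (hinv e).1.symm)
  let y₀ : (gridSys h4 h4).I → ℝ := Quotient.lift bottom₄ (by
    rintro e e' (rfl | rfl)
    · rfl
    · exact (hinv e).2.symm)
  have hs : 0 < √(2 : ℝ) := by positivity
  refine (isSurface_qXe h4 h4).isTorus hs two_pos x₀ y₀ ?_ ?_ ?_ ?_ ?_ ?_ ?_ ?_
  · rintro ⟨e⟩
    exact left₄_east e
  · rintro ⟨e⟩
    rfl
  · rintro ⟨e⟩
    exact bottom₄_north e
  · rintro ⟨e⟩
    rfl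
  · rintro ⟨e⟩
    change 0 ≤ left₄ e ∧ left₄ e + width e ≤ √2
    rw [width_four]
    unfold left₄
    split_ifs <;> constructor <;> linarith
  · rintro ⟨e⟩
    change 0 ≤ bottom₄ e ∧ bottom₄ e + height e ≤ 2
    rw [height_four]
    unfold bottom₄
    split_ifs <;> constructor <;> norm_num
  · intro x y h1 h2 h3 h4'
    obtain ⟨e, he⟩ := exists_edge_four x y h1 h2 h3 h4'
    exact ⟨gcls h4 h4 e, he⟩
  · rintro ⟨e⟩ ⟨e'⟩ x y h h'
    exact (cls_eq h4 h4).2 (eq_or_eq_iota_of_four h4 h h')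

theorem isTorus_of_le_four (hm : Even m) (hn : Even n) (hmn : 6 ≤ m * n) (h : m ≤ 4 ∧ n ≤ 4) :
    IsTorus (Xe m n hm hn) := by
  obtain ⟨h1, h2, h3⟩ := two_le_of_even hm hn hmn
  have hm' := Nat.even_iff.1 hm
  have hn' := Nat.even_iff.1 hn
  by_cases h4 : m = 4 ∧ n = 4
  · obtain ⟨rfl, rfl⟩ := h4
    exact isTorus_four_four hm
  · exact isTorus_two_four hm hn (by omega)

end GridSurface
end

noncomputable section

namespace GridSurface

variable {m n : ℕ}

/-! ### The arithmetic of the two cases -/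

theorem exists_gcd_data (hm : Even m) (hn : Even n) (hm0 : 0 < m) (hn0 : 0 < n) :
    ∃ g a b : ℕ, 0 < g ∧ 0 < a ∧ 0 < b ∧ a.Coprime b ∧ m = 2 * g * a ∧ n = 2 * g * b ∧
      Nat.gcd m n = 2 * g ∧ m / Nat.gcd m n = a ∧ n / Nat.gcd m n = b := by
  obtain ⟨g, hg⟩ : 2 ∣ Nat.gcd m n := Nat.dvd_gcd hm.two_dvd hn.two_dvd
  have hpos : 0 < Nat.gcd m n := Nat.gcd_pos_of_pos_left _ hm0
  have h1 : m = Nat.gcd m n * (m / Nat.gcd m n) := (Nat.mul_div_cancel' (Nat.gcd_dvd_left m n)).symm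
  have h2 : n = Nat.gcd m n * (n / Nat.gcd m n) :=
    (Nat.mul_div_cancel' (Nat.gcd_dvd_right m n)).symm
  refine ⟨g, m / Nat.gcd m n, n / Nat.gcd m n, by omega,
    Nat.div_pos (Nat.le_of_dvd hm0 (Nat.gcd_dvd_left m n)) hpos,
    Nat.div_pos (Nat.le_of_dvd hn0 (Nat.gcd_dvd_right m n)) hpos,
    Nat.coprime_div_gcd_div_gcd hpos, ?_, ?_, hg, rfl, rfl⟩
  · rw [← hg]; exact h1
  · rw [← hg]; exact h2

/-- The edges that unfold all have the multiplicity `N`, and there are `Z` vertices on them. -/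
structure VertexData (hm : Even m) (hn : Even n) (Z N : ℕ) : Prop where
  pos : 0 < N
  mult : ∀ i ∈ active hm hn, (gridSys hm hn).mult i = N
  ncard : (active hm hn).ncard = Z * N

theorem vertexData (hm : Even m) (hn : Even n) (hmn : 6 ≤ m * n) {g a b N Z : ℕ}
    (hg : 0 < g) (ha : 0 < a) (hb : 0 < b) (hab : a.Coprime b) (hma : m = 2 * g * a)
    (hnb : n = 2 * g * b)
    (hN : (a % 2 = 1 ∧ b % 2 = 1) ∧ 2 * N + a + b = 2 * g * a * b ∧ Z = 2 * g ∨
      ¬ (a % 2 = 1 ∧ b % 2 = 1) ∧ N + a + b = 2 * g * a * b ∧ Z = g) :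
    VertexData hm hn Z N := by
  have hcard : (active hm hn).ncard = Z * N := by
    have h := ncard_active hm hn (p := g * a) (q := g * b) (by rw [hma]; ring) (by rw [hnb]; ring)
      (by positivity) (by positivity)
    rcases hN with ⟨-, h1, rfl⟩ | ⟨-, h1, rfl⟩
    · have : g * (2 * N + a + b) = g * (2 * g * a * b) := by rw [h1]
      linarith
    · have : Z * (N + a + b) = Z * (2 * Z * a * b) := by rw [h1]
      linarith
  refine ⟨?_, ?_, hcard⟩
  -- For `N = 0` the numbers `P = ga` and `Q = gb` satisfy `P + Q = 2PQ`, so `P = Q = 1`; this is `m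
  -- = n = 2`, excluded by `mn ≥ 6`.
  · by_contra h0
    obtain rfl : N = 0 := by omega
    have h1 : a + b = 2 * g * a * b := by
      rcases hN with ⟨-, h1, -⟩ | ⟨-, h1, -⟩ <;> omega
    have h2 : 2 ≤ g * a * (g * b) := by
      rw [hma, hnb] at hmn
      nlinarith
    have h3 : g * a + g * b = 2 * (g * a) * (g * b) := by
      rw [← mul_add, h1]; ring
    have h4 : 1 ≤ g * a := Nat.mul_pos hg ha
    have h5 : 1 ≤ g * b := Nat.mul_pos hg hb
    generalize g * a = P at *
    generalize g * b = Q at *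
    nlinarith
  · rintro _ ⟨e, ⟨x, y, X, Y, h⟩, rfl⟩
    exact h.mult_gcls hm hn hmn hg ha hab hma hnb (hN.imp (fun h => ⟨h.1, h.2.1⟩)
      (fun h => ⟨h.1, h.2.1⟩))

/-- All other vertices cancel against their rectangles, so the Euler characteristic is `Z - ZN`. -/
theorem VertexData.hasGenus {hm : Even m} {hn : Even n} {Z N G : ℕ} (h : VertexData hm hn Z N)
    (hG : Z * N + 2 = 2 * G + Z) : HasGenus (Xe m n hm hn) G := by
  have h1 := (isSurface_qXe hm hn).hasEulerChar
  rw [RectSystem.card_orb_sub h.mult (mult_of_notMem_active hm hn) h.ncard h.pos, h.ncard] at h1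
  have h2 : ((Z * N : ℕ) : ℤ) + 2 = 2 * G + Z := by exact_mod_cast hG
  have h3 : (2 : ℤ) - 2 * G = Z - (Z * N : ℕ) := by linarith
  unfold HasGenus
  rwa [h3]

/-- Multiplied by `g`, the equation `N = 1` reads `2g + P + Q = 2PQ` with `P = ga`, `Q = gb` and `g
≤ P, Q`. If `P, Q ≥ 2` and one of them exceeds `2`, the right side is too large; hence one is `1`,
and the other is `3`. -/
theorem not_one_of_odd {g a b : ℕ} (hg : 0 < g) (ha : 0 < a) (hb : 0 < b)
    (h4 : 4 < 2 * g * a ∨ 4 < 2 * g * b) (h : 2 + a + b = 2 * g * a * b) :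
    2 * g * a = 2 ∧ 2 * g * b = 6 ∨ 2 * g * a = 6 ∧ 2 * g * b = 2 := by
  have hP : g ≤ g * a := Nat.le_mul_of_pos_right _ ha
  have hQ : g ≤ g * b := Nat.le_mul_of_pos_right _ hb
  have h1 : 2 * g + g * a + g * b = 2 * (g * a) * (g * b) := by
    have : g * (2 + a + b) = g * (2 * g * a * b) := by rw [h]
    linarith
  rw [mul_assoc, mul_assoc] at h4 ⊢
  generalize g * a = P at *
  generalize g * b = Q at *
  clear h
  have h2 : P = 1 ∨ Q = 1 := by
    by_contra hc
    have : 2 ≤ P ∧ 2 ≤ Q := by omega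
    rcases h4 with h4 | h4 <;> nlinarith
  rcases h2 with rfl | rfl <;> omega

theorem not_one_of_not_odd {g a b : ℕ} (hg : 0 < g) (ha : 0 < a) (hb : 0 < b)
    (h4 : 4 < 2 * g * a ∨ 4 < 2 * g * b) (h : 1 + a + b = 2 * g * a * b) : False := by
  have hP : g ≤ g * a := Nat.le_mul_of_pos_right _ ha
  have hQ : g ≤ g * b := Nat.le_mul_of_pos_right _ hb
  have h1 : g + g * a + g * b = 2 * (g * a) * (g * b) := by
    have : g * (1 + a + b) = g * (2 * g * a * b) := by rw [h]
    linarith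
  rw [mul_assoc, mul_assoc] at h4
  generalize g * a = P at *
  generalize g * b = Q at *
  clear h
  have h2 : P = 1 ∨ Q = 1 := by
    by_contra hc
    have : 2 ≤ P ∧ 2 ≤ Q := by omega
    rcases h4 with h4 | h4 <;> nlinarith
  rcases h2 with rfl | rfl <;> omega

end GridSurface
end

/-! ### Assembling the theorem -/

theorem mainTheorem7 (m n : ℕ) (hm : Even m) (hn : Even n) (hmn : 6 ≤ m * n) :
    GridSurface.IsTranslationSurface (GridSurface.projXe hm hn) ∧
    (m ≤ 4 ∧ n ≤ 4 → GridSurface.IsTorus (GridSurface.Xe m n hm hn)) ∧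
    (4 < m ∨ 4 < n →
      (Odd (m / Nat.gcd m n) ∧ Odd (n / Nat.gcd m n) →
        (∃ g : ℕ, (g : ℚ) = ((m : ℚ) * n - m - n - 2 * Nat.gcd m n) / 4 + 1 ∧
          GridSurface.HasGenus (GridSurface.Xe m n hm hn) g) ∧
        (¬ (m = 2 ∧ n = 6) ∧ ¬ (m = 6 ∧ n = 2) →
          (GridSurface.zeros (GridSurface.projXe hm hn)).ncard = Nat.gcd m n ∧
          ∃ k : ℕ, (k : ℚ) = ((m : ℚ) * n - m - n) / (2 * Nat.gcd m n) - 1 ∧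
            ∀ x ∈ GridSurface.zeros (GridSurface.projXe hm hn),
              GridSurface.HasOrder (GridSurface.projXe hm hn) x k) ∧
        ((m = 2 ∧ n = 6) ∨ (m = 6 ∧ n = 2) →
          GridSurface.zeros (GridSurface.projXe hm hn) = ∅)) ∧
      (¬ (Odd (m / Nat.gcd m n) ∧ Odd (n / Nat.gcd m n)) →
        (∃ g : ℕ, (g : ℚ) = ((m : ℚ) * n - m - n - Nat.gcd m n) / 4 + 1 ∧
          GridSurface.HasGenus (GridSurface.Xe m n hm hn) g) ∧
        ((GridSurface.zeros (GridSurface.projXe hm hn)).ncard : ℚ) = (Nat.gcd m n : ℚ) / 2 ∧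
        ∃ k : ℕ, (k : ℚ) = ((m : ℚ) * n - m - n) / Nat.gcd m n - 1 ∧
          ∀ x ∈ GridSurface.zeros (GridSurface.projXe hm hn),
            GridSurface.HasOrder (GridSurface.projXe hm hn) x k)) := by
  refine ⟨GridSurface.isTranslationSurface_projXe hm hn hmn,
    GridSurface.isTorus_of_le_four hm hn hmn, fun h4 => ?_⟩
  obtain ⟨h2m, h2n, -⟩ := GridSurface.two_le_of_even hm hn hmn
  obtain ⟨g, a, b, hg, ha, hb, hab, hma, hnb, hgcd, hda, hdb⟩ :=
    GridSurface.exists_gcd_data hm hn (by omega) (by omega)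
  have hM' := GridSurface.mult_of_notMem_active hm hn
  rw [hda, hdb, hgcd, Nat.odd_iff, Nat.odd_iff]
  have hle : a + b ≤ 2 * g * a * b := by
    have h1 : 1 ≤ g * a := Nat.mul_pos hg ha
    have h2 : 1 ≤ g * b := Nat.mul_pos hg hb
    nlinarith
  have hmq : (m : ℚ) = 2 * g * a := by exact_mod_cast hma
  have hnq : (n : ℚ) = 2 * g * b := by exact_mod_cast hnb
  have hgq : (g : ℚ) ≠ 0 := by exact_mod_cast hg.ne'
  have h4' : 4 < 2 * g * a ∨ 4 < 2 * g * b := by rwa [← hma, ← hnb]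
  constructor
  · intro hodd
    obtain ⟨N, hN⟩ : ∃ N, 2 * N + a + b = 2 * g * a * b := by
      have he : Even (2 * g * a * b) := by
        rw [mul_assoc, mul_assoc]
        exact even_two_mul _
      rw [Nat.even_iff] at he
      exact ⟨(2 * g * a * b - a - b) / 2, by omega⟩
    have hV := GridSurface.vertexData hm hn hmn hg ha hb hab hma hnb
      (Or.inl ⟨hodd, hN, rfl⟩)
    have hNpos := hV.pos
    have hNq : 2 * (N : ℚ) + a + b = 2 * g * a * b := by exact_mod_cast hN
    have hkq : ((N - 1 : ℕ) : ℚ) = N - 1 := by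
      rw [Nat.cast_sub hNpos, Nat.cast_one]
    have hE : (m : ℚ) * n - m - n = 4 * g * N := by
      rw [hmq, hnq]
      linear_combination (-2 * (g : ℚ)) * hNq
    rw [hE]
    refine ⟨⟨g * (N - 1) + 1, ?_, hV.hasGenus ?_⟩, fun h26 => ⟨?_, N - 1, ?_, ?_⟩, fun h26 => ?_⟩
    · push_cast
      rw [hkq]
      ring
    · obtain ⟨N, rfl⟩ : ∃ N', N = N' + 1 := ⟨N - 1, by omega⟩
      simp only [Nat.add_sub_cancel]
      ring
    · refine GridSurface.ncard_zeros_eq hm hn hV.mult hM' hV.ncard ?_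
      by_contra hN1
      obtain rfl : N = 1 := by omega
      have := GridSurface.not_one_of_odd hg ha hb h4' (by omega)
      rw [← hma, ← hnb] at this
      omega
    · rw [hkq]
      push_cast
      field_simp
      ring
    · exact fun x hx => GridSurface.hasOrder_of_mem_zeros hm hn hV.mult hM' hx
    · refine GridSurface.zeros_eq_empty hm hn hV.mult hM' ?_
      -- One of `m`, `n` is `2`, so the greatest common divisor is `2`; then `a` and `b` are `1` and
      -- `3` in some order, and `N = 1`.
      have h1 : g * a = 1 ∨ g * b = 1 := by
        rw [mul_assoc] at hma hnb
        omega
      obtain rfl : g = 1 := h1.elim Nat.eq_one_of_mul_eq_one_right Nat.eq_one_of_mul_eq_one_right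
      rcases h26 with ⟨h2, h6⟩ | ⟨h6, h2⟩
      · obtain rfl : a = 1 := by omega
        obtain rfl : b = 3 := by omega
        omega
      · obtain rfl : b = 1 := by omega
        obtain rfl : a = 3 := by omega
        omega
  · intro hodd
    obtain ⟨N, hN⟩ : ∃ N, N + a + b = 2 * g * a * b := ⟨2 * g * a * b - a - b, by omega⟩
    have hV := GridSurface.vertexData hm hn hmn hg ha hb hab hma hnb
      (Or.inr ⟨hodd, hN, rfl⟩)
    have hNpos := hV.pos
    have hNq : (N : ℚ) + a + b = 2 * g * a * b := by exact_mod_cast hN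
    have hkq : ((N - 1 : ℕ) : ℚ) = N - 1 := by
      rw [Nat.cast_sub hNpos, Nat.cast_one]
    have hE : (m : ℚ) * n - m - n = 2 * g * N := by
      rw [hmq, hnq]
      linear_combination (-2 * (g : ℚ)) * hNq
    -- Exactly one of `a`, `b` is odd and `2gab` is even. Hence `N - 1` is even, which makes the
    -- genus `g(N - 1)/2 + 1` an integer.
    have hNodd : N % 2 = 1 := by
      have he : Even (2 * g * a * b) := by
        rw [mul_assoc, mul_assoc]
        exact even_two_mul _
      rw [Nat.even_iff] at he
      have hab2 : ¬ (a % 2 = 0 ∧ b % 2 = 0) := by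
        rintro ⟨h1, h2⟩
        have := Nat.dvd_gcd (Nat.dvd_of_mod_eq_zero h1) (Nat.dvd_of_mod_eq_zero h2)
        rw [hab] at this
        omega
      omega
    have hN2 : 2 ≤ N := by
      by_contra hN1
      obtain rfl : N = 1 := by omega
      exact GridSurface.not_one_of_not_odd hg ha hb h4' hN
    rw [hE]
    refine ⟨?_, ?_, N - 1, ?_, ?_⟩
    · obtain ⟨c, rfl⟩ : ∃ c, N = 2 * c + 1 := ⟨N / 2, by omega⟩
      refine ⟨g * c + 1, ?_, hV.hasGenus ?_⟩
      · push_cast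
        ring
      · ring
    · rw [GridSurface.ncard_zeros_eq hm hn hV.mult hM' hV.ncard hN2]
      push_cast
      ring
    · rw [hkq]
      push_cast
      field_simp
    · exact fun x hx => GridSurface.hasOrder_of_mem_zeros hm hn hV.mult hM' hx
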